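/- **Conventions.** All manifolds are smooth, Hausdorff, $\sigma$-compact and without boundary, and all objects are smooth. For $(0,2)$-tensors $k,l$ and a $(1,1)$-tensor $K$ put $k^s(X,Y)=\tfrac12(k(X,Y)+k(Y,X))$, $k^a(X,Y)=\tfrac12(k(X,Y)-k(Y,X))$, $k_J(X,Y)=k(X,JY)$, $(J^*k)(X,Y)=k(JX,JY)$ and $(l\wedge K)_{X,Y}Z=l(X,Z)KY-l(Y,Z)KX$. For a torsion-free connection $D$ with curvature $R^D_{X,Y}=[D_X,D_Y]-D_{[X,Y]}$ put $Ric^D(Y,Z)=\mathrm{Tr}(X\mapsto R^D_{X,Y}Z)$, and for a $(0,2)$-tensor $k$ and a $(1,2)$-tensor $B$ put $(d^Dk)(X,Y,Z)=(D_Xk)(Y,Z)-(D_Yk)(X,Z)$ and $(d^DB)_{X,Y}Z=(D_XB)_YZ-(D_YB)_XZ$. Exterior derivatives of one-forms are $d\gamma(X,Y)=X\gamma(Y)-Y\gamma(X)-\gamma([X,Y])$. Complex manifolds are manifolds with an integrable almost complex structure $J$ (that is, with vanishing Nijenhuis tensor), and $D$ is complex if $DJ=0$. On a complex manifold $(M,J)$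 of real dimension $2n\ge4$ the Rho tensor and the c-projective Weyl curvature of a torsion-free complex connection $D$ are $$P^D=\tfrac1{n+1}\Big(Ric^D+\tfrac1{n-1}\big((Ric^D)^s-J^*(Ric^D)^s\big)\Big),$$ $$W^{[D]}=R^D+(P^D)^a\otimes\mathrm{Id}-(P^D_J)^a\otimes J+\tfrac12P^D\wedge\mathrm{Id}-\tfrac12P^D_J\wedge J.$$ Torsion-free complex connections $D^1,D^2$ are c-projectively related if $D^1_XY=D^2_XY+\theta(X)Y+\theta(Y)X-\theta(JX)JY-\theta(JY)JX$ for a one-form $\theta$; the class of $D$ is its c-projective structure $[D]$. A *conical special complex manifold* $(M,J,\nabla,\xi)$ is a complex manifold $(M,J)$ with a flat torsion-free connection $\nabla$ such that $(\nabla_XJ)Y=(\nabla_YJ)X$, and a nowhere vanishing vector field $\xi$ with $\nabla\xi=\mathrm{Id}$ and $L_\xi J=0$. If there is a principal $\mathbb C^*$-bundle $\pi:M\to\bar M$ with holomorphic $\mathbb C^*$-action and holomorphic projection onto a complex manifold $(\bar M,\bar J)$, such that the fundamental vector fields of $1$ and $\sqrt{-1}$ are $\xi$ and $J\xi$, then $(\bar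 M,\bar J)$ is called a *projective special complex manifold*, realized as the $\mathbb C^*$-quotient of $M$. Its *canonical c-projective structure* is the class of the connection $D^{(\omega)}_XY=\pi_*(D_{\tilde X}\tilde Y)$, where $D=\nabla-\tfrac12J(\nabla J)$, $\omega$ is a principal connection with $J$-invariant kernel and $\tilde X,\tilde Y$ are the $\omega$-horizontal lifts of $X,Y$; the class does not depend on $\omega$. **Statement.** Let $(\bar M,\bar J)$ be a complex manifold of real dimension $2n\ge4$ with a torsion-free complex connection $\bar D$. Let $\bar B$ be a symmetric $(1,2)$-tensor on $\bar M$ with $\bar B_X\bar J=-\bar J\bar B_X$, let $\bar c$ be a symmetric $(0,2)$-tensor on $\bar M$ with $\bar J^*\bar c=-\bar c$, and let $\gamma$ be a one-form on $\bar M$. Put $$\bar{\mathcal B}(X,Y)=\mathrm{Tr}(\bar B_X\bar B_Y),\qquad \bar a=\tfrac1{8(n+1)}\bar{\mathcal B}-\tfrac12P^{\bar D}.$$ Suppose that for all tangent vectors $X,Y,Z$ $$W^{[\bar D]}=-\tfrac14[\bar B,\bar B]-\tfrac1{4(n+1)}\bar{\mathcal B}_{\bar J}\otimes\bar J+\tfrac1{8(n+1)}\bar{\mathcal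 B}\wedge\mathrm{Id}-\tfrac1{8(n+1)}\bar{\mathcal B}_{\bar J}\wedge\bar J,$$ where $[\bar B,\bar B]_{X,Y}=[\bar B_X,\bar B_Y]$, $$(d^{\bar D}\bar a)(X,Y,Z)=-\tfrac14\big(\bar c(X,\bar B_YZ)-\bar c(Y,\bar B_XZ)\big),$$ $$d\gamma=2(\bar a_{\bar J})^a,$$ $$(d^{\bar D}\bar B)_{X,Y}Z=-2\big(\gamma(X)\bar J\bar B_YZ-\gamma(Y)\bar J\bar B_XZ\big)+(\bar c\wedge\mathrm{Id}+\bar c_{\bar J}\wedge\bar J)_{X,Y}Z,$$ $$\bar a(X,\bar B_YZ)-\bar a(Y,\bar B_XZ)+(d^{\bar D}\bar c)(X,Y,Z)=2\big(\gamma(X)\bar c_{\bar J}(Y,Z)-\gamma(Y)\bar c_{\bar J}(X,Z)\big).$$ Then $M=\bar M\times S^1\times\mathbb R^{>0}$, with the projection $\pi$ to the first factor and the standard action $z\cdot(x,s,r)=(x,\tfrac z{|z|}s,|z|r)$ of $\mathbb C^*$, carries a conical special complex structure $(J,\nabla,\xi)$ by which $(\bar M,\bar J)$ is realized as a projective special complex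 manifold, namely as the $\mathbb C^*$-quotient of $(M,J,\nabla,\xi)$, and the canonical c-projective structure induced on $\bar M$ by $(J,\nabla,\xi)$ is $[\bar D]$. -/

import Mathlib

open scoped Manifold ContDiff Bundle

noncomputable section

namespace CProj

/-! ## Tensor fields and connections on a manifold -/

section Tensors

variable {E : Type*} [NormedAddCommGroup E] [NormedSpace ℝ E]
  {H : Type*} [TopologicalSpace H] (I : ModelWithCorners ℝ E H)
  (M : Type*) [TopologicalSpace M] [ChartedSpace H M]

/-- Vector fields. -/
abbrev VField := ∀ x : M, TangentSpace I x

/-- Fields of endomorphisms, i.e. `(1,1)`-tensor fields. -/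
abbrev EndField := ∀ x : M, TangentSpace I x →L[ℝ] TangentSpace I x

/-- Real one-forms. -/
abbrev OneForm := ∀ x : M, TangentSpace I x →L[ℝ] ℝ

/-- Complex-valued one-forms. -/
abbrev COneForm := ∀ x : M, TangentSpace I x →L[ℝ] ℂ

/-- `(0,2)`-tensor fields. -/
abbrev Tensor02 := ∀ x : M, TangentSpace I x →L[ℝ] TangentSpace I x →L[ℝ] ℝ

/-- `(1,2)`-tensor fields; `B x u v` is `B_u v`. -/
abbrev Tensor12 :=
  ∀ x : M, TangentSpace I x →L[ℝ] TangentSpace I x →L[ℝ] TangentSpace I x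

/-- Functions of two tangent vectors with real values. They are used for expressions which are
bilinear by construction, such as the Ricci tensor. -/
abbrev Form2 := ∀ x : M, TangentSpace I x → TangentSpace I x → ℝ

variable [IsManifold I ∞ M]

/-- Affine connections; `D Y x u` is `D_u Y` at the point `x`. -/
abbrev AffConn := CovariantDerivative I E (TangentSpace I : M → Type _)

variable {I M}

def SmoothVField (X : VField I M) : Prop :=
  ContMDiff I (I.prod 𝓘(ℝ, E)) ∞
    (fun x ↦ (Bundle.TotalSpace.mk' E x (X x) : TangentBundle I M))

def SmoothEnd (K : EndField I M) : Prop :=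
  ContMDiff I (I.prod 𝓘(ℝ, E →L[ℝ] E)) ∞
    (fun x ↦ Bundle.TotalSpace.mk' (E →L[ℝ] E)
      (E := fun x : M ↦ TangentSpace I x →L[ℝ] TangentSpace I x) x (K x))

def SmoothOneForm (θ : OneForm I M) : Prop :=
  ContMDiff I (I.prod 𝓘(ℝ, E →L[ℝ] ℝ)) ∞
    (fun x ↦ Bundle.TotalSpace.mk' (E →L[ℝ] ℝ)
      (E := fun x : M ↦ TangentSpace I x →L[ℝ] Bundle.Trivial M ℝ x) x (θ x))

def SmoothCOneForm (θ : COneForm I M) : Prop :=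
  ContMDiff I (I.prod 𝓘(ℝ, E →L[ℝ] ℂ)) ∞
    (fun x ↦ Bundle.TotalSpace.mk' (E →L[ℝ] ℂ)
      (E := fun x : M ↦ TangentSpace I x →L[ℝ] Bundle.Trivial M ℂ x) x (θ x))

def SmoothTensor02 (c : Tensor02 I M) : Prop :=
  ContMDiff I (I.prod 𝓘(ℝ, E →L[ℝ] E →L[ℝ] ℝ)) ∞
    (fun x ↦ Bundle.TotalSpace.mk' (E →L[ℝ] E →L[ℝ] ℝ)
      (E := fun x : M ↦ TangentSpace I x →L[ℝ] TangentSpace I x →L[ℝ] Bundle.Trivial M ℝ x)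
      x (c x))

def SmoothTensor12 (B : Tensor12 I M) : Prop :=
  ContMDiff I (I.prod 𝓘(ℝ, E →L[ℝ] E →L[ℝ] E)) ∞
    (fun x ↦ Bundle.TotalSpace.mk' (E →L[ℝ] E →L[ℝ] E)
      (E := fun x : M ↦ TangentSpace I x →L[ℝ] TangentSpace I x →L[ℝ] TangentSpace I x)
      x (B x))

/-- A vector field which takes the value `v` at `x` and is smooth near `x`. Every expression below
in which it occurs is tensorial, so that its value does not depend on the extension. -/
def ext {x : M} (v : TangentSpace I x) : VField I M := FiberBundle.extend E v

/-! ### Almost complex structures -/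

/-- The Nijenhuis tensor `[JX, JY] - J[JX, Y] - J[X, JY] - [X, Y]`. -/
def nijenhuis (J : EndField I M) (x : M) (u v : TangentSpace I x) : TangentSpace I x :=
  VectorField.mlieBracket I (fun y ↦ J y (ext u y)) (fun y ↦ J y (ext v y)) x
    - J x (VectorField.mlieBracket I (fun y ↦ J y (ext u y)) (ext v) x)
    - J x (VectorField.mlieBracket I (ext u) (fun y ↦ J y (ext v y)) x)
    - VectorField.mlieBracket I (ext u) (ext v) x

/-- `(M, J)` is a complex manifold: `J` is an integrable smooth almost complex structure. -/
structure IsComplexStructure (J : EndField I M) : Prop where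
  smooth : SmoothEnd J
  sq : ∀ (x : M) (v : TangentSpace I x), J x (J x v) = -v
  integrable : ∀ (x : M) (u v : TangentSpace I x), nijenhuis J x u v = 0

/-- The Lie derivative `(L_ξ J) v = [ξ, JV] - J[ξ, V]`. -/
def lieDerivEnd (ξ : VField I M) (J : EndField I M) (x : M) (v : TangentSpace I x) :
    TangentSpace I x :=
  VectorField.mlieBracket I ξ (fun y ↦ J y (ext v y)) x
    - J x (VectorField.mlieBracket I ξ (ext v) x)

/-! ### Covariant derivatives and curvature -/

/-- `(D_u K) v` for a `(1,1)`-tensor field `K`. -/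
def covEnd (D : AffConn I M) (K : EndField I M) (x : M) (u v : TangentSpace I x) :
    TangentSpace I x :=
  D (fun y ↦ K y (ext v y)) x u - K x (D (ext v) x u)

/-- `(D_u k)(v, w)` for a `(0,2)`-tensor field `k`. -/
def covForm2 (D : AffConn I M) (k : Form2 I M) (x : M) (u v w : TangentSpace I x) : ℝ :=
  mvfderiv I (fun y ↦ k y (ext v y) (ext w y)) x u
    - k x (D (ext v) x u) w - k x v (D (ext w) x u)

/-- `(D_u B)_v w` for a `(1,2)`-tensor field `B`. -/
def covTensor12 (D : AffConn I M) (B : Tensor12 I M) (x : M) (u v w : TangentSpace I x) :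
    TangentSpace I x :=
  D (fun y ↦ B y (ext v y) (ext w y)) x u - B x (D (ext v) x u) w - B x v (D (ext w) x u)

/-- The exterior covariant derivative `(d^D k)(u, v, w) = (D_u k)(v, w) - (D_v k)(u, w)` of a
`(0,2)`-tensor field, for a torsion-free connection. -/
def dForm2 (D : AffConn I M) (k : Form2 I M) (x : M) (u v w : TangentSpace I x) : ℝ :=
  covForm2 D k x u v w - covForm2 D k x v u w

/-- The exterior covariant derivative `(d^D B)(u, v) w = (D_u B)_v w - (D_v B)_u w` of a
`(1,2)`-tensor field, for a torsion-free connection. -/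
def dTensor12 (D : AffConn I M) (B : Tensor12 I M) (x : M) (u v w : TangentSpace I x) :
    TangentSpace I x :=
  covTensor12 D B x u v w - covTensor12 D B x v u w

/-- The exterior derivative `dγ(X, Y) = X(γ(Y)) - Y(γ(X)) - γ([X, Y])` of a one-form. -/
def extDerivOneForm (γ : OneForm I M) (x : M) (u v : TangentSpace I x) : ℝ :=
  mvfderiv I (fun y ↦ γ y (ext v y)) x u - mvfderiv I (fun y ↦ γ y (ext u y)) x v
    - γ x (VectorField.mlieBracket I (ext u) (ext v) x)

/-- The curvature tensor `R_{X,Y} Z = D_X D_Y Z - D_Y D_X Z - D_{[X,Y]} Z`. -/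
def curv (D : AffConn I M) (x : M) (u v w : TangentSpace I x) : TangentSpace I x :=
  D (fun y ↦ D (ext w) y (ext v y)) x u - D (fun y ↦ D (ext w) y (ext u y)) x v
    - D (ext w) x (VectorField.mlieBracket I (ext u) (ext v) x)

/-- The Ricci tensor `Ric(v, w) = Tr (u ↦ R_{u,v} w)`, the trace being computed in a basis of
the model space `E`, which is the tangent space as a vector space. -/
def ricci [FiniteDimensional ℝ E] (D : AffConn I M) : Form2 I M := fun x v w ↦
  ∑ i, (Module.finBasis ℝ E).coord i (curv D x (Module.finBasis ℝ E i) v w)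

/-! ### Algebraic operations on tensors -/

/-- Symmetrization `k^s`. -/
def symm (k : Form2 I M) : Form2 I M := fun x u v ↦ (k x u v + k x v u) / 2

/-- Anti-symmetrization `k^a`. -/
def asymm (k : Form2 I M) : Form2 I M := fun x u v ↦ (k x u v - k x v u) / 2

/-- The tensor `k_J(u, v) = k(u, Jv)`. -/
def twist (J : EndField I M) (k : Form2 I M) : Form2 I M := fun x u v ↦ k x u (J x v)

/-- The pull-back `(J^* k)(u, v) = k(Ju, Jv)`. -/
def pullJ (J : EndField I M) (k : Form2 I M) : Form2 I M := fun x u v ↦ k x (J x u) (J x v)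

/-- A `(0,2)`-tensor field as a function of two vectors. -/
def Tensor02.form (c : Tensor02 I M) : Form2 I M := fun x u v ↦ c x u v

/-- `(l ∧ K)_{u,v} w = l(u, w) K v - l(v, w) K u`. -/
def wedge (l : Form2 I M) (K : EndField I M) (x : M) (u v w : TangentSpace I x) :
    TangentSpace I x :=
  l x u w • K x v - l x v w • K x u

/-- The identity field. -/
def idEnd : EndField I M := fun x ↦ ContinuousLinearMap.id ℝ (TangentSpace I x)

/-- `𝓑(u, v) = Tr (B_u ∘ B_v)`. -/
def traceForm (B : Tensor12 I M) : Form2 I M := fun x u v ↦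
  LinearMap.trace ℝ (TangentSpace I x)
    ((B x u ∘L B x v : TangentSpace I x →L[ℝ] TangentSpace I x) :
      TangentSpace I x →ₗ[ℝ] TangentSpace I x)

/-! ### c-projective geometry in real dimension `2n` -/

variable [FiniteDimensional ℝ E]

/-- The connection `D` is complex: `D J = 0`. -/
def IsComplexConn (J : EndField I M) (D : AffConn I M) : Prop :=
  ∀ (x : M) (u v : TangentSpace I x), covEnd D J x u v = 0

/-- The Rho tensor of a complex connection on a complex manifold of real dimension `2n`. -/
def rho (n : ℕ) (J : EndField I M) (D : AffConn I M) : Form2 I M := fun x u v ↦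
  1 / ((n : ℝ) + 1) * (ricci D x u v
    + 1 / ((n : ℝ) - 1) * (symm (ricci D) x u v - pullJ J (symm (ricci D)) x u v))

/-- The c-projective Weyl curvature
`R + P^a ⊗ Id - (P_J)^a ⊗ J + ½ P ∧ Id - ½ P_J ∧ J`, where `P` is the Rho tensor. -/
def weyl (n : ℕ) (J : EndField I M) (D : AffConn I M) (x : M) (u v w : TangentSpace I x) :
    TangentSpace I x :=
  curv D x u v w
    + asymm (rho n J D) x u v • w
    - asymm (twist J (rho n J D)) x u v • J x w
    + (1 / 2 : ℝ) • wedge (rho n J D) idEnd x u v w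
    - (1 / 2 : ℝ) • wedge (twist J (rho n J D)) J x u v w

/-- The tensor `a = 1/(8(n+1)) 𝓑 - ½ P`. -/
def fundForm (n : ℕ) (J : EndField I M) (D : AffConn I M) (B : Tensor12 I M) : Form2 I M :=
  fun x u v ↦ 1 / (8 * ((n : ℝ) + 1)) * traceForm B x u v - 1 / 2 * rho n J D x u v

variable [CompleteSpace E]

/-- `D` is a smooth torsion-free complex connection on `(M, J)`. -/
structure IsTorsionFreeComplex (J : EndField I M) (D : AffConn I M) : Prop where
  smooth : CovariantDerivative.ContMDiffCovariantDerivative D ∞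
  torsion : D.torsion = 0
  complex : IsComplexConn J D

/-- `D₁` and `D₂` are c-projectively related: for some smooth one-form `θ`,
`D₁_X Y = D₂_X Y + θ(X) Y + θ(Y) X - θ(JX) JY - θ(JY) JX`. -/
def CProjRelated (J : EndField I M) (D₁ D₂ : AffConn I M) : Prop :=
  ∃ θ : OneForm I M, SmoothOneForm θ ∧
    ∀ Y : VField I M, SmoothVField Y → ∀ (x : M) (u : TangentSpace I x),
      D₁ Y x u = D₂ Y x u + θ x u • Y x + θ x (Y x) • u
        - θ x (J x u) • J x (Y x) - θ x (J x (Y x)) • J x u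

/-- The c-projective structure `[D]`: all smooth torsion-free complex connections which are
c-projectively related to `D`. -/
def cprojClass (J : EndField I M) (D : AffConn I M) : Set (AffConn I M) :=
  {D' | IsTorsionFreeComplex J D' ∧ CProjRelated J D' D}

/-! ### Special complex manifolds -/

/-- `(M, J, ∇)` is a special complex manifold: `∇` is flat and torsion-free and `∇J` is
symmetric. -/
structure IsSpecialComplex (J : EndField I M) (nabla : AffConn I M) : Prop where
  complexStructure : IsComplexStructure J
  smooth : CovariantDerivative.ContMDiffCovariantDerivative nabla ∞
  torsion : nabla.torsion = 0
  flat : ∀ (x : M) (u v w : TangentSpace I x), curv nabla x u v w = 0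
  symmetric : ∀ (x : M) (u v : TangentSpace I x), covEnd nabla J x u v = covEnd nabla J x v u

/-- `(M, J, ∇, ξ)` is a conical special complex manifold. -/
structure IsConicalSpecialComplex (J : EndField I M) (nabla : AffConn I M) (ξ : VField I M) :
    Prop where
  special : IsSpecialComplex J nabla
  smooth_field : SmoothVField ξ
  ne_zero : ∀ x : M, ξ x ≠ 0
  nabla_field : ∀ (x : M) (u : TangentSpace I x), nabla ξ x u = u
  lie_field : ∀ (x : M) (v : TangentSpace I x), lieDerivEnd ξ J x v = 0

end Tensors

section Connections

variable {E : Type*} [NormedAddCommGroup E] [NormedSpace ℝ E]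
  {H : Type*} [TopologicalSpace H] {I : ModelWithCorners ℝ E H}
  {M : Type*} [TopologicalSpace M] [ChartedSpace H M] [IsManifold I ∞ M]

/-- The complex connection `D = ∇ - ½ J (∇J)` of a special complex manifold, as an operator on
vector fields: `D_u Y = ∇_u Y - ½ J (∇_u (JY) - J ∇_u Y)`. -/
def complexConn (J : EndField I M) (nabla : AffConn I M) (Y : VField I M) (x : M)
    (u : TangentSpace I x) : TangentSpace I x :=
  nabla Y x u - (1 / 2 : ℝ) • J x (nabla (fun y ↦ J y (Y y)) x u - J x (nabla Y x u))

end Connections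

/-! ## Principal `ℂ^*`-bundles -/

section Principal

variable {E : Type*} [NormedAddCommGroup E] [NormedSpace ℝ E]
  {H : Type*} [TopologicalSpace H] (I : ModelWithCorners ℝ E H)
  {M : Type*} [TopologicalSpace M] [ChartedSpace H M]
  {E' : Type*} [NormedAddCommGroup E'] [NormedSpace ℝ E']
  {H' : Type*} [TopologicalSpace H'] (I' : ModelWithCorners ℝ E' H')
  {N : Type*} [TopologicalSpace N] [ChartedSpace H' N]

/-- The element `e^w` of the group `ℂ^*`. -/
def expUnit (w : ℂ) : ℂˣ := Units.mk0 (Complex.exp w) (Complex.exp_ne_zero w)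

/-- `act` is an action of `ℂ^*` on `M` which makes `pr : M → N` a smooth principal
`ℂ^*`-bundle. -/
structure IsPrincipalBundle (act : ℂˣ → M → M) (pr : M → N) : Prop where
  act_one : ∀ p, act 1 p = p
  act_mul : ∀ z w p, act (z * w) p = act z (act w p)
  smooth_act : ContMDiff (𝓘(ℝ, ℂ).prod I) I ∞ (fun q : ℂˣ × M ↦ act q.1 q.2)
  smooth_proj : ContMDiff I I' ∞ pr
  proj_act : ∀ z p, pr (act z p) = pr p
  /-- Smooth equivariant local trivializations `pr⁻¹(U) ≅ U × ℂ^*`. -/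
  locallyTrivial : ∀ b : N, ∃ (U : Set N) (e : OpenPartialHomeomorph M (N × ℂˣ)),
    IsOpen U ∧ b ∈ U ∧ e.source = pr ⁻¹' U ∧ e.target = U ×ˢ Set.univ ∧
    ContMDiffOn I (I'.prod 𝓘(ℝ, ℂ)) ∞ e e.source ∧
    ContMDiffOn (I'.prod 𝓘(ℝ, ℂ)) I ∞ e.symm e.target ∧
    (∀ p ∈ e.source, (e p).1 = pr p) ∧
    ∀ z, ∀ p ∈ e.source, (e (act z p)).2 = z * (e p).2

variable {I}

/-- The fundamental vector field of the action generated by `w ∈ ℂ = Lie(ℂ^*)`, that is, the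
velocity at `t = 0` of `t ↦ e^{tw} · p`. -/
def fundField (act : ℂˣ → M → M) (w : ℂ) (p : M) : TangentSpace I p :=
  (mfderiv 𝓘(ℝ, ℝ) I (fun t : ℝ ↦ act (expUnit (t * w)) p) 0 : ℝ →L[ℝ] E) 1

/-- `η` is a smooth principal connection form on the `ℂ^*`-bundle. -/
structure IsPrincipalConnection (act : ℂˣ → M → M) (η : COneForm I M) [IsManifold I ∞ M] :
    Prop where
  smooth : SmoothCOneForm η
  fundamental : ∀ (w : ℂ) (p : M), η p (fundField act w p) = w
  invariant : ∀ (z : ℂˣ) (p : M) (v : TangentSpace I p),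
    η (act z p) (mfderiv I I (act z) p v) = η p v

variable {I'}

/-- `Y'` is the `η`-horizontal lift of the vector field `Y` along `pr`. -/
def IsHorizontalLift (pr : M → N) (η : COneForm I M) (Y : VField I' N) (Y' : VField I M) : Prop :=
  ∀ p, η p (Y' p) = 0 ∧ mfderiv I I' pr p (Y' p) = Y (pr p)

variable [IsManifold I ∞ M] [IsManifold I' ∞ N]

/-- `D₀` is the projection to `N` of the connection `D` on `M` along the horizontal
distribution `Ker η`: `pr_* (D_{X'} Y') = D₀_X Y` for the horizontal lifts `X'`, `Y'` of
`X`, `Y`. -/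
def IsProjectedConn (pr : M → N) (η : COneForm I M)
    (D : VField I M → ∀ p : M, TangentSpace I p → TangentSpace I p) (D₀ : AffConn I' N) : Prop :=
  ∀ (Y : VField I' N) (Y' : VField I M), SmoothVField Y → IsHorizontalLift pr η Y Y' →
    ∀ (p : M) (u : TangentSpace I p), η p u = 0 →
      mfderiv I I' pr p (D Y' p u) = D₀ Y (pr p) (mfderiv I I' pr p u)

variable [CompleteSpace E] [FiniteDimensional ℝ E] [CompleteSpace E'] [FiniteDimensional ℝ E']

/-- The base `(N, J')` is a projective special complex manifold: it is the quotient of the conical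
special complex manifold `(M, J, ∇, ξ)` by a principal `ℂ^*`-action with holomorphic action maps
and holomorphic projection, which is generated by `ξ - √-1 J ξ`, i.e. the fundamental vector
fields of `1` and `√-1` are `ξ` and `J ξ`. -/
structure IsProjectiveSpecialQuotient (J : EndField I M) (nabla : AffConn I M) (ξ : VField I M)
    (act : ℂˣ → M → M) (pr : M → N) (J' : EndField I' N) : Prop where
  conical : IsConicalSpecialComplex J nabla ξ
  complexBase : IsComplexStructure J'
  principal : IsPrincipalBundle I I' act pr
  fund_one : ∀ p : M, fundField act 1 p = ξ p
  fund_I : ∀ p : M, fundField act Complex.I p = J p (ξ p)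
  holomorphic_act : ∀ (z : ℂˣ) (p : M) (v : TangentSpace I p),
    mfderiv I I (act z) p (J p v) = J (act z p) (mfderiv I I (act z) p v)
  holomorphic_proj : ∀ (p : M) (v : TangentSpace I p),
    mfderiv I I' pr p (J p v) = J' (pr p) (mfderiv I I' pr p v)

/-- The canonical c-projective structure on the base: the connections which are c-projectively
related to a connection projected from `D = ∇ - ½ J (∇J)` by means of a principal
connection `η` with `J`-invariant kernel. -/
def canonicalCProj (J : EndField I M) (nabla : AffConn I M) (act : ℂˣ → M → M) (pr : M → N)
    (J' : EndField I' N) : Set (AffConn I' N) :=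
  {D' | ∃ (η : COneForm I M) (D₀ : AffConn I' N),
    IsPrincipalConnection act η ∧
    (∀ (p : M) (u : TangentSpace I p), η p u = 0 → η p (J p u) = 0) ∧
    IsTorsionFreeComplex J' D₀ ∧
    IsProjectedConn pr η (complexConn J nabla) D₀ ∧
    D' ∈ cprojClass J' D₀}

end Principal

/-! ## The trivial bundle `N × S¹ × ℝ^{>0}` -/

section Trivial

/-- The manifold `ℝ^{>0}`, an open submanifold of `ℝ`. -/
def posReal : TopologicalSpace.Opens ℝ := ⟨Set.Ioi 0, isOpen_Ioi⟩

/-- The manifold `N × S¹ × ℝ^{>0}`. -/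
abbrev Total (N : Type*) := N × Circle × posReal

/-- The model with corners of `N × S¹ × ℝ^{>0}` for a manifold `N` modelled on `E`. -/
abbrev totalModel (E : Type*) [NormedAddCommGroup E] [NormedSpace ℝ E] :
    ModelWithCorners ℝ (E × EuclideanSpace ℝ (Fin 1) × ℝ)
      (ModelProd E (ModelProd (EuclideanSpace ℝ (Fin 1)) ℝ)) :=
  𝓘(ℝ, E).prod ((𝓡 1).prod 𝓘(ℝ, ℝ))

/-- The phase `z / |z|`. -/
def phase (z : ℂˣ) : Circle :=
  ⟨(z : ℂ) / (‖(z : ℂ)‖ : ℂ), by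
    rw [Submonoid.unitSphere, Submonoid.mem_mk, Subsemigroup.mem_mk, mem_sphere_zero_iff_norm,
      norm_div, Complex.norm_real, norm_norm]
    exact div_self (norm_ne_zero_iff.mpr z.ne_zero)⟩

/-- The standard action of `ℂ^* ≅ S¹ × ℝ^{>0}` on `N × S¹ × ℝ^{>0}`:
`z · (b, s, r) = (b, (z / |z|) s, |z| r)`. -/
def stdAct (N : Type*) (z : ℂˣ) (p : Total N) : Total N :=
  (p.1, phase z * p.2.1,
    ⟨‖(z : ℂ)‖ * (p.2.2 : ℝ), mul_pos (norm_pos_iff.mpr z.ne_zero) p.2.2.2⟩)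

end Trivial

end CProj

end

open scoped Topology

set_option linter.unusedSectionVars false

noncomputable section

namespace CProj

section Calculus

variable {E : Type*} [NormedAddCommGroup E] [NormedSpace ℝ E]
  {H : Type*} [TopologicalSpace H] {I : ModelWithCorners ℝ E H}
  {M : Type*} [TopologicalSpace M] [ChartedSpace H M]
  {W : Type*} [NormedAddCommGroup W] [NormedSpace ℝ W]

lemma mdifferentiableAt_sum {ι : Type*} (s : Finset ι) {f : ι → M → W} {x : M}
    (h : ∀ i, MDifferentiableAt I 𝓘(ℝ, W) (f i) x) :
    MDifferentiableAt I 𝓘(ℝ, W) (fun q ↦ ∑ i ∈ s, f i q) x := by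
  classical
  induction s using Finset.induction_on with
  | empty => simpa using mdifferentiableAt_const
  | insert a s ha ih => simp only [Finset.sum_insert ha]; exact (h a).add ih

lemma mvfderiv_sum {ι : Type*} (s : Finset ι) {f : ι → M → W} {x : M}
    (h : ∀ i, MDifferentiableAt I 𝓘(ℝ, W) (f i) x) (u : TangentSpace I x) :
    mvfderiv I (fun q ↦ ∑ i ∈ s, f i q) x u = ∑ i ∈ s, mvfderiv I (f i) x u := by
  classical
  induction s using Finset.induction_on with
  | empty => simp [mvfderiv_const]
  | insert a s ha ih =>
    simp only [Finset.sum_insert ha]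
    rw [mvfderiv_fun_add (h a) (mdifferentiableAt_sum s h), add_apply, ih]

lemma contMDiffAt_coord [FiniteDimensional ℝ E] {x : M} {f : M → E} {n : ℕ∞ω}
    (hf : ContMDiffAt I 𝓘(ℝ, E) n f x) (i : Fin (Module.finrank ℝ E)) :
    ContMDiffAt I 𝓘(ℝ, ℝ) n (fun q ↦ (Module.finBasis ℝ E).coord i (f q)) x :=
  (LinearMap.toContinuousLinearMap ((Module.finBasis ℝ E).coord i)).contMDiff.contMDiffAt.comp x hf

variable {V V' : Type*} [NormedAddCommGroup V] [NormedSpace ℝ V]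
  [NormedAddCommGroup V'] [NormedSpace ℝ V']

lemma mvfderiv_fderiv_comp {g : W → V} {f : M → W} {x : M} (hg : DifferentiableAt ℝ g (f x))
    (hf : MDifferentiableAt I 𝓘(ℝ, W) f x) (u : TangentSpace I x) :
    mvfderiv I (fun q ↦ g (f q)) x u = fderiv ℝ g (f x) (mvfderiv I f x u) :=
  DFunLike.congr_fun (HasMFDerivAt.comp x hg.hasFDerivAt.hasMFDerivAt hf.hasMFDerivAt).mfderiv u

lemma mvfderiv_clm (L : W →L[ℝ] V) {f : M → W} {x : M}
    (hf : MDifferentiableAt I 𝓘(ℝ, W) f x) (u : TangentSpace I x) :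
    mvfderiv I (fun q ↦ L (f q)) x u = L (mvfderiv I f x u) := by
  rw [mvfderiv_fderiv_comp L.differentiableAt hf, L.fderiv]

lemma mdifferentiableAt_clm (L : W →L[ℝ] V) {f : M → W} {x : M}
    (hf : MDifferentiableAt I 𝓘(ℝ, W) f x) :
    MDifferentiableAt I 𝓘(ℝ, V) (fun q ↦ L (f q)) x :=
  L.differentiableAt.comp_mdifferentiableAt hf

lemma contMDiffAt_clm (L : W →L[ℝ] V) {f : M → W} {x : M} {n : ℕ∞ω}
    (hf : ContMDiffAt I 𝓘(ℝ, W) n f x) :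
    ContMDiffAt I 𝓘(ℝ, V) n (fun q ↦ L (f q)) x :=
  L.contMDiff.contMDiffAt.comp x hf

lemma mvfderiv_prodMk {f : M → W} {g : M → V} {x : M}
    (hf : MDifferentiableAt I 𝓘(ℝ, W) f x) (hg : MDifferentiableAt I 𝓘(ℝ, V) g x)
    (u : TangentSpace I x) :
    mvfderiv I (fun q ↦ (f q, g q)) x u = (mvfderiv I f x u, mvfderiv I g x u) := by
  have h2 : MDifferentiableAt I 𝓘(ℝ, W × V) (fun q ↦ (f q, g q)) x := hf.prodMk_space hg
  exact Prod.ext (mvfderiv_clm (ContinuousLinearMap.fst ℝ W V) h2 u).symm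
    (mvfderiv_clm (ContinuousLinearMap.snd ℝ W V) h2 u).symm

lemma mdifferentiableAt_coord [FiniteDimensional ℝ E] {x : M} {f : M → E}
    (hf : MDifferentiableAt I 𝓘(ℝ, E) f x) (i : Fin (Module.finrank ℝ E)) :
    MDifferentiableAt I 𝓘(ℝ, ℝ) (fun q ↦ (Module.finBasis ℝ E).coord i (f q)) x :=
  mdifferentiableAt_clm (LinearMap.toContinuousLinearMap ((Module.finBasis ℝ E).coord i)) hf

lemma mvfderiv_coord [FiniteDimensional ℝ E] {x : M} {f : M → E}
    (hf : MDifferentiableAt I 𝓘(ℝ, E) f x) (i : Fin (Module.finrank ℝ E)) (u : TangentSpace I x) :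
    mvfderiv I (fun q ↦ (Module.finBasis ℝ E).coord i (f q)) x u =
      (Module.finBasis ℝ E).coord i (mvfderiv I f x u) :=
  mvfderiv_clm (LinearMap.toContinuousLinearMap ((Module.finBasis ℝ E).coord i)) hf u

lemma mdifferentiableAt_fun_smul {a : M → ℝ} {f : M → W} {x : M}
    (ha : MDifferentiableAt I 𝓘(ℝ, ℝ) a x) (hf : MDifferentiableAt I 𝓘(ℝ, W) f x) :
    MDifferentiableAt I 𝓘(ℝ, W) (fun q ↦ a q • f q) x :=
  ha.smul hf

/-- The product rule for a continuous bilinear map. -/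
lemma mvfderiv_bilin (L : W →L[ℝ] V →L[ℝ] V') {f : M → W} {g : M → V} {x : M}
    (hf : MDifferentiableAt I 𝓘(ℝ, W) f x) (hg : MDifferentiableAt I 𝓘(ℝ, V) g x)
    (u : TangentSpace I x) :
    mvfderiv I (fun q ↦ L (f q) (g q)) x u =
      L (mvfderiv I f x u) (g x) + L (f x) (mvfderiv I g x u) := by
  have h1 := L.isBoundedBilinearMap.hasFDerivAt (f x, g x)
  have h2 : MDifferentiableAt I 𝓘(ℝ, W × V) (fun q ↦ (f q, g q)) x := hf.prodMk_space hg
  have h3 : mvfderiv I (fun q ↦ (f q, g q)) x u = (mvfderiv I f x u, mvfderiv I g x u) :=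
    mvfderiv_prodMk hf hg u
  have := mvfderiv_fderiv_comp (g := fun p : W × V ↦ L p.1 p.2)
    (f := fun q ↦ (f q, g q)) h1.differentiableAt h2 u
  rw [h1.fderiv, h3] at this
  refine this.trans ?_
  exact add_comm _ _

lemma mvfderiv_clm_apply {f : M → W →L[ℝ] V} {g : M → W} {x : M}
    (hf : MDifferentiableAt I 𝓘(ℝ, W →L[ℝ] V) f x) (hg : MDifferentiableAt I 𝓘(ℝ, W) g x)
    (u : TangentSpace I x) :
    mvfderiv I (fun q ↦ f q (g q)) x u =
      mvfderiv I f x u (g x) + f x (mvfderiv I g x u) :=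
  mvfderiv_bilin (ContinuousLinearMap.id ℝ (W →L[ℝ] V)) hf hg u

lemma mvfderiv_apply_const {f : M → W →L[ℝ] V} {x : M}
    (hf : MDifferentiableAt I 𝓘(ℝ, W →L[ℝ] V) f x) (w : W)
    (u : TangentSpace I x) :
    mvfderiv I (fun q ↦ f q w) x u = mvfderiv I f x u w :=
  mvfderiv_clm (ContinuousLinearMap.apply ℝ V w) hf u

lemma mvfderiv_congr {f g : M → W} {x : M} (h : f =ᶠ[𝓝 x] g) :
    mvfderiv I f x = mvfderiv I g x := by
  unfold mvfderiv
  rw [h.mfderiv_eq]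
  congr 1

end Calculus

section Frames

variable {E : Type*} [NormedAddCommGroup E] [NormedSpace ℝ E]
  {H : Type*} [TopologicalSpace H] {I : ModelWithCorners ℝ E H}
  {M : Type*} [TopologicalSpace M] [ChartedSpace H M] [IsManifold I ∞ M]
  {W : Type*} [NormedAddCommGroup W] [NormedSpace ℝ W]

variable (I) in
/-- The coordinates of a tangent vector at `q` in the preferred chart at `x₀`. -/
def tr (x₀ q : M) : TangentSpace I q →L[ℝ] E :=
  (trivializationAt E (TangentSpace I) x₀).continuousLinearMapAt ℝ q

variable (I) in
/-- The vector field with constant coordinates in the preferred chart at `x₀`. -/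
def cst (x₀ : M) (v : E) : VField I M := fun q ↦
  (trivializationAt E (TangentSpace I) x₀).symm q v

lemma cst_eq_symmL {x₀ q : M} (hq : q ∈ (chartAt H x₀).source) (v : E) :
    cst I x₀ v q = (trivializationAt E (TangentSpace I) x₀).symmL ℝ q v :=
  ((trivializationAt E (TangentSpace I) x₀).symmL_apply (R := ℝ) hq v).symm

lemma tr_cst {x₀ q : M} (hq : q ∈ (chartAt H x₀).source) (v : E) :
    tr I x₀ q (cst I x₀ v q) = v := by
  rw [cst_eq_symmL hq]
  exact (trivializationAt E (TangentSpace I) x₀).continuousLinearMapAt_symmL (R := ℝ) hq v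

lemma cst_tr {x₀ q : M} (hq : q ∈ (chartAt H x₀).source) (u : TangentSpace I q) :
    cst I x₀ (tr I x₀ q u) q = u := by
  rw [cst_eq_symmL hq]
  exact (trivializationAt E (TangentSpace I) x₀).symmL_continuousLinearMapAt (R := ℝ) hq u

lemma tr_self (x : M) (u : TangentSpace I x) : tr I x x u = u := by
  rw [tr, TangentBundle.continuousLinearMapAt_trivializationAt_eq_core (mem_chart_source H x)]
  exact tangentCoordChange_self (mem_extChartAt_source x)

lemma cst_self (x : M) (v : E) : cst I x v x = v := by
  have := tr_cst (I := I) (mem_chart_source H x) v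
  rwa [tr_self] at this

lemma tr_apply {x₀ q : M} (hq : q ∈ (chartAt H x₀).source) (u : TangentSpace I q) :
    tr I x₀ q u = (trivializationAt E (TangentSpace I) x₀ ⟨q, u⟩).2 :=
  (trivializationAt E (TangentSpace I) x₀).continuousLinearMapAt_apply_of_mem (R := ℝ) hq u

lemma ext_eq {x : M} (v : TangentSpace I x) : ext v = cst I x (tr I x x v) := by
  funext q
  rw [tr_apply (mem_chart_source H x)]
  rfl

lemma contMDiffAt_vfield_iff {x₀ x : M} (hx : x ∈ (chartAt H x₀).source) {Y : VField I M}
    {n : ℕ∞} :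
    ContMDiffAt I (I.prod 𝓘(ℝ, E)) n
      (fun q ↦ (Bundle.TotalSpace.mk' E q (Y q) : TangentBundle I M)) x ↔
    ContMDiffAt I 𝓘(ℝ, E) n (fun q ↦ tr I x₀ q (Y q)) x := by
  have : IsManifold I ((n : ℕ∞ω) + 1) M := IsManifold.of_le (n := ∞) (by
    have := (WithTop.coe_le_coe.mpr (le_top : (n + 1 : ℕ∞) ≤ ⊤)); exact this)
  have : ContMDiffVectorBundle (n : ℕ∞ω) E (TangentSpace I : M → Type _) I :=
    TangentBundle.contMDiffVectorBundle
  rw [(trivializationAt E (TangentSpace I) x₀).contMDiffAt_section_iff hx]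
  refine Filter.EventuallyEq.contMDiffAt_iff ?_
  filter_upwards [(chartAt H x₀).open_source.mem_nhds hx] with q hq
  rw [tr_apply hq]

lemma mdifferentiableAt_vfield_iff {x₀ x : M} (hx : x ∈ (chartAt H x₀).source) {Y : VField I M} :
    MDifferentiableAt I (I.prod 𝓘(ℝ, E))
      (fun q ↦ (Bundle.TotalSpace.mk' E q (Y q) : TangentBundle I M)) x ↔
    MDifferentiableAt I 𝓘(ℝ, E) (fun q ↦ tr I x₀ q (Y q)) x := by
  rw [(trivializationAt E (TangentSpace I) x₀).mdifferentiableAt_section_iff I _ hx]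
  refine Filter.EventuallyEq.mdifferentiableAt_iff ?_
  filter_upwards [(chartAt H x₀).open_source.mem_nhds hx] with q hq
  rw [tr_apply hq]

/-- Smoothness of a vector field at a point. -/
def FieldSmoothAt (Y : VField I M) (x : M) : Prop :=
  ContMDiffAt I (I.prod 𝓘(ℝ, E)) ∞
    (fun q ↦ (Bundle.TotalSpace.mk' E q (Y q) : TangentBundle I M)) x

/-- Differentiability of a vector field at a point. -/
def FieldDiffAt (Y : VField I M) (x : M) : Prop :=
  MDifferentiableAt I (I.prod 𝓘(ℝ, E))
    (fun q ↦ (Bundle.TotalSpace.mk' E q (Y q) : TangentBundle I M)) x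

lemma FieldSmoothAt.diffAt {Y : VField I M} {x : M} (h : FieldSmoothAt Y x) : FieldDiffAt Y x :=
  ContMDiffAt.mdifferentiableAt h (by simp)

lemma fieldSmoothAt_iff {x₀ x : M} (hx : x ∈ (chartAt H x₀).source) {Y : VField I M} :
    FieldSmoothAt Y x ↔ ContMDiffAt I 𝓘(ℝ, E) ∞ (fun q ↦ tr I x₀ q (Y q)) x :=
  contMDiffAt_vfield_iff (n := ⊤) hx

lemma fieldDiffAt_iff {x₀ x : M} (hx : x ∈ (chartAt H x₀).source) {Y : VField I M} :
    FieldDiffAt Y x ↔ MDifferentiableAt I 𝓘(ℝ, E) (fun q ↦ tr I x₀ q (Y q)) x :=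
  mdifferentiableAt_vfield_iff hx

lemma fieldSmoothAt_cst {x₀ x : M} (hx : x ∈ (chartAt H x₀).source) (v : E) :
    FieldSmoothAt (cst I x₀ v) x := by
  rw [fieldSmoothAt_iff hx]
  refine (contMDiffAt_const (c := v)).congr_of_eventuallyEq ?_
  filter_upwards [(chartAt H x₀).open_source.mem_nhds hx] with q hq
  rw [tr_cst hq]

/-! ### Vector-valued one-forms -/

/-- Smoothness of a vector-valued one-form at a point, tested on a coordinate frame. -/
def FormSmoothAt (Φ : ∀ q : M, TangentSpace I q →L[ℝ] W) (x : M) : Prop :=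
  ∀ v : E, ContMDiffAt I 𝓘(ℝ, W) ∞ (fun q ↦ Φ q (cst I x v q)) x

variable [FiniteDimensional ℝ E]

lemma form_expand {x₀ q : M} (hq : q ∈ (chartAt H x₀).source)
    (Φ : TangentSpace I q →L[ℝ] W) (u : TangentSpace I q) :
    Φ u = ∑ i, (Module.finBasis ℝ E).coord i (tr I x₀ q u) •
      Φ (cst I x₀ (Module.finBasis ℝ E i) q) := by
  conv_lhs => rw [← cst_tr hq u, ← (Module.finBasis ℝ E).sum_repr (tr I x₀ q u)]
  simp only [cst_eq_symmL hq, map_sum, map_smul, Module.Basis.coord_apply]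

lemma formSmoothAt_of_cst {Φ : ∀ q : M, TangentSpace I q →L[ℝ] W} {x₀ x : M}
    (hx : x ∈ (chartAt H x₀).source)
    (h : ∀ v : E, ContMDiffAt I 𝓘(ℝ, W) ∞ (fun q ↦ Φ q (cst I x₀ v q)) x)
    {X : VField I M} (hX : FieldSmoothAt X x) :
    ContMDiffAt I 𝓘(ℝ, W) ∞ (fun q ↦ Φ q (X q)) x := by
  have : (fun q ↦ Φ q (X q)) =ᶠ[𝓝 x] fun q ↦ ∑ i, (Module.finBasis ℝ E).coord i (tr I x₀ q (X q)) •
      Φ q (cst I x₀ (Module.finBasis ℝ E i) q) := by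
    filter_upwards [(chartAt H x₀).open_source.mem_nhds hx] with q hq
    exact form_expand hq _ _
  refine ContMDiffAt.congr_of_eventuallyEq ?_ this
  refine ContMDiffAt.sum fun i _ ↦ ?_
  exact (contMDiffAt_coord ((fieldSmoothAt_iff hx).1 hX) i).smul (h _)

lemma FormSmoothAt.apply {Φ : ∀ q : M, TangentSpace I q →L[ℝ] W} {x : M} (h : FormSmoothAt Φ x)
    {X : VField I M} (hX : FieldSmoothAt X x) :
    ContMDiffAt I 𝓘(ℝ, W) ∞ (fun q ↦ Φ q (X q)) x :=
  formSmoothAt_of_cst (mem_chart_source H x) h hX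

lemma FormSmoothAt.of_cst {Φ : ∀ q : M, TangentSpace I q →L[ℝ] W} {x₀ x : M}
    (hx : x ∈ (chartAt H x₀).source)
    (h : ∀ v : E, ContMDiffAt I 𝓘(ℝ, W) ∞ (fun q ↦ Φ q (cst I x₀ v q)) x) : FormSmoothAt Φ x :=
  fun v ↦ formSmoothAt_of_cst hx h (fieldSmoothAt_cst (mem_chart_source H x) v)

lemma FormSmoothAt.apply_diff {Φ : ∀ q : M, TangentSpace I q →L[ℝ] W} {x : M}
    (h : FormSmoothAt Φ x) {X : VField I M} (hX : FieldDiffAt X x) :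
    MDifferentiableAt I 𝓘(ℝ, W) (fun q ↦ Φ q (X q)) x := by
  have hx := mem_chart_source H x
  have : (fun q ↦ Φ q (X q)) =ᶠ[𝓝 x] fun q ↦ ∑ i, (Module.finBasis ℝ E).coord i (tr I x q (X q)) •
      Φ q (cst I x (Module.finBasis ℝ E i) q) := by
    filter_upwards [(chartAt H x).open_source.mem_nhds hx] with q hq
    exact form_expand hq _ _
  refine MDifferentiableAt.congr_of_eventuallyEq ?_ this
  refine mdifferentiableAt_sum _ fun i ↦ ?_
  refine MDifferentiableAt.smul ?_ ((h _).mdifferentiableAt (by simp))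
  have h1 := (fieldDiffAt_iff hx).1 hX
  exact (LinearMap.toContinuousLinearMap ((Module.finBasis ℝ E).coord i)).differentiableAt
    |>.comp_mdifferentiableAt h1

lemma formSmoothAt_tr {x₀ x : M} (hx : x ∈ (chartAt H x₀).source) :
    FormSmoothAt (W := E) (tr I x₀ : ∀ q : M, TangentSpace I q →L[ℝ] E) x := by
  refine FormSmoothAt.of_cst hx (fun v ↦ ?_)
  refine (contMDiffAt_const (c := v)).congr_of_eventuallyEq ?_
  filter_upwards [(chartAt H x₀).open_source.mem_nhds hx] with q hq
  rw [tr_cst hq]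

end Frames

section ChartCalculus

variable {E : Type*} [NormedAddCommGroup E] [NormedSpace ℝ E]
  {H : Type*} [TopologicalSpace H] {I : ModelWithCorners ℝ E H} [I.Boundaryless]
  {M : Type*} [TopologicalSpace M] [ChartedSpace H M] [IsManifold I ∞ M]
  {W : Type*} [NormedAddCommGroup W] [NormedSpace ℝ W]

lemma mdifferentiableAt_chart_rep {F : M → W} {p q : M} (hq : q ∈ (chartAt H p).source)
    (hF : MDifferentiableAt I 𝓘(ℝ, W) F q) :
    DifferentiableAt ℝ (F ∘ (extChartAt I p).symm) (extChartAt I p q) := by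
  have hq' : q ∈ (extChartAt I p).source := by rwa [extChartAt_source]
  have h1 : MDifferentiableAt 𝓘(ℝ, E) I (extChartAt I p).symm (extChartAt I p q) := by
    have := mdifferentiableWithinAt_extChartAt_symm (I := I) (x := p)
      ((extChartAt I p).map_source hq')
    rwa [I.range_eq_univ, mdifferentiableWithinAt_univ] at this
  have h2 : MDifferentiableAt I 𝓘(ℝ, W) F ((extChartAt I p).symm (extChartAt I p q)) := by
    rwa [(extChartAt I p).left_inv hq']
  exact (h2.comp _ h1).differentiableAt

lemma contDiffAt_chart_rep {F : M → W} {p q : M} {n : ℕ∞} (hq : q ∈ (chartAt H p).source)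
    (hF : ContMDiffAt I 𝓘(ℝ, W) n F q) :
    ContDiffAt ℝ n (F ∘ (extChartAt I p).symm) (extChartAt I p q) := by
  have hq' : q ∈ (extChartAt I p).source := by rwa [extChartAt_source]
  have : IsManifold I (n : ℕ∞ω) M := IsManifold.of_le (n := ∞) (by
    exact WithTop.coe_le_coe.mpr (le_top : (n : ℕ∞) ≤ ⊤))
  have h1 : ContMDiffAt 𝓘(ℝ, E) I n (extChartAt I p).symm (extChartAt I p q) := by
    refine (contMDiffOn_extChartAt_symm p).contMDiffAt ?_
    exact (isOpen_extChartAt_target p).mem_nhds ((extChartAt I p).map_source hq')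
  have h2 : ContMDiffAt I 𝓘(ℝ, W) n F ((extChartAt I p).symm (extChartAt I p q)) := by
    rwa [(extChartAt I p).left_inv hq']
  exact (h2.comp _ h1).contDiffAt

lemma contMDiffAt_extChartAt_of_mem {p q : M} (hq : q ∈ (chartAt H p).source) :
    ContMDiffAt I 𝓘(ℝ, E) ∞ (extChartAt I p) q :=
  contMDiffAt_extChartAt' hq

lemma mfderiv_extChartAt_eq_tr {p q : M} (hq : q ∈ (chartAt H p).source) (u : TangentSpace I q) :
    mvfderiv I (extChartAt I p) q u = tr I p q u := by
  rw [tr, TangentBundle.continuousLinearMapAt_trivializationAt hq]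
  rfl

lemma mvfderiv_eq_fderiv {F : M → W} {p q : M} (hq : q ∈ (chartAt H p).source)
    (hF : MDifferentiableAt I 𝓘(ℝ, W) F q) (u : TangentSpace I q) :
    mvfderiv I F q u =
      fderiv ℝ (F ∘ (extChartAt I p).symm) (extChartAt I p q) (tr I p q u) := by
  have hq' : q ∈ (extChartAt I p).source := by rwa [extChartAt_source]
  have h : F =ᶠ[𝓝 q] fun y ↦ (F ∘ (extChartAt I p).symm) (extChartAt I p y) := by
    filter_upwards [(chartAt H p).open_source.mem_nhds hq] with y hy
    rw [Function.comp_apply, (extChartAt I p).left_inv (by rwa [extChartAt_source])]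
  rw [mvfderiv_congr h, mvfderiv_fderiv_comp (mdifferentiableAt_chart_rep hq hF)
    ((contMDiffAt_extChartAt_of_mem hq).mdifferentiableAt (by simp)),
    mfderiv_extChartAt_eq_tr hq]

lemma mvfderiv_cst_eventuallyEq {F : M → W} {p x : M} (hx : x ∈ (chartAt H p).source)
    (hF : ContMDiffAt I 𝓘(ℝ, W) ∞ F x) (v : E) :
    (fun q ↦ mvfderiv I F q (cst I p v q)) =ᶠ[𝓝 x]
      fun q ↦ fderiv ℝ (F ∘ (extChartAt I p).symm) (extChartAt I p q) v := by
  have hF1 : ContMDiffAt I 𝓘(ℝ, W) 1 F x := hF.of_le (by simp)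
  filter_upwards [(chartAt H p).open_source.mem_nhds hx,
    (contMDiffAt_iff_contMDiffAt_nhds (n := 1) (by simp)).1 hF1] with q hq hFq
  rw [mvfderiv_eq_fderiv hq (hFq.mdifferentiableAt (by simp)), tr_cst hq]

lemma formSmoothAt_mvfderiv [FiniteDimensional ℝ E] {F : M → W} {x : M}
    (hF : ContMDiffAt I 𝓘(ℝ, W) ∞ F x) :
    FormSmoothAt (W := W) (mvfderiv I F) x := by
  intro v
  have hx := mem_chart_source H x
  refine ContMDiffAt.congr_of_eventuallyEq ?_
    (mvfderiv_cst_eventuallyEq hx hF v)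
  have h1 : ContDiffAt ℝ ∞ (fun z ↦ fderiv ℝ (F ∘ (extChartAt I x).symm) z v)
      (extChartAt I x x) := by
    refine ContDiffAt.clm_apply ?_ contDiffAt_const
    exact (contDiffAt_chart_rep (n := ⊤) hx hF).fderiv_right (m := ∞) (by simp)
  exact h1.contMDiffAt.comp x (contMDiffAt_extChartAt_of_mem hx)

/-- The symmetry of second derivatives in the preferred chart. -/
lemma mvfderiv_mvfderiv_symm {F : M → W} {x : M}
    (hF : ContMDiffAt I 𝓘(ℝ, W) ∞ F x) (u v : TangentSpace I x) :
    mvfderiv I (fun q ↦ mvfderiv I F q (cst I x (tr I x x v) q)) x u =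
      mvfderiv I (fun q ↦ mvfderiv I F q (cst I x (tr I x x u) q)) x v := by
  have hx := mem_chart_source H x
  have h0 : ContDiffAt ℝ ∞ (F ∘ (extChartAt I x).symm) (extChartAt I x x) :=
    contDiffAt_chart_rep (n := ⊤) hx hF
  have h1 : DifferentiableAt ℝ (fderiv ℝ (F ∘ (extChartAt I x).symm)) (extChartAt I x x) :=
    (h0.fderiv_right (m := ∞) (by simp)).differentiableAt (by simp)
  have key : ∀ u v : TangentSpace I x,
      mvfderiv I (fun q ↦ mvfderiv I F q (cst I x (tr I x x v) q)) x u =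
      fderiv ℝ (fderiv ℝ (F ∘ (extChartAt I x).symm)) (extChartAt I x x)
        (tr I x x u) (tr I x x v) := by
    intro u v
    rw [mvfderiv_congr (mvfderiv_cst_eventuallyEq hx hF _)]
    have h2 : DifferentiableAt ℝ
        (fun z ↦ fderiv ℝ (F ∘ (extChartAt I x).symm) z (tr I x x v)) (extChartAt I x x) :=
      h1.clm_apply (differentiableAt_const _)
    rw [mvfderiv_fderiv_comp h2
      ((contMDiffAt_extChartAt_of_mem hx).mdifferentiableAt (by simp)),
      mfderiv_extChartAt_eq_tr hx]
    rw [fderiv_clm_apply h1 (differentiableAt_const _)]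
    simp
  rw [key, key]
  exact (h0.isSymmSndFDerivAt (by simp; exact WithTop.coe_le_coe.mpr le_top)).eq _ _

/-- The fields which are constant in the preferred chart at `x` commute at `x`. -/
lemma mlieBracket_cst [CompleteSpace E] (x : M) (v w : E) :
    VectorField.mlieBracket I (cst I x v) (cst I x w) x = 0 := by
  have key : ∀ v : E, VectorField.mpullbackWithin 𝓘(ℝ, E) I (extChartAt I x).symm (cst I x v)
      (Set.range I) =ᶠ[𝓝 (extChartAt I x x)] fun _ ↦ v := by
    intro v
    filter_upwards [(isOpen_extChartAt_target x).mem_nhds (mem_extChartAt_target x)] with y hy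
    have hq : (extChartAt I x).symm y ∈ (chartAt H x).source := by
      rw [← extChartAt_source I]; exact (extChartAt I x).map_target hy
    rw [VectorField.mpullbackWithin_apply, cst_eq_symmL hq,
      TangentBundle.symmL_trivializationAt hq, (extChartAt I x).right_inv hy]
    obtain ⟨e, he⟩ := isInvertible_mfderivWithin_extChartAt_symm hy
    rw [← he, ContinuousLinearMap.inverse_equiv]
    exact e.symm_apply_apply v
  rw [VectorField.mlieBracket, VectorField.mlieBracketWithin_apply,
    (key v).lieBracketWithin_vectorField_eq_nhds (key w)]
  have : VectorField.lieBracketWithin ℝ (fun _ : E ↦ v) (fun _ : E ↦ w)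
      ((extChartAt I x).symm ⁻¹' Set.univ ∩ Set.range I) (extChartAt I x x) = 0 := by
    simp [VectorField.lieBracketWithin]
  erw [this]
  exact map_zero _

/-- The exterior derivative of a vector-valued one-form. -/
def extD (Φ : ∀ q : M, TangentSpace I q →L[ℝ] W) (x : M) (u v : TangentSpace I x) : W :=
  mvfderiv I (fun q ↦ Φ q (cst I x (tr I x x v) q)) x u -
    mvfderiv I (fun q ↦ Φ q (cst I x (tr I x x u) q)) x v

/-- The derivative of `Φ(X)` for a one-form `Φ` and a vector field `X` in coordinates. -/
lemma mvfderiv_form_apply [FiniteDimensional ℝ E] {Φ : ∀ q : M, TangentSpace I q →L[ℝ] W}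
    {x₀ x : M} (hx : x ∈ (chartAt H x₀).source) (hΦ : FormSmoothAt Φ x) {X : VField I M}
    (hX : FieldDiffAt X x) (u : TangentSpace I x) :
    mvfderiv I (fun q ↦ Φ q (X q)) x u =
      mvfderiv I (fun q ↦ Φ q (cst I x₀ (tr I x₀ x (X x)) q)) x u +
        Φ x (cst I x₀ (mvfderiv I (fun q ↦ tr I x₀ q (X q)) x u) x) := by
  have hX' := (fieldDiffAt_iff hx).1 hX
  have hc : ∀ v : E, MDifferentiableAt I 𝓘(ℝ, W) (fun q ↦ Φ q (cst I x₀ v q)) x := fun v ↦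
    (hΦ.apply (fieldSmoothAt_cst hx v)).mdifferentiableAt (by simp)
  have e1 : (fun q ↦ Φ q (X q)) =ᶠ[𝓝 x] fun q ↦ ∑ i, (Module.finBasis ℝ E).coord i (tr I x₀ q (X q)) •
      Φ q (cst I x₀ (Module.finBasis ℝ E i) q) := by
    filter_upwards [(chartAt H x₀).open_source.mem_nhds hx] with q hq
    exact form_expand hq _ _
  have e2 : ∀ w : E, (fun q ↦ Φ q (cst I x₀ w q)) =ᶠ[𝓝 x]
      fun q ↦ ∑ i, (Module.finBasis ℝ E).coord i w •
        Φ q (cst I x₀ (Module.finBasis ℝ E i) q) := by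
    intro w
    filter_upwards [(chartAt H x₀).open_source.mem_nhds hx] with q hq
    rw [form_expand hq, tr_cst hq]
  have e3 : ∀ w : E, Φ x (cst I x₀ w x) = ∑ i, (Module.finBasis ℝ E).coord i w •
      Φ x (cst I x₀ (Module.finBasis ℝ E i) x) := fun w ↦ by
    rw [form_expand hx, tr_cst hx]
  rw [mvfderiv_congr e1, mvfderiv_congr (e2 _), e3,
    mvfderiv_sum _ fun i ↦ mdifferentiableAt_fun_smul (mdifferentiableAt_coord hX' i) (hc _),
    mvfderiv_sum _ fun i ↦ mdifferentiableAt_fun_smul mdifferentiableAt_const (hc _), ← Finset.sum_add_distrib]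
  refine Finset.sum_congr rfl fun i _ ↦ ?_
  rw [mvfderiv_fun_smul (mdifferentiableAt_coord hX' i) (hc _),
    mvfderiv_fun_smul mdifferentiableAt_const (hc _)]
  simp only [add_apply, ContinuousLinearMap.smulRight_apply, mvfderiv_const, zero_apply, zero_smul,
    add_zero, mvfderiv_coord hX']

/-- The exterior derivative computed in another chart. -/
lemma extD_eq [FiniteDimensional ℝ E] {Φ : ∀ q : M, TangentSpace I q →L[ℝ] W} {x₀ x : M}
    (hx : x ∈ (chartAt H x₀).source) (hΦ : FormSmoothAt Φ x) (u v : TangentSpace I x) :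
    extD Φ x u v =
      mvfderiv I (fun q ↦ Φ q (cst I x₀ (tr I x₀ x v) q)) x u -
        mvfderiv I (fun q ↦ Φ q (cst I x₀ (tr I x₀ x u) q)) x v := by
  have hx' := mem_chart_source H x
  have hs : ∀ v, FieldSmoothAt (cst I x v) x := fun v ↦ fieldSmoothAt_cst hx' v
  have h1 : ∀ v : E, (fun q ↦ tr I x₀ q (cst I x v q)) =ᶠ[𝓝 x]
      fun q ↦ mvfderiv I (extChartAt I x₀) q (cst I x v q) := by
    intro v
    filter_upwards [(chartAt H x₀).open_source.mem_nhds hx] with q hq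
    rw [mfderiv_extChartAt_eq_tr hq]
  have h2 : ∀ u : TangentSpace I x, cst I x (tr I x x u) x = u := fun u ↦ cst_tr hx' u
  rw [extD, mvfderiv_form_apply hx hΦ (hs _).diffAt, mvfderiv_form_apply hx hΦ (hs _).diffAt,
    mvfderiv_congr (h1 _), mvfderiv_congr (h1 _),
    mvfderiv_mvfderiv_symm (contMDiffAt_extChartAt_of_mem hx) u v, h2, h2]
  abel

end ChartCalculus

section OperatorValued

variable {E : Type*} [NormedAddCommGroup E] [NormedSpace ℝ E]
  {H : Type*} [TopologicalSpace H] {I : ModelWithCorners ℝ E H}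
  {M : Type*} [TopologicalSpace M] [ChartedSpace H M]
  {W : Type*} [NormedAddCommGroup W] [NormedSpace ℝ W]
  {V : Type*} [NormedAddCommGroup V] [NormedSpace ℝ V] [FiniteDimensional ℝ V]

/-- The operator with prescribed values on a basis. -/
lemma clm_eq_sum_basis (f : V →L[ℝ] W) :
    f = ∑ i, ContinuousLinearMap.smulRightL ℝ V W
      (LinearMap.toContinuousLinearMap ((Module.finBasis ℝ V).coord i))
      (f (Module.finBasis ℝ V i)) := by
  ext v
  conv_lhs => rw [← (Module.finBasis ℝ V).sum_repr v, map_sum]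
  simp

lemma contMDiffAt_clm_of_apply {f : M → V →L[ℝ] W} {x : M} {n : ℕ∞ω}
    (h : ∀ v, ContMDiffAt I 𝓘(ℝ, W) n (fun q ↦ f q v) x) :
    ContMDiffAt I 𝓘(ℝ, V →L[ℝ] W) n f x := by
  rw [show f = fun q ↦ ∑ i, ContinuousLinearMap.smulRightL ℝ V W
      (LinearMap.toContinuousLinearMap ((Module.finBasis ℝ V).coord i))
      (f q (Module.finBasis ℝ V i)) from funext fun q ↦ clm_eq_sum_basis _]
  exact ContMDiffAt.sum fun i _ ↦ contMDiffAt_clm _ (h _)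

end OperatorValued

section Connections

variable {E : Type*} [NormedAddCommGroup E] [NormedSpace ℝ E] [FiniteDimensional ℝ E]
  {H : Type*} [TopologicalSpace H] {I : ModelWithCorners ℝ E H} [I.Boundaryless]
  {M : Type*} [TopologicalSpace M] [ChartedSpace H M] [IsManifold I ∞ M]
  {W : Type*} [NormedAddCommGroup W] [NormedSpace ℝ W]

/-! ### Frames -/

/-- A smooth family of isomorphisms from the tangent spaces over `U` to a vector space. -/
structure IsFrame (Φ : ∀ q : M, TangentSpace I q →L[ℝ] W) (U : Set M) : Prop where
  smooth : ∀ q ∈ U, FormSmoothAt Φ q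
  bijective : ∀ q ∈ U, Function.Bijective (Φ q)

lemma isFrame_tr (x₀ : M) : IsFrame (I := I) (W := E) (tr I x₀) (chartAt H x₀).source where
  smooth _ hq := formSmoothAt_tr hq
  bijective _ hq := ⟨fun u v h ↦ by rw [← cst_tr hq u, h, cst_tr hq],
    fun w ↦ ⟨_, tr_cst hq w⟩⟩

/-- A one-form read in the preferred chart at `x₀`, as an operator-valued function. -/
def formRep (x₀ : M) (Φ : ∀ q : M, TangentSpace I q →L[ℝ] W) (q : M) : E →L[ℝ] W :=
  Φ q ∘L (trivializationAt E (TangentSpace I) x₀).symmL ℝ q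

lemma formRep_apply {x₀ q : M} (hq : q ∈ (chartAt H x₀).source)
    (Φ : ∀ q : M, TangentSpace I q →L[ℝ] W) (w : E) : formRep x₀ Φ q w = Φ q (cst I x₀ w q) := by
  rw [cst_eq_symmL hq]; rfl

lemma FormSmoothAt.contMDiffAt_formRep {x₀ x : M} (hx : x ∈ (chartAt H x₀).source)
    {Φ : ∀ q : M, TangentSpace I q →L[ℝ] W} (h : FormSmoothAt Φ x) :
    ContMDiffAt I 𝓘(ℝ, E →L[ℝ] W) ∞ (formRep x₀ Φ) x := by
  refine contMDiffAt_clm_of_apply fun v ↦ ?_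
  refine (h.apply (fieldSmoothAt_cst hx v)).congr_of_eventuallyEq ?_
  filter_upwards [(chartAt H x₀).open_source.mem_nhds hx] with q hq
  exact formRep_apply hq _ _

lemma IsFrame.fieldSmoothAt {Φ : ∀ q : M, TangentSpace I q →L[ℝ] W} {U : Set M}
    (h : IsFrame Φ U) {x : M} (hx : x ∈ U) {Y : VField I M}
    (hY : ContMDiffAt I 𝓘(ℝ, W) ∞ (fun q ↦ Φ q (Y q)) x) : FieldSmoothAt Y x := by
  have hx' := mem_chart_source H x
  rw [fieldSmoothAt_iff hx']
  have hbij : Function.Bijective (formRep x Φ x) := by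
    have : ⇑(formRep x Φ x) = Φ x ∘ (fun w ↦ cst I x w x) :=
      funext fun w ↦ formRep_apply hx' _ _
    rw [this]
    exact (h.bijective x hx).comp ⟨fun a b hab ↦ by
      rw [← tr_cst (I := I) hx' a, ← tr_cst (I := I) hx' b]; exact congrArg _ hab,
      fun u ↦ ⟨_, cst_tr hx' u⟩⟩
  let e : E ≃L[ℝ] W := by
    have : FiniteDimensional ℝ W := FiniteDimensional.of_surjective
      (formRep x Φ x : E →ₗ[ℝ] W) hbij.2
    exact (LinearEquiv.ofBijective (formRep x Φ x : E →ₗ[ℝ] W) hbij).toContinuousLinearEquiv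
  have he : (e : E →L[ℝ] W) = formRep x Φ x := by ext; rfl
  have hrep := (h.smooth x hx).contMDiffAt_formRep hx'
  have hinv : ContMDiffAt I 𝓘(ℝ, W →L[ℝ] E) ∞ (fun q ↦ (formRep x Φ q).inverse) x := by
    have h1 : ContDiffAt ℝ ∞ (ContinuousLinearMap.inverse : (E →L[ℝ] W) → (W →L[ℝ] E))
        (formRep x Φ x) := he ▸ contDiffAt_map_inverse e
    exact h1.contMDiffAt.comp x hrep
  have hop : ∀ᶠ q in 𝓝 x, formRep x Φ q ∈ Set.range ((↑) : (E ≃L[ℝ] W) → E →L[ℝ] W) := by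
    have : CompleteSpace E := FiniteDimensional.complete ℝ E
    exact hrep.continuousAt.eventually_mem (he ▸ ContinuousLinearEquiv.nhds e)
  refine (hinv.clm_apply hY).congr_of_eventuallyEq ?_
  filter_upwards [(chartAt H x).open_source.mem_nhds hx', hop] with q hq ⟨e', he'⟩
  rw [← he', ContinuousLinearMap.inverse_equiv]
  refine (e'.symm_apply_eq.2 ?_).symm
  have : e' (tr I x q (Y q)) = formRep x Φ q (tr I x q (Y q)) := by rw [← he']; rfl
  rw [this, formRep_apply hq, cst_tr hq]

/-! ### Connections in a frame -/

/-- The connection `D` is `d + A` in the frame `Φ` over `U`. -/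
def IsRep (D : AffConn I M) (Φ : ∀ q : M, TangentSpace I q →L[ℝ] W)
    (A : ∀ q : M, TangentSpace I q →L[ℝ] W →L[ℝ] W) (U : Set M) : Prop :=
  ∀ q ∈ U, ∀ Y : VField I M, FieldDiffAt Y q → ∀ u : TangentSpace I q,
    Φ q (D Y q u) = mvfderiv I (fun q' ↦ Φ q' (Y q')) q u + A q u (Φ q (Y q))

lemma IsRep.curv_eq [FiniteDimensional ℝ W] [CompleteSpace E] {D : AffConn I M}
    {Φ : ∀ q : M, TangentSpace I q →L[ℝ] W}
    {A : ∀ q : M, TangentSpace I q →L[ℝ] W →L[ℝ] W} {U : Set M}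
    (hD : IsRep D Φ A U) (hΦ : IsFrame Φ U) (hA : ∀ q ∈ U, FormSmoothAt A q) (hU : IsOpen U)
    {x : M} (hx : x ∈ U) (u v w : TangentSpace I x) :
    Φ x (curv D x u v w) = extD A x u v (Φ x w) + A x u (A x v (Φ x w))
      - A x v (A x u (Φ x w)) := by
  have hx' := mem_chart_source H x
  set Z := cst I x (tr I x x w) with hZ
  have hZx : Z x = w := cst_tr hx' w
  have hUs : U ∩ (chartAt H x).source ∈ 𝓝 x :=
    Filter.inter_mem (hU.mem_nhds hx) ((chartAt H x).open_source.mem_nhds hx')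
  set g : M → W := fun q ↦ Φ q (Z q) with hg
  have hgs : ∀ q ∈ U ∩ (chartAt H x).source, ContMDiffAt I 𝓘(ℝ, W) ∞ g q := fun q hq ↦
    (hΦ.smooth q hq.1).apply (fieldSmoothAt_cst hq.2 _)
  have hgx := hgs x ⟨hx, hx'⟩
  have key : ∀ u v : TangentSpace I x, Φ x (D (fun y ↦ D Z y (cst I x (tr I x x v) y)) x u) =
      mvfderiv I (fun q ↦ mvfderiv I g q (cst I x (tr I x x v) q)) x u +
      (mvfderiv I (fun q ↦ A q (cst I x (tr I x x v) q)) x u (g x) + A x v (mvfderiv I g x u)) +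
      A x u (mvfderiv I g x v + A x v (g x)) := by
    intro u v
    set X := cst I x (tr I x x v) with hX
    have hXx : X x = v := cst_tr hx' v
    have hXs : FieldSmoothAt X x := fieldSmoothAt_cst hx' _
    have e : (fun q ↦ Φ q (D Z q (X q))) =ᶠ[𝓝 x]
        fun q ↦ mvfderiv I g q (X q) + A q (X q) (g q) := by
      filter_upwards [hUs] with q hq
      exact hD q hq.1 Z (fieldSmoothAt_cst hq.2 _).diffAt _
    have h1 : ContMDiffAt I 𝓘(ℝ, W) ∞ (fun q ↦ mvfderiv I g q (X q)) x :=
      (formSmoothAt_mvfderiv hgx).apply hXs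
    have h2 : ContMDiffAt I 𝓘(ℝ, W →L[ℝ] W) ∞ (fun q ↦ A q (X q)) x := (hA x hx).apply hXs
    have h3 : ContMDiffAt I 𝓘(ℝ, W) ∞ (fun q ↦ A q (X q) (g q)) x := h2.clm_apply hgx
    have hY : FieldSmoothAt (fun q ↦ D Z q (X q)) x :=
      hΦ.fieldSmoothAt hx ((h1.add h3).congr_of_eventuallyEq e)
    have e0 : Φ x (D Z x (X x)) = mvfderiv I g x (X x) + A x (X x) (g x) := e.self_of_nhds
    rw [hD x hx _ hY.diffAt u, mvfderiv_congr e, e0,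
      mvfderiv_fun_add (h1.mdifferentiableAt (by simp)) (h3.mdifferentiableAt (by simp)),
      add_apply, mvfderiv_clm_apply (h2.mdifferentiableAt (by simp))
      (hgx.mdifferentiableAt (by simp)), hXx]
  simp only [curv, ext_eq]
  rw [mlieBracket_cst, map_zero, sub_zero, map_sub, key u v, key v u,
    mvfderiv_mvfderiv_symm hgx u v]
  have hgw : g x = Φ x w := by rw [hg]; simp only [hZx]
  rw [extD, sub_apply, hgw]
  simp only [map_add]
  abel

/-! ### Christoffel symbols -/

lemma conn_sum (D : AffConn I M) {ι : Type*} (s : Finset ι) {f : ι → M → ℝ} {X : ι → VField I M}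
    {x : M} (hf : ∀ i, MDifferentiableAt I 𝓘(ℝ, ℝ) (f i) x) (hX : ∀ i, FieldDiffAt (X i) x)
    (u : TangentSpace I x) :
    FieldDiffAt (fun q ↦ ∑ i ∈ s, f i q • X i q) x ∧
    D (fun q ↦ ∑ i ∈ s, f i q • X i q) x u =
      ∑ i ∈ s, (f i x • D (X i) x u + mvfderiv I (f i) x u • X i x) := by
  classical
  induction s using Finset.induction_on with
  | empty =>
    refine ⟨Bundle.mdifferentiableAt_zeroSection .., ?_⟩
    simp only [Finset.sum_empty]
    have := congrFun D.zero x
    exact DFunLike.congr_fun this u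
  | insert a s ha ih =>
    have h1 : FieldDiffAt (f a • X a) x := (hf a).smul_section (hX a)
    have h2 : (fun q ↦ ∑ i ∈ insert a s, f i q • X i q) =
        f a • X a + fun q ↦ ∑ i ∈ s, f i q • X i q := by
      funext q; rw [Finset.sum_insert ha]; rfl
    rw [h2]
    refine ⟨mdifferentiableAt_add_section h1 ih.1, ?_⟩
    rw [D.isCovariantDerivativeOnUniv.add h1 ih.1,
      D.isCovariantDerivativeOnUniv.leibniz (hX a) (hf a), Finset.sum_insert ha, ← ih.2]
    rfl

lemma field_expand {x₀ q : M} (hq : q ∈ (chartAt H x₀).source) (u : TangentSpace I q) :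
    u = ∑ i, (Module.finBasis ℝ E).coord i (tr I x₀ q u) •
      cst I x₀ (Module.finBasis ℝ E i) q := by
  conv_lhs => rw [← cst_tr hq u, ← (Module.finBasis ℝ E).sum_repr (tr I x₀ q u)]
  simp only [cst_eq_symmL hq, map_sum, map_smul, Module.Basis.coord_apply]

lemma conn_congr (D : AffConn I M) {Y Z : VField I M} {x : M} (hY : FieldDiffAt Y x)
    (hZ : FieldDiffAt Z x) (h : ∀ᶠ q in 𝓝 x, Y q = Z q) : D Y x = D Z x :=
  D.isCovariantDerivativeOnUniv.congr_of_eventuallyEq hY hZ Filter.univ_mem h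

/-- The Christoffel symbols of `D` in the preferred chart at `x₀`. -/
def christoffel (D : AffConn I M) (x₀ q : M) : TangentSpace I q →L[ℝ] E →L[ℝ] E :=
  ∑ i, ContinuousLinearMap.smulRightL ℝ E E
    (LinearMap.toContinuousLinearMap ((Module.finBasis ℝ E).coord i)) ∘L
    tr I x₀ q ∘L D (cst I x₀ (Module.finBasis ℝ E i)) q

lemma christoffel_apply (D : AffConn I M) (x₀ q : M) (u : TangentSpace I q) (w : E) :
    christoffel D x₀ q u w = ∑ i, (Module.finBasis ℝ E).coord i w •
      tr I x₀ q (D (cst I x₀ (Module.finBasis ℝ E i)) q u) := by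
  simp [christoffel]

lemma isRep_christoffel (D : AffConn I M) (x₀ : M) :
    IsRep (W := E) D (tr I x₀) (christoffel D x₀) (chartAt H x₀).source := by
  intro q hq Y hY u
  have hY' := (fieldDiffAt_iff hq).1 hY
  have h := conn_sum D Finset.univ (fun i ↦ mdifferentiableAt_coord hY' i)
    (fun i ↦ (fieldSmoothAt_cst hq (Module.finBasis ℝ E i)).diffAt) u
  have e : ∀ᶠ y in 𝓝 q, Y y = ∑ i, (Module.finBasis ℝ E).coord i (tr I x₀ y (Y y)) •
      cst I x₀ (Module.finBasis ℝ E i) y := by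
    filter_upwards [(chartAt H x₀).open_source.mem_nhds hq] with y hy
    exact field_expand hy _
  rw [conn_congr D hY h.1 e, h.2, map_sum, christoffel_apply]
  simp only [map_add, map_smul, tr_cst hq, Finset.sum_add_distrib, mvfderiv_coord hY']
  rw [add_comm]
  congr 1
  exact (Module.finBasis ℝ E).sum_repr _

lemma tr_conn_cst (D : AffConn I M) {x₀ q : M} (hq : q ∈ (chartAt H x₀).source) (w : E)
    (u : TangentSpace I q) : tr I x₀ q (D (cst I x₀ w) q u) = christoffel D x₀ q u w := by
  have e : (fun y ↦ tr I x₀ y (cst I x₀ w y)) =ᶠ[𝓝 q] fun _ ↦ w := by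
    filter_upwards [(chartAt H x₀).open_source.mem_nhds hq] with y hy
    exact tr_cst hy w
  rw [isRep_christoffel D x₀ q hq _ (fieldSmoothAt_cst hq w).diffAt, mvfderiv_congr e,
    mvfderiv_const, zero_apply, zero_add, tr_cst hq]

/-! ### Smooth connections -/

lemma fieldSmoothAt_conn [T2Space M] {D : AffConn I M}
    (hD : CovariantDerivative.ContMDiffCovariantDerivative D ∞) {U : Set M} (hU : IsOpen U)
    {Y : VField I M} (hY : ∀ q ∈ U, FieldSmoothAt Y q) {x : M} (hx : x ∈ U) {X : VField I M}
    (hX : FieldSmoothAt X x) : FieldSmoothAt (fun q ↦ D Y q (X q)) x := by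
  obtain ⟨ψ, -, hψ⟩ := (SmoothBumpFunction.nhds_basis_tsupport (I := I) x).mem_iff.1
    (hU.mem_nhds hx)
  have hσ : ContMDiff I (I.prod 𝓘(ℝ, E)) ∞
      (fun q ↦ (Bundle.TotalSpace.mk' E q (ψ q • Y q) : TangentBundle I M)) :=
    ContMDiffOn.smul_section_of_tsupport ψ.contMDiff.contMDiffOn hU hψ
      fun q hq ↦ (hY q hq).contMDiffWithinAt
  have h1 := (hD.contMDiff.contMDiff (σ := fun q ↦ ψ q • Y q) hσ.contMDiffOn).contMDiffAt
    (x := x) Filter.univ_mem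
  have h2 := ContMDiffAt.clm_bundle_apply h1 hX
  refine ContMDiffAt.congr_of_eventuallyEq h2 ?_
  filter_upwards [ψ.eventuallyEq_one.eventuallyEq_nhds, hU.mem_nhds hx] with q hq hqU
  congr 1
  have : D Y q = D (fun q ↦ ψ q • Y q) q := by
    refine conn_congr D (hY q hqU).diffAt (FieldSmoothAt.diffAt hσ.contMDiffAt) ?_
    filter_upwards [hq] with y hy
    rw [hy]; simp
  rw [this]

lemma formSmoothAt_christoffel [T2Space M] {D : AffConn I M}
    (hD : CovariantDerivative.ContMDiffCovariantDerivative D ∞) {x₀ q : M}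
    (hq : q ∈ (chartAt H x₀).source) : FormSmoothAt (christoffel D x₀) q := by
  refine FormSmoothAt.of_cst hq fun v ↦ contMDiffAt_clm_of_apply fun w ↦ ?_
  have h := fieldSmoothAt_conn hD (chartAt H x₀).open_source
    (fun y hy ↦ fieldSmoothAt_cst hy w) hq (fieldSmoothAt_cst hq v)
  refine ((fieldSmoothAt_iff hq).1 h).congr_of_eventuallyEq ?_
  filter_upwards [(chartAt H x₀).open_source.mem_nhds hq] with y hy
  rw [tr_conn_cst D hy]

end Connections

section BundleSmoothness

variable {E : Type*} [NormedAddCommGroup E] [NormedSpace ℝ E] [FiniteDimensional ℝ E]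
  {H : Type*} [TopologicalSpace H] {I : ModelWithCorners ℝ E H}
  {M : Type*} [TopologicalSpace M] [ChartedSpace H M] [IsManifold I ∞ M]
  {W : Type*} [NormedAddCommGroup W] [NormedSpace ℝ W]

/-! ### Smooth sections of tensor bundles -/

lemma endSmoothAt_iff {K : EndField I M} {x : M} :
    ContMDiffAt I (I.prod 𝓘(ℝ, E →L[ℝ] E)) ∞
      (fun x ↦ Bundle.TotalSpace.mk' (E →L[ℝ] E)
        (E := fun x : M ↦ TangentSpace I x →L[ℝ] TangentSpace I x) x (K x)) x ↔
    ∀ v, ContMDiffAt I 𝓘(ℝ, E) ∞ (fun q ↦ tr I x q (K q (cst I x v q))) x := by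
  have key : ∀ v, (fun q ↦ tr I x q (K q (cst I x v q))) =ᶠ[𝓝 x]
      fun q ↦ ContinuousLinearMap.inCoordinates E (TangentSpace I : M → Type _) E
        (TangentSpace I : M → Type _) x q x q (K q) v := by
    intro v
    filter_upwards [(chartAt H x).open_source.mem_nhds (mem_chart_source H x)] with q hq
    rw [cst_eq_symmL hq]
    rfl
  rw [contMDiffAt_hom_bundle]
  refine ⟨fun h v ↦ (h.2.clm_apply contMDiffAt_const).congr_of_eventuallyEq (key v),
    fun h ↦ ⟨contMDiffAt_id, ?_⟩⟩
  exact contMDiffAt_clm_of_apply fun v ↦ (h v).congr_of_eventuallyEq (key v).symm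

lemma formSmoothAt_iff {K : ∀ x : M, TangentSpace I x →L[ℝ] W} {x : M} :
    ContMDiffAt I (I.prod 𝓘(ℝ, E →L[ℝ] W)) ∞
      (fun x ↦ Bundle.TotalSpace.mk' (E →L[ℝ] W)
        (E := fun x : M ↦ TangentSpace I x →L[ℝ] Bundle.Trivial M W x) x (K x)) x ↔
    FormSmoothAt K x := by
  have key : ∀ v, (fun q ↦ K q (cst I x v q)) =ᶠ[𝓝 x]
      fun q ↦ ContinuousLinearMap.inCoordinates E (TangentSpace I : M → Type _) W
        (Bundle.Trivial M W) x q x q (K q) v := by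
    intro v
    filter_upwards [(chartAt H x).open_source.mem_nhds (mem_chart_source H x)] with q hq
    rw [cst_eq_symmL hq, ContinuousLinearMap.inCoordinates]
    simp [Bundle.Trivial.continuousLinearMapAt_trivialization]
  rw [contMDiffAt_hom_bundle]
  refine ⟨fun h v ↦ (h.2.clm_apply contMDiffAt_const).congr_of_eventuallyEq (key v),
    fun h ↦ ⟨contMDiffAt_id, ?_⟩⟩
  exact contMDiffAt_clm_of_apply fun v ↦ (h v).congr_of_eventuallyEq (key v).symm

/-- A field of endomorphisms which preserves smoothness of vector fields at `x`. -/
def EndSmoothAt (K : EndField I M) (x : M) : Prop :=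
  ∀ ⦃X : VField I M⦄, FieldSmoothAt X x → FieldSmoothAt (fun q ↦ K q (X q)) x

lemma SmoothEnd.endSmoothAt {K : EndField I M} (hK : SmoothEnd K) (x : M) : EndSmoothAt K x :=
  fun _ hX ↦ (hK x).clm_bundle_apply hX

lemma smoothEnd_of_endSmoothAt {K : EndField I M} (h : ∀ x, EndSmoothAt K x) : SmoothEnd K :=
  fun x ↦ endSmoothAt_iff.2 fun v ↦
    (fieldSmoothAt_iff (mem_chart_source H x)).1 (h x (fieldSmoothAt_cst (mem_chart_source H x) v))

/-- The one-form `v ↦ K v` in coordinates. -/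
lemma EndSmoothAt.formSmoothAt {K : EndField I M} {x₀ x : M} (hx : x ∈ (chartAt H x₀).source)
    (hK : EndSmoothAt K x) : FormSmoothAt (W := E) (fun q ↦ tr I x₀ q ∘L K q) x :=
  FormSmoothAt.of_cst hx fun v ↦ (fieldSmoothAt_iff hx).1 (hK (fieldSmoothAt_cst hx v))

lemma EndSmoothAt.fieldDiffAt {K : EndField I M} {x : M} (hK : EndSmoothAt K x) {X : VField I M}
    (hX : FieldDiffAt X x) : FieldDiffAt (fun q ↦ K q (X q)) x :=
  (fieldDiffAt_iff (mem_chart_source H x)).2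
    ((hK.formSmoothAt (mem_chart_source H x)).apply_diff hX)

/-- A `(1,2)`-tensor field which is smooth at `x`. -/
def TensorSmoothAt (B : Tensor12 I M) (x : M) : Prop :=
  ∀ ⦃X Y : VField I M⦄, FieldSmoothAt X x → FieldSmoothAt Y x →
    FieldSmoothAt (fun q ↦ B q (X q) (Y q)) x

lemma SmoothTensor12.tensorSmoothAt {B : Tensor12 I M} (hB : SmoothTensor12 B) (x : M) :
    TensorSmoothAt B x :=
  fun _ _ hX hY ↦ (hB x).clm_bundle_apply₂ hX hY

lemma SmoothOneForm.formSmoothAt {θ : OneForm I M} (h : SmoothOneForm θ) (x : M) :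
    FormSmoothAt θ x := formSmoothAt_iff.1 (h x)

lemma smoothOneForm_iff {θ : OneForm I M} : SmoothOneForm θ ↔ ∀ x, FormSmoothAt θ x :=
  ⟨fun h x ↦ h.formSmoothAt x, fun h x ↦ formSmoothAt_iff.2 (h x)⟩

lemma smoothCOneForm_iff {θ : COneForm I M} : SmoothCOneForm θ ↔ ∀ x, FormSmoothAt θ x :=
  ⟨fun h x ↦ formSmoothAt_iff.1 (h x), fun h x ↦ formSmoothAt_iff.2 (h x)⟩

/-- A smooth field of bilinear forms. -/
structure IsSmoothForm2 (k : Form2 I M) : Prop where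
  add_left : ∀ x u v w, k x (u + v) w = k x u w + k x v w
  smul_left : ∀ x (a : ℝ) u w, k x (a • u) w = a * k x u w
  add_right : ∀ x w u v, k x w (u + v) = k x w u + k x w v
  smul_right : ∀ x (a : ℝ) w u, k x w (a • u) = a * k x w u
  smooth : ∀ ⦃X Y : VField I M⦄ ⦃x : M⦄, FieldSmoothAt X x → FieldSmoothAt Y x →
    ContMDiffAt I 𝓘(ℝ, ℝ) ∞ (fun q ↦ k q (X q) (Y q)) x

lemma SmoothTensor02.isSmoothForm2 {c : Tensor02 I M} (hc : SmoothTensor02 c) :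
    IsSmoothForm2 c.form where
  add_left := by simp [Tensor02.form]
  smul_left := by simp [Tensor02.form]
  add_right := by simp [Tensor02.form]
  smul_right := by simp [Tensor02.form]
  smooth _ _ x hX hY := (Bundle.contMDiffAt_section x).1 ((hc x).clm_bundle_apply₂ hX hY)

instance (x : M) : FiniteDimensional ℝ (TangentSpace I x) := inferInstanceAs (FiniteDimensional ℝ E)

instance (x : M) : T2Space (TangentSpace I x) := inferInstanceAs (T2Space E)

/-- The field of endomorphisms `v ↦ B_v Y`. -/
def flipField (B : Tensor12 I M) (Y : VField I M) : EndField I M := fun q ↦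
  LinearMap.toContinuousLinearMap
    { toFun := fun v ↦ B q v (Y q)
      map_add' := fun u v ↦ by rw [map_add, add_apply]
      map_smul' := fun a v ↦ by rw [map_smul, smul_apply, RingHom.id_apply] }

lemma flipField_apply (B : Tensor12 I M) (Y : VField I M) (q : M) (v : TangentSpace I q) :
    flipField B Y q v = B q v (Y q) := rfl

/-- The tensor field given by a smooth field of bilinear forms. -/
def IsSmoothForm2.tensor {k : Form2 I M} (hk : IsSmoothForm2 k) : Tensor02 I M := fun x ↦
  LinearMap.toContinuousLinearMap
    (LinearMap.toContinuousLinearMap.toLinearMap ∘ₗ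
      LinearMap.mk₂ ℝ (k x) (hk.add_left x) (hk.smul_left x) (hk.add_right x)
        (fun a w u ↦ hk.smul_right x a w u))

lemma IsSmoothForm2.tensor_apply {k : Form2 I M} (hk : IsSmoothForm2 k) (x : M)
    (u v : TangentSpace I x) : hk.tensor x u v = k x u v := rfl

lemma IsSmoothForm2.add {k l : Form2 I M} (hk : IsSmoothForm2 k) (hl : IsSmoothForm2 l) :
    IsSmoothForm2 (fun x u v ↦ k x u v + l x u v) where
  add_left x u v w := by rw [hk.add_left, hl.add_left]; ring
  smul_left x a u w := by rw [hk.smul_left, hl.smul_left]; ring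
  add_right x u v w := by rw [hk.add_right, hl.add_right]; ring
  smul_right x a u w := by rw [hk.smul_right, hl.smul_right]; ring
  smooth _ _ _ hX hY := (hk.smooth hX hY).add (hl.smooth hX hY)

lemma IsSmoothForm2.smul {k : Form2 I M} (hk : IsSmoothForm2 k) (a : ℝ) :
    IsSmoothForm2 (fun x u v ↦ a * k x u v) where
  add_left x u v w := by rw [hk.add_left]; ring
  smul_left x a u w := by rw [hk.smul_left]; ring
  add_right x u v w := by rw [hk.add_right]; ring
  smul_right x a u w := by rw [hk.smul_right]; ring
  smooth _ _ _ hX hY := contMDiffAt_const.mul (hk.smooth hX hY)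

lemma IsSmoothForm2.swap {k : Form2 I M} (hk : IsSmoothForm2 k) :
    IsSmoothForm2 (fun x u v ↦ k x v u) where
  add_left x u v w := hk.add_right x w u v
  smul_left x a u w := hk.smul_right x a w u
  add_right x u v w := hk.add_left x v w u
  smul_right x a u w := hk.smul_left x a w u
  smooth _ _ _ hX hY := hk.smooth hY hX

lemma IsSmoothForm2.symm {k : Form2 I M} (hk : IsSmoothForm2 k) : IsSmoothForm2 (symm k) := by
  have : CProj.symm k = fun x u v ↦ (1 / 2 : ℝ) * (k x u v + k x v u) := by
    funext x u v; rw [CProj.symm]; ring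
  rw [this]
  exact (hk.add hk.swap).smul _

lemma IsSmoothForm2.pullJ {k : Form2 I M} (hk : IsSmoothForm2 k) {J : EndField I M}
    (hJ : ∀ x, EndSmoothAt J x) : IsSmoothForm2 (pullJ J k) where
  add_left x u v w := by simp only [CProj.pullJ, map_add, hk.add_left]
  smul_left x a u w := by simp only [CProj.pullJ, map_smul, hk.smul_left]
  add_right x u v w := by simp only [CProj.pullJ, map_add, hk.add_right]
  smul_right x a u w := by simp only [CProj.pullJ, map_smul, hk.smul_right]
  smooth _ _ _ hX hY := hk.smooth (hJ _ hX) (hJ _ hY)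

end BundleSmoothness

section Leibniz

variable {E : Type*} [NormedAddCommGroup E] [NormedSpace ℝ E] [FiniteDimensional ℝ E]
  {H : Type*} [TopologicalSpace H] {I : ModelWithCorners ℝ E H} [I.Boundaryless]
  {M : Type*} [TopologicalSpace M] [ChartedSpace H M] [IsManifold I ∞ M]
  {W : Type*} [NormedAddCommGroup W] [NormedSpace ℝ W]

/-! ### Covariant derivatives of tensors -/

lemma tr_injective {x₀ q : M} (hq : q ∈ (chartAt H x₀).source) :
    Function.Injective (tr I x₀ q) := ((isFrame_tr x₀).bijective q hq).1

/-- A smooth connection in its frame yields smooth covariant derivatives. -/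
lemma IsRep.contMDiffCovariantDerivative {D : AffConn I M}
    (h : ∀ x : M, ∃ (U : Set M) (Φ : ∀ q : M, TangentSpace I q →L[ℝ] W)
      (A : ∀ q : M, TangentSpace I q →L[ℝ] W →L[ℝ] W), IsOpen U ∧ x ∈ U ∧ IsFrame Φ U ∧
      (∀ q ∈ U, FormSmoothAt A q) ∧ IsRep D Φ A U) :
    CovariantDerivative.ContMDiffCovariantDerivative D ∞ := by
  refine ⟨⟨fun {σ} hσ ↦ contMDiffOn_univ.2 fun x ↦ endSmoothAt_iff.2 fun v ↦ ?_⟩⟩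
  obtain ⟨U, Φ, A, hU, hx, hΦ, hA, hD⟩ := h x
  have hx' := mem_chart_source H x
  have hσ' : ∀ q, FieldSmoothAt σ q := fun q ↦ (contMDiffOn_univ.1 hσ) q
  have hv := fieldSmoothAt_cst (I := I) hx' v
  refine (fieldSmoothAt_iff hx').1 (hΦ.fieldSmoothAt hx ?_)
  have e : (fun q ↦ Φ q (D σ q (cst I x v q))) =ᶠ[𝓝 x] fun q ↦
      mvfderiv I (fun q' ↦ Φ q' (σ q')) q (cst I x v q) + A q (cst I x v q) (Φ q (σ q)) := by
    filter_upwards [hU.mem_nhds hx] with q hq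
    exact hD q hq σ (hσ' q).diffAt _
  have h1 := (hΦ.smooth x hx).apply (hσ' x)
  exact (((formSmoothAt_mvfderiv h1).apply hv).add
    (((hA x hx).apply hv).clm_apply h1)).congr_of_eventuallyEq e

lemma tr_conn (D : AffConn I M) {x₀ q : M} (hq : q ∈ (chartAt H x₀).source) {Y : VField I M}
    (hY : FieldDiffAt Y q) (u : TangentSpace I q) :
    tr I x₀ q (D Y q u) =
      mvfderiv I (fun q' ↦ tr I x₀ q' (Y q')) q u + christoffel D x₀ q u (tr I x₀ q (Y q)) :=
  isRep_christoffel D x₀ q hq Y hY u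

/-- The derivative of `Φ(X)` for a one-form `Φ`, computed with a connection. -/
lemma mvfderiv_form_conn (D : AffConn I M) {Φ : ∀ q : M, TangentSpace I q →L[ℝ] W} {x₀ x : M}
    (hx : x ∈ (chartAt H x₀).source)
    (hΦ : FormSmoothAt Φ x) {X : VField I M} (hX : FieldDiffAt X x) (u : TangentSpace I x) :
    mvfderiv I (fun q ↦ Φ q (X q)) x u - Φ x (D X x u) =
      mvfderiv I (fun q ↦ Φ q (cst I x₀ (tr I x₀ x (X x)) q)) x u -
        Φ x (D (cst I x₀ (tr I x₀ x (X x))) x u) := by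
  rw [mvfderiv_form_apply hx hΦ hX]
  have : D X x u = D (cst I x₀ (tr I x₀ x (X x))) x u +
      cst I x₀ (mvfderiv I (fun q ↦ tr I x₀ q (X q)) x u) x := by
    apply tr_injective hx
    rw [map_add, tr_conn D hx hX, tr_conn_cst D hx, tr_cst hx, add_comm]
  rw [this, map_add]
  abel

lemma covEnd_apply (D : AffConn I M) {K : EndField I M} {x : M} (hK : EndSmoothAt K x)
    {X : VField I M} (hX : FieldDiffAt X x) (u : TangentSpace I x) :
    D (fun q ↦ K q (X q)) x u = covEnd D K x u (X x) + K x (D X x u) := by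
  have hx := mem_chart_source H x
  have h := mvfderiv_form_conn D hx (hK.formSmoothAt hx) hX u
  have hc := fieldSmoothAt_cst (I := I) hx (tr I x x (X x))
  apply tr_injective hx
  rw [covEnd, ext_eq, map_add, map_sub, tr_conn D hx (hK.fieldDiffAt hX),
    tr_conn D hx (hK hc).diffAt, cst_tr hx]
  simp only [ContinuousLinearMap.comp_apply] at h
  rw [← sub_eq_iff_eq_add, add_sub_right_comm, h]
  abel

lemma covTensor12_apply (D : AffConn I M) {B : Tensor12 I M} {x : M} (hB : TensorSmoothAt B x)
    {X Y : VField I M} (hX : FieldSmoothAt X x) (hY : FieldSmoothAt Y x) (u : TangentSpace I x) :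
    D (fun q ↦ B q (X q) (Y q)) x u =
      covTensor12 D B x u (X x) (Y x) + B x (D X x u) (Y x) + B x (X x) (D Y x u) := by
  have hx := mem_chart_source H x
  have hc := fieldSmoothAt_cst (I := I) hx (tr I x x (X x))
  have h1 := covEnd_apply D (K := flipField B Y) (x := x)
    (fun Z hZ ↦ hB hZ hY) hX.diffAt u
  have h2 := covEnd_apply D (K := fun q ↦ B q (cst I x (tr I x x (X x)) q)) (x := x)
    (fun Z hZ ↦ hB hc hZ) hY.diffAt u
  simp only [covEnd, covTensor12, ext_eq, flipField_apply, cst_tr hx] at h1 h2 ⊢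
  rw [h1, h2]
  abel

lemma covForm2_apply (D : AffConn I M) {k : Form2 I M} (hk : IsSmoothForm2 k) {x : M}
    {X Y : VField I M} (hX : FieldSmoothAt X x) (hY : FieldSmoothAt Y x) (u : TangentSpace I x) :
    mvfderiv I (fun q ↦ k q (X q) (Y q)) x u =
      covForm2 D k x u (X x) (Y x) + k x (D X x u) (Y x) + k x (X x) (D Y x u) := by
  have hx := mem_chart_source H x
  have hc := fieldSmoothAt_cst (I := I) hx (tr I x x (X x))
  have h1 := mvfderiv_form_conn D (Φ := fun q ↦ hk.swap.tensor q (Y q)) hx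
    (FormSmoothAt.of_cst hx fun v ↦ hk.smooth (fieldSmoothAt_cst hx v) hY) hX.diffAt u
  have h2 := mvfderiv_form_conn D (Φ := fun q ↦ hk.tensor q (cst I x (tr I x x (X x)) q)) hx
    (FormSmoothAt.of_cst hx fun v ↦ hk.smooth hc (fieldSmoothAt_cst hx v)) hY.diffAt u
  simp only [covForm2, ext_eq, hk.tensor_apply, hk.swap.tensor_apply, cst_tr hx]
    at h1 h2 ⊢
  linarith

variable [CompleteSpace E]

lemma mlieBracket_eq_of_torsion {D : AffConn I M} (hD : D.torsion = 0) {X Y : VField I M} {x : M}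
    (hX : FieldDiffAt X x) (hY : FieldDiffAt Y x) :
    VectorField.mlieBracket I X Y x = D Y x (X x) - D X x (Y x) := by
  have h := D.torsion_apply hX hY
  rw [hD] at h
  exact (sub_eq_zero.1 h.symm).symm

lemma conn_cst_comm {D : AffConn I M} (hD : D.torsion = 0) {x : M} (u v : TangentSpace I x) :
    D (cst I x (tr I x x u)) x v = D (cst I x (tr I x x v)) x u := by
  have hx := mem_chart_source H x
  have h := mlieBracket_eq_of_torsion hD (fieldSmoothAt_cst (I := I) hx (tr I x x u)).diffAt
    (fieldSmoothAt_cst hx (tr I x x v)).diffAt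
  rw [mlieBracket_cst, cst_tr hx, cst_tr hx] at h
  exact (sub_eq_zero.1 h.symm).symm

lemma torsion_eq_zero_of_cst {D : AffConn I M}
    (h : ∀ (x : M) (u v : TangentSpace I x),
      D (cst I x (tr I x x u)) x v = D (cst I x (tr I x x v)) x u) : D.torsion = 0 := by
  funext x
  ext u v
  have hx := mem_chart_source H x
  have := D.torsion_apply (fieldSmoothAt_cst (I := I) hx (tr I x x u)).diffAt
    (fieldSmoothAt_cst hx (tr I x x v)).diffAt
  rw [mlieBracket_cst, cst_tr hx, cst_tr hx, h x u v] at this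
  simpa using this

end Leibniz

section Curvature

variable {E : Type*} [NormedAddCommGroup E] [NormedSpace ℝ E] [FiniteDimensional ℝ E]
  {H : Type*} [TopologicalSpace H] {I : ModelWithCorners ℝ E H} [I.Boundaryless]
  {M : Type*} [TopologicalSpace M] [ChartedSpace H M] [IsManifold I ∞ M]
  {W : Type*} [NormedAddCommGroup W] [NormedSpace ℝ W]

/-! ### The curvature in coordinates and its symmetries -/

lemma extD_eq_formRep {Φ : ∀ q : M, TangentSpace I q →L[ℝ] W} {x₀ x : M}
    (hx : x ∈ (chartAt H x₀).source) (hΦ : FormSmoothAt Φ x) (u v : TangentSpace I x) :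
    extD Φ x u v = mvfderiv I (formRep x₀ Φ) x u (tr I x₀ x v) -
      mvfderiv I (formRep x₀ Φ) x v (tr I x₀ x u) := by
  have key : ∀ w : E, mvfderiv I (fun q ↦ Φ q (cst I x₀ w q)) x =
      mvfderiv I (fun q ↦ formRep x₀ Φ q w) x := fun w ↦ mvfderiv_congr (by
    filter_upwards [(chartAt H x₀).open_source.mem_nhds hx] with q hq
    rw [formRep_apply hq])
  have hd := (hΦ.contMDiffAt_formRep hx).mdifferentiableAt (by simp)
  rw [extD_eq hx hΦ, key, key, mvfderiv_apply_const hd, mvfderiv_apply_const hd]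

/-- The curvature of `d + Γ` for an operator-valued function `Γ`. -/
def curvRep (D : AffConn I M) (x₀ q : M) (u v : TangentSpace I q) (w : E) : E :=
  (mvfderiv I (formRep x₀ (christoffel D x₀)) q u (tr I x₀ q v) -
    mvfderiv I (formRep x₀ (christoffel D x₀)) q v (tr I x₀ q u)) w +
    christoffel D x₀ q u (christoffel D x₀ q v w) - christoffel D x₀ q v (christoffel D x₀ q u w)

variable [CompleteSpace E] [T2Space M]

lemma tr_curv {D : AffConn I M} (hD : CovariantDerivative.ContMDiffCovariantDerivative D ∞)
    {x₀ q : M} (hq : q ∈ (chartAt H x₀).source) (u v w : TangentSpace I q) :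
    tr I x₀ q (curv D q u v w) = curvRep D x₀ q u v (tr I x₀ q w) := by
  rw [(isRep_christoffel D x₀).curv_eq (isFrame_tr x₀)
    (fun y hy ↦ formSmoothAt_christoffel hD hy) (chartAt H x₀).open_source hq,
    extD_eq_formRep hq (formSmoothAt_christoffel hD hq), curvRep]

/-- The curvature operator `w ↦ R_{u,v} w`. -/
def curvEnd {D : AffConn I M} (hD : CovariantDerivative.ContMDiffCovariantDerivative D ∞)
    (x : M) (u v : TangentSpace I x) : TangentSpace I x →ₗ[ℝ] TangentSpace I x where
  toFun := curv D x u v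
  map_add' w w' := by
    have hx := mem_chart_source H x
    apply tr_injective hx
    simp only [map_add, tr_curv hD hx, curvRep]
    abel
  map_smul' a w := by
    have hx := mem_chart_source H x
    apply tr_injective hx
    simp only [map_smul, tr_curv hD hx, curvRep, RingHom.id_apply, smul_add, smul_sub]

/-- The operator `u ↦ R_{u,v} w`. -/
def ricciEnd {D : AffConn I M} (hD : CovariantDerivative.ContMDiffCovariantDerivative D ∞)
    (x : M) (v w : TangentSpace I x) : TangentSpace I x →ₗ[ℝ] TangentSpace I x where
  toFun u := curv D x u v w
  map_add' u u' := by
    have hx := mem_chart_source H x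
    apply tr_injective hx
    simp only [map_add, tr_curv hD hx, curvRep, sub_apply, add_apply]
    abel
  map_smul' a u := by
    have hx := mem_chart_source H x
    apply tr_injective hx
    simp only [map_smul, tr_curv hD hx, curvRep, RingHom.id_apply, smul_add, smul_sub, sub_apply,
      smul_apply]

lemma curv_swap {D : AffConn I M} (x : M) (u v w : TangentSpace I x)
    (hD : CovariantDerivative.ContMDiffCovariantDerivative D ∞) :
    curv D x v u w = - curv D x u v w := by
  have hx := mem_chart_source H x
  apply tr_injective hx
  simp only [map_neg, tr_curv hD hx, curvRep, sub_apply]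
  abel

lemma christoffel_symm {D : AffConn I M} (hD : D.torsion = 0) {x₀ q : M}
    (hq : q ∈ (chartAt H x₀).source) (u v : TangentSpace I q) :
    christoffel D x₀ q u (tr I x₀ q v) = christoffel D x₀ q v (tr I x₀ q u) := by
  have hq' := mem_chart_source H q
  have key : ∀ u v : TangentSpace I q, tr I x₀ q (D (cst I q (tr I q q v)) q u) =
      mvfderiv I (fun y ↦ tr I x₀ y (cst I q (tr I q q v) y)) q u +
        christoffel D x₀ q u (tr I x₀ q v) := fun u v ↦ by
    rw [tr_conn D hq (fieldSmoothAt_cst hq' _).diffAt, cst_tr hq']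
  have h0 : extD (W := E) (tr I x₀) q u v = 0 := by
    have hc : ∀ w : E, (fun y ↦ tr I x₀ y (cst I x₀ w y)) =ᶠ[𝓝 q] fun _ ↦ w := fun w ↦ by
      filter_upwards [(chartAt H x₀).open_source.mem_nhds hq] with y hy
      rw [tr_cst hy]
    rw [extD_eq hq (formSmoothAt_tr hq), mvfderiv_congr (hc _), mvfderiv_congr (hc _)]
    simp [mvfderiv_const]
  rw [extD] at h0
  have h1 := congrArg (tr I x₀ q) (conn_cst_comm hD u v)
  rw [key, key] at h1
  have h2 := sub_eq_zero.1 h0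
  rw [h2] at h1
  exact (add_left_cancel h1).symm

/-- The first Bianchi identity. -/
lemma bianchi {D : AffConn I M} (hD : CovariantDerivative.ContMDiffCovariantDerivative D ∞)
    (hT : D.torsion = 0) (x : M) (u v w : TangentSpace I x) :
    curv D x u v w + curv D x v w u + curv D x w u v = 0 := by
  have hx := mem_chart_source H x
  have hs := (formSmoothAt_christoffel hD hx).contMDiffAt_formRep hx
  have hd := hs.mdifferentiableAt (by simp)
  have key : ∀ u v w : TangentSpace I x,
      mvfderiv I (formRep x (christoffel D x)) x u (tr I x x v) (tr I x x w) =
      mvfderiv I (formRep x (christoffel D x)) x u (tr I x x w) (tr I x x v) := by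
    intro u v w
    have h2 : ∀ v w : TangentSpace I x,
        mvfderiv I (formRep x (christoffel D x)) x u (tr I x x v) (tr I x x w) =
        mvfderiv I (fun q ↦ formRep x (christoffel D x) q (tr I x x v) (tr I x x w)) x u := by
      intro v w
      have h3 : MDifferentiableAt I 𝓘(ℝ, E →L[ℝ] E)
          (fun q ↦ formRep x (christoffel D x) q (tr I x x v)) x :=
        mdifferentiableAt_clm (ContinuousLinearMap.apply ℝ _ (tr I x x v)) hd
      rw [mvfderiv_apply_const h3, mvfderiv_apply_const hd]
    rw [h2, h2]
    refine DFunLike.congr_fun (mvfderiv_congr ?_) u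
    filter_upwards [(chartAt H x).open_source.mem_nhds hx] with q hq
    have h4 := christoffel_symm hT hq (cst I x (tr I x x v) q) (cst I x (tr I x x w) q)
    rw [tr_cst hq, tr_cst hq] at h4
    rw [formRep_apply hq, formRep_apply hq, h4]
  apply tr_injective hx
  simp only [map_add, map_zero, tr_curv hD hx, curvRep, sub_apply]
  rw [key u v w, key v u w, key w v u, christoffel_symm hT hx v w, christoffel_symm hT hx u w,
    christoffel_symm hT hx v u]
  abel

/-- The trace computed in the coordinate frame of a chart. -/
lemma trace_eq_sum_cst {x₀ q : M} (hq : q ∈ (chartAt H x₀).source)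
    (L : TangentSpace I q →ₗ[ℝ] TangentSpace I q) :
    LinearMap.trace ℝ _ L = ∑ i, (Module.finBasis ℝ E).coord i
      (tr I x₀ q (L (cst I x₀ (Module.finBasis ℝ E i) q))) := by
  let e : E ≃ₗ[ℝ] TangentSpace I q := (LinearEquiv.ofBijective
    (tr I x₀ q : TangentSpace I q →ₗ[ℝ] E) ((isFrame_tr x₀).bijective q hq)).symm
  have he : ∀ w, e w = cst I x₀ w q := fun w ↦ by
    apply tr_injective hq
    rw [tr_cst hq]
    exact LinearEquiv.apply_symm_apply (LinearEquiv.ofBijective _ _) w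
  have he' : ∀ u, e.symm u = tr I x₀ q u := fun u ↦ rfl
  rw [LinearMap.trace_eq_matrix_trace ℝ ((Module.finBasis ℝ E).map e), Matrix.trace]
  refine Finset.sum_congr rfl fun i _ ↦ ?_
  rw [Matrix.diag_apply, LinearMap.toMatrix_apply, Module.Basis.map_apply, Module.Basis.map_repr,
    LinearEquiv.trans_apply, he, he']
  rfl

lemma ricci_eq_trace {D : AffConn I M}
    (hD : CovariantDerivative.ContMDiffCovariantDerivative D ∞) (x : M) (v w : TangentSpace I x) :
    ricci D x v w = LinearMap.trace ℝ _ (ricciEnd hD x v w) := by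
  rw [trace_eq_sum_cst (mem_chart_source H x), ricci]
  refine Finset.sum_congr rfl fun i _ ↦ ?_
  rw [tr_self, cst_self]
  rfl

/-- The trace of the curvature is determined by the skew-symmetric part of the Ricci tensor. -/
lemma trace_curvEnd {D : AffConn I M}
    (hD : CovariantDerivative.ContMDiffCovariantDerivative D ∞) (hT : D.torsion = 0) (x : M)
    (v w : TangentSpace I x) :
    LinearMap.trace ℝ _ (curvEnd hD x v w) = - 2 * asymm (ricci D) x v w := by
  have h : curvEnd hD x v w = ricciEnd hD x w v - ricciEnd hD x v w := by
    ext u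
    have hb := bianchi hD hT x u v w
    have hs := curv_swap x u w v hD
    change curv D x v w u = curv D x u w v - curv D x u v w
    rw [hs] at hb
    exact sub_eq_zero.1 (by rw [← hb]; abel)
  rw [h, map_sub, asymm, ricci_eq_trace hD, ricci_eq_trace hD]
  ring

lemma isSmoothForm2_ricci {D : AffConn I M}
    (hD : CovariantDerivative.ContMDiffCovariantDerivative D ∞) : IsSmoothForm2 (ricci D) where
  add_left x u v w := by
    rw [ricci_eq_trace hD, ricci_eq_trace hD, ricci_eq_trace hD, ← map_add]
    congr 1
    ext u'
    have hx := mem_chart_source H x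
    apply tr_injective hx
    change tr I x x (curv D x u' (u + v) w) = tr I x x (curv D x u' u w + curv D x u' v w)
    simp only [map_add, tr_curv hD hx, curvRep, sub_apply, add_apply]
    abel
  smul_left x a u w := by
    rw [ricci_eq_trace hD, ricci_eq_trace hD, ← smul_eq_mul, ← map_smul]
    congr 1
    ext u'
    have hx := mem_chart_source H x
    apply tr_injective hx
    change tr I x x (curv D x u' (a • u) w) = tr I x x (a • curv D x u' u w)
    simp only [map_smul, tr_curv hD hx, curvRep, smul_add, smul_sub, sub_apply, smul_apply]
  add_right x w u v := by
    rw [ricci_eq_trace hD, ricci_eq_trace hD, ricci_eq_trace hD, ← map_add]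
    congr 1
    ext u'
    exact (curvEnd hD x u' w).map_add u v
  smul_right x a w u := by
    rw [ricci_eq_trace hD, ricci_eq_trace hD, ← smul_eq_mul, ← map_smul]
    congr 1
    ext u'
    exact (curvEnd hD x u' w).map_smul a u
  smooth X Y x hX hY := by
    have hx := mem_chart_source H x
    have e : (fun q ↦ ricci D q (X q) (Y q)) =ᶠ[𝓝 x] fun q ↦ ∑ i, (Module.finBasis ℝ E).coord i
        (curvRep D x q (cst I x (Module.finBasis ℝ E i) q) (X q) (tr I x q (Y q))) := by
      filter_upwards [(chartAt H x).open_source.mem_nhds hx] with q hq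
      rw [ricci_eq_trace hD, trace_eq_sum_cst hq]
      refine Finset.sum_congr rfl fun i _ ↦ ?_
      rw [← tr_curv hD hq]
      rfl
    refine ContMDiffAt.congr_of_eventuallyEq (ContMDiffAt.sum fun i _ ↦ contMDiffAt_coord ?_ i) e
    have hΓ := formSmoothAt_christoffel hD hx
    have hs := hΓ.contMDiffAt_formRep hx
    have hb := fieldSmoothAt_cst (I := I) hx (Module.finBasis ℝ E i)
    have hX' := (fieldSmoothAt_iff hx).1 hX
    have hY' := (fieldSmoothAt_iff hx).1 hY
    have hb' := (fieldSmoothAt_iff hx).1 hb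
    have hd := formSmoothAt_mvfderiv hs
    exact (((((hd.apply hb).clm_apply hX').sub ((hd.apply hX).clm_apply hb')).clm_apply hY').add
      ((hΓ.apply hb).clm_apply ((hΓ.apply hX).clm_apply hY'))).sub
      ((hΓ.apply hX).clm_apply ((hΓ.apply hb).clm_apply hY'))

end Curvature

section Determinant

variable {E : Type*} [NormedAddCommGroup E] [NormedSpace ℝ E] [FiniteDimensional ℝ E]

/-! ### The derivative of the determinant -/

/-- The trace of a continuous operator, as a continuous functional. -/
def traceL (E : Type*) [NormedAddCommGroup E] [NormedSpace ℝ E] [FiniteDimensional ℝ E] :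
    (E →L[ℝ] E) →L[ℝ] ℝ :=
  LinearMap.toContinuousLinearMap (LinearMap.trace ℝ E ∘ₗ ContinuousLinearMap.coeLM ℝ)

lemma traceL_apply (f : E →L[ℝ] E) : traceL E f = LinearMap.trace ℝ E (f : E →ₗ[ℝ] E) := rfl

lemma traceL_eq_sum (f : E →L[ℝ] E) :
    traceL E f = ∑ i, (Module.finBasis ℝ E).coord i (f (Module.finBasis ℝ E i)) := by
  rw [traceL_apply, LinearMap.trace_eq_matrix_trace ℝ (Module.finBasis ℝ E), Matrix.trace]
  refine Finset.sum_congr rfl fun i _ ↦ ?_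
  rw [Matrix.diag_apply, LinearMap.toMatrix_apply]
  rfl

lemma traceL_comp_comm (f g : E →L[ℝ] E) : traceL E (f ∘L g) = traceL E (g ∘L f) :=
  LinearMap.trace_mul_comm ℝ (f : E →ₗ[ℝ] E) (g : E →ₗ[ℝ] E)

lemma contDiff_det {n : ℕ∞ω} : ContDiff ℝ n (fun f : E →L[ℝ] E ↦ LinearMap.det (f : E →ₗ[ℝ] E)) := by
  classical
  have h : (fun f : E →L[ℝ] E ↦ LinearMap.det (f : E →ₗ[ℝ] E)) = fun f ↦
      ∑ σ : Equiv.Perm (Fin (Module.finrank ℝ E)), (Equiv.Perm.sign σ : ℝ) *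
        ∏ i, (Module.finBasis ℝ E).coord (σ i) (f (Module.finBasis ℝ E i)) := by
    funext f
    rw [← LinearMap.det_toMatrix (Module.finBasis ℝ E), Matrix.det_apply']
    refine Finset.sum_congr rfl fun σ _ ↦ ?_
    congr 1
    refine Finset.prod_congr rfl fun i _ ↦ ?_
    rw [LinearMap.toMatrix_apply]
    rfl
  rw [h]
  refine ContDiff.sum fun σ _ ↦ contDiff_const.mul (contDiff_prod fun i _ ↦ ?_)
  exact (LinearMap.toContinuousLinearMap ((Module.finBasis ℝ E).coord (σ i)) ∘L
    ContinuousLinearMap.apply ℝ E (Module.finBasis ℝ E i)).contDiff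

/-- Jacobi's formula. -/
lemma fderiv_det_comp (A K : E →L[ℝ] E) :
    fderiv ℝ (fun f : E →L[ℝ] E ↦ LinearMap.det (f : E →ₗ[ℝ] E)) A (A ∘L K) =
      LinearMap.det (A : E →ₗ[ℝ] E) * traceL E K := by
  classical
  set b := Module.finBasis ℝ E
  set P : Polynomial ℝ := (Matrix.det (1 + (Polynomial.X : Polynomial ℝ) •
    (LinearMap.toMatrix b b (K : E →ₗ[ℝ] E)).map Polynomial.C)).divX.divX with hP
  have h1 : HasDerivAt (fun t : ℝ ↦ A + t • (A ∘L K)) (A ∘L K) 0 := by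
    simpa using ((hasDerivAt_id (0 : ℝ)).smul_const (A ∘L K)).const_add A
  have h2 := (contDiff_det (E := E) (n := 1)).differentiable (by simp) A
  have h3 := (show DifferentiableAt ℝ _ (A + (0 : ℝ) • (A ∘L K)) by
    simpa using h2).hasFDerivAt.comp_hasDerivAt (0 : ℝ) h1
  have h4 : ((fun f : E →L[ℝ] E ↦ LinearMap.det (f : E →ₗ[ℝ] E)) ∘
      fun t : ℝ ↦ A + t • (A ∘L K)) = fun t : ℝ ↦ LinearMap.det (A : E →ₗ[ℝ] E) *
        (1 + traceL E K * t + P.eval t * t ^ 2) := by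
    funext t
    have e : ((A + t • (A ∘L K) : E →L[ℝ] E) : E →ₗ[ℝ] E) =
        (A : E →ₗ[ℝ] E) * (1 + t • (K : E →ₗ[ℝ] E)) := by
      ext v; simp
    rw [Function.comp_apply, e, map_mul, traceL_apply, LinearMap.trace_eq_matrix_trace ℝ b,
      ← LinearMap.det_toMatrix b (1 + t • (K : E →ₗ[ℝ] E)), map_add, map_smul,
      LinearMap.toMatrix_one, Matrix.det_one_add_smul]
  have h5 : HasDerivAt (fun t : ℝ ↦ LinearMap.det (A : E →ₗ[ℝ] E) *
        (1 + traceL E K * t + P.eval t * t ^ 2))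
      (LinearMap.det (A : E →ₗ[ℝ] E) * traceL E K) 0 := by
    have h6 := (P.hasDerivAt 0).mul (hasDerivAt_pow 2 (0 : ℝ))
    have h7 := (((hasDerivAt_id (0 : ℝ)).const_mul (traceL E K)).const_add 1).add h6
    simpa using h7.const_mul (LinearMap.det (A : E →ₗ[ℝ] E))
  rw [h4] at h3
  have h8 := h3.unique h5
  simpa using h8

end Determinant

section TraceCurvature

variable {E : Type*} [NormedAddCommGroup E] [NormedSpace ℝ E] [FiniteDimensional ℝ E]
  {H : Type*} [TopologicalSpace H] {I : ModelWithCorners ℝ E H} [I.Boundaryless]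
  {M : Type*} [TopologicalSpace M] [ChartedSpace H M] [IsManifold I ∞ M]

/-! ### The trace of the curvature is exact -/

lemma mvfderiv_log_det {τ : M → E →L[ℝ] E} {y : M}
    (hτ : MDifferentiableAt I 𝓘(ℝ, E →L[ℝ] E) τ y)
    (hdet : LinearMap.det (τ y : E →ₗ[ℝ] E) ≠ 0) (u : TangentSpace I y) {K : E →L[ℝ] E}
    (hK : mvfderiv I τ y u = τ y ∘L K) :
    mvfderiv I (fun q ↦ Real.log (LinearMap.det (τ q : E →ₗ[ℝ] E))) y u = traceL E K := by
  have h1 := (contDiff_det (E := E) (n := 1)).differentiable (by simp) (τ y)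
  have h2 : HasFDerivAt (fun f : E →L[ℝ] E ↦ Real.log (LinearMap.det (f : E →ₗ[ℝ] E))) _ (τ y) :=
    h1.hasFDerivAt.log hdet
  rw [mvfderiv_fderiv_comp h2.differentiableAt hτ, h2.fderiv, hK, smul_apply, fderiv_det_comp,
    smul_eq_mul, inv_mul_cancel_left₀ hdet]

/-- The change of coordinates from the chart at `x₀` to the chart at `x₁`. -/
abbrev chartChange (I : ModelWithCorners ℝ E H) {M : Type*} [TopologicalSpace M]
    [ChartedSpace H M] [IsManifold I ∞ M] (x₁ x₀ : M) : M → E →L[ℝ] E :=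
  formRep x₀ (tr I x₁ : ∀ q : M, TangentSpace I q →L[ℝ] E)

lemma det_chartChange_ne_zero {x₀ x₁ q : M} (h₀ : q ∈ (chartAt H x₀).source)
    (h₁ : q ∈ (chartAt H x₁).source) :
    LinearMap.det (chartChange I x₁ x₀ q : E →ₗ[ℝ] E) ≠ 0 := by
  have hb : Function.Bijective (chartChange I x₁ x₀ q : E →ₗ[ℝ] E) := by
    have : ⇑(chartChange I x₁ x₀ q : E →ₗ[ℝ] E) = tr I x₁ q ∘ fun w ↦ cst I x₀ w q :=
      funext fun w ↦ formRep_apply h₀ _ _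
    rw [this]
    refine ((isFrame_tr x₁).bijective q h₁).comp ⟨fun a b hab ↦ ?_, fun u ↦ ⟨_, cst_tr h₀ u⟩⟩
    rw [← tr_cst (I := I) h₀ a, ← tr_cst (I := I) h₀ b]
    exact congrArg _ hab
  exact (LinearEquiv.isUnit_det' (LinearEquiv.ofBijective _ hb)).ne_zero

lemma chartChange_comp {x₀ x₁ x₂ q : M} (h₀ : q ∈ (chartAt H x₀).source)
    (h₁ : q ∈ (chartAt H x₁).source) :
    chartChange I x₂ x₀ q = chartChange I x₂ x₁ q ∘L chartChange I x₁ x₀ q := by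
  ext w
  rw [ContinuousLinearMap.comp_apply, formRep_apply h₀, formRep_apply h₀, formRep_apply h₁,
    cst_tr h₁]

lemma contMDiffAt_chartChange {x₀ x₁ q : M} (h₀ : q ∈ (chartAt H x₀).source)
    (h₁ : q ∈ (chartAt H x₁).source) :
    ContMDiffAt I 𝓘(ℝ, E →L[ℝ] E) ∞ (chartChange I x₁ x₀) q :=
  (formSmoothAt_tr h₁).contMDiffAt_formRep h₀

/-- The transformation rule of the Christoffel symbols. -/
lemma chartChange_comp_christoffel (D : AffConn I M) {x₀ x₁ q : M}
    (h₀ : q ∈ (chartAt H x₀).source) (h₁ : q ∈ (chartAt H x₁).source) (u : TangentSpace I q) :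
    chartChange I x₁ x₀ q ∘L christoffel D x₀ q u =
      mvfderiv I (chartChange I x₁ x₀) q u + christoffel D x₁ q u ∘L chartChange I x₁ x₀ q := by
  have hs : MDifferentiableAt I 𝓘(ℝ, E →L[ℝ] E) (chartChange I x₁ x₀) q :=
    (contMDiffAt_chartChange h₀ h₁).mdifferentiableAt (by simp)
  ext w
  have h := tr_conn D h₁ (fieldSmoothAt_cst (I := I) h₀ w).diffAt u
  have e : (fun y ↦ tr I x₁ y (cst I x₀ w y)) =ᶠ[𝓝 q] fun y ↦ chartChange I x₁ x₀ y w := by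
    filter_upwards [(chartAt H x₀).open_source.mem_nhds h₀] with y hy
    rw [formRep_apply hy]
  rw [mvfderiv_congr e, mvfderiv_apply_const hs, ← cst_tr h₀ (D (cst I x₀ w) q u),
    tr_conn_cst D h₀, e.eq_of_nhds, ← formRep_apply h₀] at h
  exact h

/-- The transformation rule of the traces of the Christoffel symbols. -/
lemma trace_christoffel_sub (D : AffConn I M) {x₀ x₁ q : M} (h₀ : q ∈ (chartAt H x₀).source)
    (h₁ : q ∈ (chartAt H x₁).source) (u : TangentSpace I q) :
    traceL E (christoffel D x₀ q u) - traceL E (christoffel D x₁ q u) =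
      mvfderiv I (fun y ↦ Real.log (LinearMap.det (chartChange I x₁ x₀ y : E →ₗ[ℝ] E))) q u := by
  have key := chartChange_comp_christoffel D h₀ h₁ u
  set τ := chartChange I x₁ x₀ with hτ
  have hs : MDifferentiableAt I 𝓘(ℝ, E →L[ℝ] E) τ q :=
    (contMDiffAt_chartChange h₀ h₁).mdifferentiableAt (by simp)
  have hinv : τ q ∘L chartChange I x₀ x₁ q = ContinuousLinearMap.id ℝ E := by
    ext w
    rw [ContinuousLinearMap.comp_apply, formRep_apply h₀, formRep_apply h₁, cst_tr h₀, tr_cst h₁]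
    rfl
  rw [mvfderiv_log_det hs (det_chartChange_ne_zero h₀ h₁) u
    (K := christoffel D x₀ q u - (chartChange I x₀ x₁ q ∘L christoffel D x₁ q u) ∘L τ q) ?_,
    map_sub, traceL_comp_comm, ← ContinuousLinearMap.comp_assoc, hinv, ContinuousLinearMap.id_comp]
  rw [ContinuousLinearMap.comp_sub, key, ContinuousLinearMap.comp_assoc,
    ← ContinuousLinearMap.comp_assoc _ (chartChange I x₀ x₁ q), hinv, ContinuousLinearMap.id_comp,
    add_sub_cancel_right]

/-- The logarithm of a smooth positive density, in the chart at `x₀`. -/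
def logDensity (ρ : SmoothPartitionOfUnity M I M Set.univ) (x₀ q : M) : ℝ :=
  ∑ᶠ i, ρ i q • Real.log (LinearMap.det (chartChange I i x₀ q : E →ₗ[ℝ] E))

variable {ρ : SmoothPartitionOfUnity M I M Set.univ}

lemma contMDiffAt_logDensity (hρ : ρ.IsSubordinate fun x ↦ (chartAt H x).source) {x₀ q : M}
    (h₀ : q ∈ (chartAt H x₀).source) : ContMDiffAt I 𝓘(ℝ, ℝ) ∞ (logDensity ρ x₀) q := by
  refine ρ.contMDiffAt_finsum (n := ⊤) fun i hi ↦ ?_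
  have h1 : ContDiffAt ℝ ∞ (fun f : E →L[ℝ] E ↦ Real.log (LinearMap.det (f : E →ₗ[ℝ] E)))
      (chartChange I i x₀ q) :=
    contDiff_det.contDiffAt.log (det_chartChange_ne_zero h₀ (hρ i hi))
  exact h1.contMDiffAt.comp q (contMDiffAt_chartChange h₀ (hρ i hi))

lemma logDensity_sub (hρ : ρ.IsSubordinate fun x ↦ (chartAt H x).source) {x₀ x₁ q : M}
    (h₀ : q ∈ (chartAt H x₀).source) (h₁ : q ∈ (chartAt H x₁).source) :
    logDensity ρ x₀ q = logDensity ρ x₁ q +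
      Real.log (LinearMap.det (chartChange I x₁ x₀ q : E →ₗ[ℝ] E)) := by
  set L := Real.log (LinearMap.det (chartChange I x₁ x₀ q : E →ₗ[ℝ] E))
  have hfin : (Function.support fun i ↦ ρ i q).Finite := ρ.locallyFinite.point_finite q
  have h1 : ∀ i, ρ i q • Real.log (LinearMap.det (chartChange I i x₀ q : E →ₗ[ℝ] E)) =
      ρ i q • Real.log (LinearMap.det (chartChange I i x₁ q : E →ₗ[ℝ] E)) + ρ i q • L := by
    intro i
    by_cases hi : ρ i q = 0
    · simp [hi]
    · have h₂ : q ∈ (chartAt H i).source := hρ i (subset_tsupport _ hi)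
      have : (chartChange I i x₀ q : E →ₗ[ℝ] E) =
          (chartChange I i x₁ q : E →ₗ[ℝ] E) ∘ₗ (chartChange I x₁ x₀ q : E →ₗ[ℝ] E) := by
        rw [chartChange_comp h₀ h₁]; rfl
      rw [this, LinearMap.det_comp, Real.log_mul (det_chartChange_ne_zero h₁ h₂)
        (det_chartChange_ne_zero h₀ h₁), smul_add]
  rw [logDensity, finsum_congr h1, finsum_add_distrib, logDensity, ← finsum_smul,
    ρ.sum_eq_one (Set.mem_univ q), one_smul]
  · exact hfin.subset fun i hi ↦ fun h ↦ hi (by simp [h])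
  · exact hfin.subset fun i hi ↦ fun h ↦ hi (by simp [h])

/-- The difference of the trace of the Christoffel symbols and the derivative of the logarithm of
a density. -/
def densityForm (D : AffConn I M) (ρ : SmoothPartitionOfUnity M I M Set.univ) : OneForm I M :=
  fun q ↦ traceL E ∘L christoffel D q q - mvfderiv I (logDensity ρ q) q

lemma densityForm_eq (D : AffConn I M) (hρ : ρ.IsSubordinate fun x ↦ (chartAt H x).source)
    {x₀ q : M} (h₀ : q ∈ (chartAt H x₀).source) (u : TangentSpace I q) :
    densityForm D ρ q u = traceL E (christoffel D x₀ q u) - mvfderiv I (logDensity ρ x₀) q u := by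
  have hq := mem_chart_source H q
  have e : logDensity ρ x₀ =ᶠ[𝓝 q] fun y ↦ logDensity ρ q y +
      Real.log (LinearMap.det (chartChange I q x₀ y : E →ₗ[ℝ] E)) := by
    filter_upwards [(chartAt H x₀).open_source.mem_nhds h₀,
      (chartAt H q).open_source.mem_nhds hq] with y hy₀ hy
    exact logDensity_sub hρ hy₀ hy
  have h1 : ContDiffAt ℝ ∞ (fun f : E →L[ℝ] E ↦ Real.log (LinearMap.det (f : E →ₗ[ℝ] E)))
      (chartChange I q x₀ q) :=
    contDiff_det.contDiffAt.log (det_chartChange_ne_zero h₀ hq)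
  have h2 : ContMDiffAt I 𝓘(ℝ, ℝ) ∞ (fun y ↦
      Real.log (LinearMap.det (chartChange I q x₀ y : E →ₗ[ℝ] E))) q :=
    h1.contMDiffAt.comp q (contMDiffAt_chartChange h₀ hq)
  rw [mvfderiv_congr e, mvfderiv_fun_add ((contMDiffAt_logDensity hρ hq).mdifferentiableAt
    (by simp)) (h2.mdifferentiableAt (by simp)), add_apply, ← trace_christoffel_sub D h₀ hq,
    densityForm]
  simp only [sub_apply, ContinuousLinearMap.comp_apply]
  ring

variable [CompleteSpace E] [T2Space M]

lemma formSmoothAt_densityForm {D : AffConn I M}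
    (hD : CovariantDerivative.ContMDiffCovariantDerivative D ∞)
    (hρ : ρ.IsSubordinate fun x ↦ (chartAt H x).source) (x : M) :
    FormSmoothAt (densityForm D ρ) x := by
  intro v
  have hx := mem_chart_source H x
  have hv := fieldSmoothAt_cst (I := I) hx v
  refine ContMDiffAt.congr_of_eventuallyEq (f := fun q ↦ traceL E (christoffel D x q (cst I x v q))
    - mvfderiv I (logDensity ρ x) q (cst I x v q)) ?_ ?_
  · exact (contMDiffAt_clm _ ((formSmoothAt_christoffel hD hx).apply hv)).sub
      ((formSmoothAt_mvfderiv (contMDiffAt_logDensity hρ hx)).apply hv)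
  · filter_upwards [(chartAt H x).open_source.mem_nhds hx] with q hq
    exact densityForm_eq D hρ hq _

lemma extD_densityForm {D : AffConn I M}
    (hD : CovariantDerivative.ContMDiffCovariantDerivative D ∞)
    (hρ : ρ.IsSubordinate fun x ↦ (chartAt H x).source) (x : M) (u v : TangentSpace I x) :
    extD (densityForm D ρ) x u v = LinearMap.trace ℝ _ (curvEnd hD x u v) := by
  have hx := mem_chart_source H x
  have hΓ := formSmoothAt_christoffel hD hx
  have hℓ := contMDiffAt_logDensity hρ hx
  have key : ∀ u v : TangentSpace I x,
      mvfderiv I (fun q ↦ densityForm D ρ q (cst I x (tr I x x v) q)) x u =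
      traceL E (mvfderiv I (fun q ↦ christoffel D x q (cst I x (tr I x x v) q)) x u) -
      mvfderiv I (fun q ↦ mvfderiv I (logDensity ρ x) q (cst I x (tr I x x v) q)) x u := by
    intro u v
    have hv := fieldSmoothAt_cst (I := I) hx (tr I x x v)
    have e : (fun q ↦ densityForm D ρ q (cst I x (tr I x x v) q)) =ᶠ[𝓝 x] fun q ↦
        traceL E (christoffel D x q (cst I x (tr I x x v) q)) -
          mvfderiv I (logDensity ρ x) q (cst I x (tr I x x v) q) := by
      filter_upwards [(chartAt H x).open_source.mem_nhds hx] with q hq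
      exact densityForm_eq D hρ hq _
    have h1 := (hΓ.apply hv).mdifferentiableAt (n := ∞) (by simp)
    rw [mvfderiv_congr e, mvfderiv_fun_sub (mdifferentiableAt_clm _ h1)
      (((formSmoothAt_mvfderiv hℓ).apply hv).mdifferentiableAt (by simp)), sub_apply,
      mvfderiv_clm _ h1]
  rw [extD, key, key, mvfderiv_mvfderiv_symm hℓ u v, sub_sub_sub_cancel_right,
    trace_eq_sum_cst hx]
  have hR : ∀ w, tr I x x (curvEnd hD x u v (cst I x w x)) =
      (extD (christoffel D x) x u v + christoffel D x x u ∘L christoffel D x x v -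
        christoffel D x x v ∘L christoffel D x x u) w := by
    intro w
    refine (tr_curv hD hx u v _).trans ?_
    rw [curvRep, tr_cst hx, extD_eq_formRep hx hΓ]
    rfl
  simp only [hR]
  rw [← traceL_eq_sum, map_sub, map_add, traceL_comp_comm, add_sub_cancel_right, extD, map_sub]

lemma extDerivOneForm_eq (γ : OneForm I M) (x : M) (u v : TangentSpace I x) :
    extDerivOneForm γ x u v = extD γ x u v := by
  rw [extDerivOneForm, ext_eq, ext_eq, mlieBracket_cst, map_zero, sub_zero, extD]

lemma extD_smul {γ : OneForm I M} {x : M} (hγ : FormSmoothAt γ x) (a : ℝ) (u v : TangentSpace I x) :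
    extD (fun q ↦ a • γ q) x u v = a * extD γ x u v := by
  have hx := mem_chart_source H x
  have h : ∀ v : E, mvfderiv I (fun q ↦ (a • γ q) (cst I x v q)) x =
      a • mvfderiv I (fun q ↦ γ q (cst I x v q)) x := fun v ↦ by
    ext u
    have := mvfderiv_clm (a • ContinuousLinearMap.id ℝ ℝ)
      ((hγ.apply (fieldSmoothAt_cst (I := I) hx v)).mdifferentiableAt (by simp)) u
    exact this
  rw [extD, extD, h, h, smul_apply, smul_apply, smul_eq_mul, smul_eq_mul, mul_sub]

/-- The skew-symmetric part of the Rho tensor is exact. -/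
lemma exists_extD_eq_asymm_rho [SigmaCompactSpace M] (n : ℕ) (J : EndField I M) {D : AffConn I M}
    (hD : CovariantDerivative.ContMDiffCovariantDerivative D ∞) (hT : D.torsion = 0) :
    ∃ α : OneForm I M, (∀ x, FormSmoothAt α x) ∧
      ∀ x u v, extD α x u v = asymm (rho n J D) x u v := by
  obtain ⟨ρ, hρ⟩ := SmoothPartitionOfUnity.exists_isSubordinate_chartAt_source I M
  have hs := formSmoothAt_densityForm hD hρ
  refine ⟨fun q ↦ (-(1 / (2 * ((n : ℝ) + 1)))) • densityForm D ρ q, fun x v ↦ ?_, fun x u v ↦ ?_⟩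
  · exact contMDiffAt_clm (-(1 / (2 * ((n : ℝ) + 1))) • ContinuousLinearMap.id ℝ ℝ) (hs x v)
  · have h0 : (n : ℝ) + 1 ≠ 0 := by positivity
    rw [extD_smul (hs x), extD_densityForm hD hρ, trace_curvEnd hD hT]
    simp only [asymm, rho, symm, pullJ]
    field_simp
    ring

end TraceCurvature

section FundamentalData

variable {E : Type*} [NormedAddCommGroup E] [NormedSpace ℝ E] [FiniteDimensional ℝ E]
  {H : Type*} [TopologicalSpace H] {I : ModelWithCorners ℝ E H} [I.Boundaryless]
  {M : Type*} [TopologicalSpace M] [ChartedSpace H M] [IsManifold I ∞ M] [CompleteSpace E] [T2Space M]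

/-! ### The trace form and the fundamental form -/

lemma isSmoothForm2_traceForm {B : Tensor12 I M} (hB : ∀ x, TensorSmoothAt B x) :
    IsSmoothForm2 (traceForm B) where
  add_left x u v w := by
    simp only [traceForm, map_add, ContinuousLinearMap.add_comp, ContinuousLinearMap.toLinearMap_add]
  smul_left x a u w := by
    simp only [traceForm, map_smul, ContinuousLinearMap.smul_comp,
      ContinuousLinearMap.toLinearMap_smul, smul_eq_mul]
  add_right x w u v := by
    simp only [traceForm, map_add, ContinuousLinearMap.comp_add, ContinuousLinearMap.toLinearMap_add]
  smul_right x a w u := by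
    simp only [traceForm, map_smul, ContinuousLinearMap.comp_smul,
      ContinuousLinearMap.toLinearMap_smul, smul_eq_mul]
  smooth X Y x hX hY := by
    have hx := mem_chart_source H x
    refine ContMDiffAt.congr_of_eventuallyEq (f := fun q ↦ ∑ i, (Module.finBasis ℝ E).coord i
      (tr I x q (B q (X q) (B q (Y q) (cst I x (Module.finBasis ℝ E i) q))))) ?_ ?_
    · refine ContMDiffAt.sum fun i _ ↦ contMDiffAt_coord ?_ i
      exact (fieldSmoothAt_iff hx).1 (hB x hX (hB x hY (fieldSmoothAt_cst hx _)))
    · filter_upwards [(chartAt H x).open_source.mem_nhds hx] with q hq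
      rw [traceForm, trace_eq_sum_cst hq]
      rfl

lemma traceForm_symm (B : Tensor12 I M) (x : M) (u v : TangentSpace I x) :
    traceForm B x u v = traceForm B x v u :=
  LinearMap.trace_mul_comm ℝ (B x u : TangentSpace I x →ₗ[ℝ] TangentSpace I x)
    (B x v : TangentSpace I x →ₗ[ℝ] TangentSpace I x)

lemma traceForm_twist {J : EndField I M} {B : Tensor12 I M} (hBsymm : ∀ x u v, B x u v = B x v u)
    (hBJ : ∀ x u v, B x u (J x v) = - J x (B x u v)) (x : M) (u v : TangentSpace I x) :
    traceForm B x v (J x u) = - traceForm B x u (J x v) := by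
  have h1 : ∀ u, B x (J x u) = - (J x ∘L B x u) := fun u ↦ by
    ext w
    rw [hBsymm, hBJ, hBsymm]; rfl
  have h2 : B x u ∘L B x (J x v) = (J x ∘L B x u) ∘L B x v := by
    rw [h1]
    ext w
    simp only [ContinuousLinearMap.comp_apply, neg_apply, map_neg, hBJ, neg_neg]
  have h3 : B x v ∘L B x (J x u) = - (B x v ∘L (J x ∘L B x u)) := by
    rw [h1, ContinuousLinearMap.comp_neg]
  rw [traceForm, traceForm, h2, h3, ContinuousLinearMap.toLinearMap_neg, map_neg]
  congr 1
  exact LinearMap.trace_mul_comm ℝ (B x v : TangentSpace I x →ₗ[ℝ] TangentSpace I x)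
    ((J x ∘L B x u : TangentSpace I x →L[ℝ] TangentSpace I x) :
      TangentSpace I x →ₗ[ℝ] TangentSpace I x)

lemma isSmoothForm2_rho (n : ℕ) {J : EndField I M} (hJ : ∀ x, EndSmoothAt J x) {D : AffConn I M}
    (hD : CovariantDerivative.ContMDiffCovariantDerivative D ∞) : IsSmoothForm2 (rho n J D) := by
  have h := isSmoothForm2_ricci hD
  have e : rho n J D = fun x u v ↦ 1 / ((n : ℝ) + 1) * (ricci D x u v + 1 / ((n : ℝ) - 1) *
      (symm (ricci D) x u v + (-1) * pullJ J (symm (ricci D)) x u v)) := by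
    funext x u v; rw [rho]; ring
  rw [e]
  exact (h.add ((h.symm.add ((h.symm.pullJ hJ).smul (-1))).smul _)).smul _

lemma isSmoothForm2_fundForm (n : ℕ) {J : EndField I M} (hJ : ∀ x, EndSmoothAt J x)
    {D : AffConn I M} (hD : CovariantDerivative.ContMDiffCovariantDerivative D ∞)
    {B : Tensor12 I M} (hB : ∀ x, TensorSmoothAt B x) : IsSmoothForm2 (fundForm n J D B) := by
  have e : fundForm n J D B = fun x u v ↦ 1 / (8 * ((n : ℝ) + 1)) * traceForm B x u v +
      (-1 / 2) * rho n J D x u v := by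
    funext x u v; rw [fundForm]; ring
  rw [e]
  exact ((isSmoothForm2_traceForm hB).smul _).add ((isSmoothForm2_rho n hJ hD).smul _)

/-- The structure equations: those of a torsion-free complex connection `D` with tensors `B`, `a`,
`c` and one-forms `α`, `γ` which make the connection of `tractorForm` flat. -/
structure StructureEquations (J : EndField I M) (D : AffConn I M) (B : Tensor12 I M)
    (a c : Tensor02 I M) (α γ : OneForm I M) : Prop where
  smooth_J : ∀ x, EndSmoothAt J x
  sq : ∀ x v, J x (J x v) = -v
  smooth_D : CovariantDerivative.ContMDiffCovariantDerivative D ∞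
  torsion : D.torsion = 0
  complex : ∀ x u v, covEnd D J x u v = 0
  smooth_B : ∀ x, TensorSmoothAt B x
  symm_B : ∀ x u v, B x u v = B x v u
  anti_B : ∀ x u v, B x u (J x v) = - J x (B x u v)
  smooth_a : IsSmoothForm2 a.form
  smooth_c : IsSmoothForm2 c.form
  symm_c : ∀ x u v, c x u v = c x v u
  anti_c : ∀ x u v, c x (J x u) (J x v) = - c x u v
  smooth_α : ∀ x, FormSmoothAt α x
  smooth_γ : ∀ x, FormSmoothAt γ x
  d_α : ∀ x u v, extD α x u v = a x v u - a x u v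
  d_γ : ∀ x u v, extD γ x u v = a x u (J x v) - a x v (J x u)
  curvature : ∀ x u v w, curv D x u v w = - (1 / 4 : ℝ) • (B x u (B x v w) - B x v (B x u w))
    - extD α x u v • w - extD γ x u v • J x w + a x u w • v - a x v w • u
    - a x u (J x w) • J x v + a x v (J x w) • J x u
  d_B : ∀ x u v w, covTensor12 D B x u v w - covTensor12 D B x v u w =
    - (2 : ℝ) • (γ x u • J x (B x v w) - γ x v • J x (B x u w)) + c x u w • v - c x v w • u
    + c x u (J x w) • J x v - c x v (J x w) • J x u
  d_a : ∀ x u v w, covForm2 D a.form x u v w - covForm2 D a.form x v u w =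
    - (1 / 4 : ℝ) * (c x u (B x v w) - c x v (B x u w))
  d_c : ∀ x u v w, covForm2 D c.form x u v w - covForm2 D c.form x v u w =
    2 * (γ x u * c x v (J x w) - γ x v * c x u (J x w)) - a x u (B x v w) + a x v (B x u w)

lemma exists_structureEquations [SigmaCompactSpace M] (n : ℕ)
    (J : EndField I M) (hJ : IsComplexStructure J)
    (D : AffConn I M) (hD : IsTorsionFreeComplex J D)
    (B : Tensor12 I M) (hB : SmoothTensor12 B)
    (hBsymm : ∀ x u v, B x u v = B x v u)
    (hBJ : ∀ x u v, B x u (J x v) = - J x (B x u v))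
    (c : Tensor02 I M) (hc : SmoothTensor02 c)
    (hcsymm : ∀ x u v, c x u v = c x v u)
    (hcJ : ∀ x u v, c x (J x u) (J x v) = - c x u v)
    (hW : ∀ x u v w, weyl n J D x u v w =
      - (1 / 4 : ℝ) • (B x u (B x v w) - B x v (B x u w))
      - (1 / (4 * ((n : ℝ) + 1)) * twist J (traceForm B) x u v) • J x w
      + (1 / (8 * ((n : ℝ) + 1))) • wedge (traceForm B) idEnd x u v w
      - (1 / (8 * ((n : ℝ) + 1))) • wedge (twist J (traceForm B)) J x u v w)
    (hda : ∀ x u v w, dForm2 D (fundForm n J D B) x u v w =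
      - (1 / 4 : ℝ) * (c x u (B x v w) - c x v (B x u w)))
    (γ : OneForm I M) (hγ : SmoothOneForm γ)
    (hdγ : ∀ x u v, extDerivOneForm γ x u v =
      2 * asymm (twist J (fundForm n J D B)) x u v)
    (hdB : ∀ x u v w, dTensor12 D B x u v w =
      - (2 : ℝ) • (γ x u • J x (B x v w) - γ x v • J x (B x u w))
      + wedge c.form idEnd x u v w
      + wedge (twist J c.form) J x u v w)
    (hdc : ∀ x u v w,
      fundForm n J D B x u (B x v w) - fundForm n J D B x v (B x u w)
        + dForm2 D c.form x u v w =
      2 * (γ x u * c x v (J x w) - γ x v * c x u (J x w))) :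
    ∃ (a : Tensor02 I M) (α : OneForm I M), StructureEquations J D B a c α γ := by
  have hJs := hJ.smooth.endSmoothAt
  have hBs := hB.tensorSmoothAt
  have ha := isSmoothForm2_fundForm n hJs hD.smooth hBs
  have hform : ha.tensor.form = fundForm n J D B := rfl
  obtain ⟨α, hα, hdα⟩ := exists_extD_eq_asymm_rho n J hD.smooth hD.torsion
  refine ⟨ha.tensor, α, hJs, hJ.sq, hD.smooth, hD.torsion, hD.complex, hBs, hBsymm, hBJ, ha,
    hc.isSmoothForm2, hcsymm, hcJ, hα, hγ.formSmoothAt, fun x u v ↦ ?_, fun x u v ↦ ?_,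
    fun x u v w ↦ ?_, fun x u v w ↦ ?_, fun x u v w ↦ ?_, fun x u v w ↦ ?_⟩
  · rw [hdα, ha.tensor_apply, ha.tensor_apply, fundForm, fundForm, traceForm_symm B x v u, asymm]
    ring
  · rw [← extDerivOneForm_eq, hdγ, ha.tensor_apply, ha.tensor_apply, asymm, twist, twist]
    ring
  · have h := hW x u v w
    simp only [weyl] at h
    rw [hdα, ← extDerivOneForm_eq, hdγ]
    simp only [ha.tensor_apply]
    rw [← sub_eq_zero] at h ⊢
    rw [← h]
    simp only [wedge, twist, asymm, idEnd, fundForm, traceForm_twist hBsymm hBJ x u v,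
      ContinuousLinearMap.id_apply]
    have h0 : (n : ℝ) + 1 ≠ 0 := by positivity
    match_scalars <;> field_simp <;> ring
  · refine (hdB x u v w).trans ?_
    simp only [wedge, twist, idEnd, Tensor02.form, ContinuousLinearMap.id_apply]
    abel
  · exact hda x u v w
  · have h := hdc x u v w
    simp only [dForm2] at h
    rw [ha.tensor_apply, ha.tensor_apply]
    linarith

end FundamentalData

section Tractor

variable {E : Type*} [NormedAddCommGroup E] [NormedSpace ℝ E] [FiniteDimensional ℝ E]
  {H : Type*} [TopologicalSpace H] {I : ModelWithCorners ℝ E H} [I.Boundaryless]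
  {M : Type*} [TopologicalSpace M] [ChartedSpace H M] [IsManifold I ∞ M]
  {W : Type*} [NormedAddCommGroup W] [NormedSpace ℝ W]

/-! ### Rules for covariant derivatives -/

lemma FieldSmoothAt.add {X Y : VField I M} {x : M} (hX : FieldSmoothAt X x)
    (hY : FieldSmoothAt Y x) : FieldSmoothAt (fun q ↦ X q + Y q) x :=
  ContMDiffAt.add_section hX hY

lemma FieldSmoothAt.smul {f : M → ℝ} {X : VField I M} {x : M}
    (hf : ContMDiffAt I 𝓘(ℝ, ℝ) ∞ f x) (hX : FieldSmoothAt X x) :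
    FieldSmoothAt (fun q ↦ f q • X q) x := ContMDiffAt.smul_section hf hX

lemma conn_add (D : AffConn I M) {X Y : VField I M} {x : M} (hX : FieldSmoothAt X x)
    (hY : FieldSmoothAt Y x) (u : TangentSpace I x) :
    D (fun q ↦ X q + Y q) x u = D X x u + D Y x u :=
  DFunLike.congr_fun (D.isCovariantDerivativeOnUniv.add hX.diffAt hY.diffAt) u

lemma conn_smul (D : AffConn I M) {f : M → ℝ} {X : VField I M} {x : M}
    (hf : ContMDiffAt I 𝓘(ℝ, ℝ) ∞ f x) (hX : FieldSmoothAt X x) (u : TangentSpace I x) :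
    D (fun q ↦ f q • X q) x u = f x • D X x u + mvfderiv I f x u • X x :=
  DFunLike.congr_fun (D.isCovariantDerivativeOnUniv.leibniz hX.diffAt
    (hf.mdifferentiableAt (by simp))) u

lemma conn_const_smul (D : AffConn I M) (r : ℝ) {X : VField I M} {x : M}
    (hX : FieldSmoothAt X x) (u : TangentSpace I x) :
    D (fun q ↦ r • X q) x u = r • D X x u := by
  rw [conn_smul D contMDiffAt_const hX, mvfderiv_const]
  simp

/-! ### The connection on `TM ⊕ ℂ` -/

variable (J : EndField I M) (D : AffConn I M) (B : Tensor12 I M) (a c : Tensor02 I M)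
  (α γ : OneForm I M)

/-- The `TM`-component of the algebraic part of the connection. -/
def tractorFst (x : M) (u y : TangentSpace I x) (f : ℂ) : TangentSpace I x :=
  (1 / 2 : ℝ) • B x u y + α x u • y + γ x u • J x y + f.re • u + f.im • J x u

/-- The complex-valued form extending `a + ½ c`. -/
def complexForm (x : M) (u y : TangentSpace I x) : ℂ :=
  (a x u y + 1 / 2 * c x u y) • (1 : ℂ) + (- a x u (J x y) + 1 / 2 * c x u (J x y)) • Complex.I

/-- The `ℂ`-component of the connection. -/
def tractorSnd (x : M) (u y : TangentSpace I x) (f : ℂ) : ℂ :=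
  α x u • f + γ x u • (Complex.I * f) + complexForm J a c x u y

/-- The inverse of the coordinates `tr`. -/
def sy (I : ModelWithCorners ℝ E H) {M : Type*} [TopologicalSpace M]
    [ChartedSpace H M] [IsManifold I ∞ M] (x₀ q : M) : E →L[ℝ] TangentSpace I q :=
  (trivializationAt E (TangentSpace I) x₀).symmL ℝ q

lemma sy_eq {x₀ q : M} (hq : q ∈ (chartAt H x₀).source) (w : E) : sy I x₀ q w = cst I x₀ w q :=
  (cst_eq_symmL hq w).symm

lemma sy_tr {x₀ q : M} (hq : q ∈ (chartAt H x₀).source) (u : TangentSpace I q) :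
    sy I x₀ q (tr I x₀ q u) = u := by rw [sy_eq hq, cst_tr hq]

lemma tr_sy {x₀ q : M} (hq : q ∈ (chartAt H x₀).source) (w : E) :
    tr I x₀ q (sy I x₀ q w) = w := by rw [sy_eq hq, tr_cst hq]

/-- The algebraic part of the connection on `TM ⊕ ℂ` in coordinates. -/
def tractorTensor (x₀ q : M) : TangentSpace I q →L[ℝ] (E × ℂ) →L[ℝ] E × ℂ :=
  LinearMap.toContinuousLinearMap (LinearMap.toContinuousLinearMap.toLinearMap ∘ₗ
    LinearMap.mk₂ ℝ (fun (u : TangentSpace I q) (σ : E × ℂ) ↦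
      (tr I x₀ q (tractorFst J B α γ q u (sy I x₀ q σ.1) σ.2),
        tractorSnd J a c α γ q u (sy I x₀ q σ.1) σ.2))
      (fun u v σ ↦ by
        simp only [tractorFst, tractorSnd, complexForm, map_add, add_apply, Prod.mk_add_mk,
          map_smul]
        congr 1 <;> module)
      (fun r u σ ↦ by
        simp only [tractorFst, tractorSnd, complexForm, map_add, smul_apply, Prod.smul_mk,
          map_smul, smul_eq_mul]
        congr 1 <;> module)
      (fun u σ τ ↦ by
        simp only [tractorFst, tractorSnd, complexForm, map_add, Prod.mk_add_mk,
          map_smul, Prod.fst_add, Prod.snd_add, Complex.add_re, Complex.add_im, mul_add]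
        congr 1 <;> module)
      (fun r u σ ↦ by
        simp only [tractorFst, tractorSnd, complexForm, map_add, Prod.smul_mk,
          map_smul, Prod.smul_fst, Prod.smul_snd, Complex.smul_re, Complex.smul_im, smul_eq_mul,
          mul_smul_comm]
        congr 1 <;> module))

lemma tractorTensor_apply (x₀ q : M) (u : TangentSpace I q) (σ : E × ℂ) :
    tractorTensor J B a c α γ x₀ q u σ =
      (tr I x₀ q (tractorFst J B α γ q u (sy I x₀ q σ.1) σ.2),
        tractorSnd J a c α γ q u (sy I x₀ q σ.1) σ.2) := rfl

/-- The connection form of the connection on `TM ⊕ ℂ` in coordinates. -/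
def tractorForm (x₀ q : M) : TangentSpace I q →L[ℝ] (E × ℂ) →L[ℝ] E × ℂ :=
  (ContinuousLinearMap.compL ℝ (E × ℂ) E (E × ℂ) (ContinuousLinearMap.inl ℝ E ℂ) ∘L
    (ContinuousLinearMap.compL ℝ (E × ℂ) E E).flip (ContinuousLinearMap.fst ℝ E ℂ)) ∘L
    christoffel D x₀ q + tractorTensor J B a c α γ x₀ q

lemma tractorForm_apply (x₀ q : M) (u : TangentSpace I q) (σ : E × ℂ) :
    tractorForm J D B a c α γ x₀ q u σ =
      (christoffel D x₀ q u σ.1 + tr I x₀ q (tractorFst J B α γ q u (sy I x₀ q σ.1) σ.2),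
        tractorSnd J a c α γ q u (sy I x₀ q σ.1) σ.2) := by
  rw [tractorForm, add_apply, add_apply, tractorTensor_apply]
  simp

variable [CompleteSpace E] [T2Space M]
variable {J D B a c α γ}

section Smoothness

variable (h : StructureEquations J D B a c α γ)
include h

lemma StructureEquations.fieldSmoothAt_tractorFst {x : M} {X Y : VField I M}
    (hX : FieldSmoothAt X x) (hY : FieldSmoothAt Y x) (f : ℂ) :
    FieldSmoothAt (fun q ↦ tractorFst J B α γ q (X q) (Y q) f) x :=
  ((((FieldSmoothAt.smul contMDiffAt_const (h.smooth_B x hX hY)).add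
    (FieldSmoothAt.smul ((h.smooth_α x).apply hX) hY)).add
    (FieldSmoothAt.smul ((h.smooth_γ x).apply hX) (h.smooth_J x hY))).add
    (FieldSmoothAt.smul contMDiffAt_const hX)).add
    (FieldSmoothAt.smul contMDiffAt_const (h.smooth_J x hX))

lemma StructureEquations.contMDiffAt_complexForm {x : M} {X Y : VField I M}
    (hX : FieldSmoothAt X x) (hY : FieldSmoothAt Y x) :
    ContMDiffAt I 𝓘(ℝ, ℂ) ∞ (fun q ↦ complexForm J a c q (X q) (Y q)) x := by
  have h1 := h.smooth_a.smooth hX hY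
  have h2 := h.smooth_c.smooth hX hY
  have h3 := h.smooth_a.smooth hX (h.smooth_J x hY)
  have h4 := h.smooth_c.smooth hX (h.smooth_J x hY)
  exact ((h1.add (contMDiffAt_const.mul h2)).smul contMDiffAt_const).add
    ((h3.neg.add (contMDiffAt_const.mul h4)).smul contMDiffAt_const)

lemma StructureEquations.contMDiffAt_tractorSnd {x : M} {X Y : VField I M}
    (hX : FieldSmoothAt X x) (hY : FieldSmoothAt Y x) (f : ℂ) :
    ContMDiffAt I 𝓘(ℝ, ℂ) ∞ (fun q ↦ tractorSnd J a c α γ q (X q) (Y q) f) x :=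
  ((((h.smooth_α x).apply hX).smul contMDiffAt_const).add
    (((h.smooth_γ x).apply hX).smul contMDiffAt_const)).add (h.contMDiffAt_complexForm hX hY)

lemma StructureEquations.formSmoothAt_tractorForm {x₀ q : M} (hq : q ∈ (chartAt H x₀).source) :
    FormSmoothAt (tractorForm J D B a c α γ x₀) q := by
  refine FormSmoothAt.of_cst hq fun v ↦ contMDiffAt_clm_of_apply fun σ ↦ ?_
  have hv := fieldSmoothAt_cst (I := I) hq v
  have hσ := fieldSmoothAt_cst (I := I) hq σ.1
  have hΓ := formSmoothAt_christoffel h.smooth_D hq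
  refine ContMDiffAt.congr_of_eventuallyEq (((((hΓ.apply hv).clm_apply (contMDiffAt_const (c := σ.1))).add
    ((fieldSmoothAt_iff hq).1 (h.fieldSmoothAt_tractorFst hv hσ σ.2))).prodMk_space
    (h.contMDiffAt_tractorSnd hv hσ σ.2))) ?_
  filter_upwards [(chartAt H x₀).open_source.mem_nhds hq] with y hy
  rw [tractorForm_apply, sy_eq hy]
  rfl

end Smoothness

end Tractor

section Flatness

lemma mdifferentiableAt_fun_add {E : Type*} [NormedAddCommGroup E] [NormedSpace ℝ E]
    {H : Type*} [TopologicalSpace H] {I : ModelWithCorners ℝ E H}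
    {M : Type*} [TopologicalSpace M] [ChartedSpace H M]
    {W : Type*} [NormedAddCommGroup W] [NormedSpace ℝ W] {f g : M → W} {x : M}
    (hf : MDifferentiableAt I 𝓘(ℝ, W) f x) (hg : MDifferentiableAt I 𝓘(ℝ, W) g x) :
    MDifferentiableAt I 𝓘(ℝ, W) (fun q ↦ f q + g q) x := hf.add hg

variable {E : Type*} [NormedAddCommGroup E] [NormedSpace ℝ E] [FiniteDimensional ℝ E]
  {H : Type*} [TopologicalSpace H] {I : ModelWithCorners ℝ E H} [I.Boundaryless]
  {M : Type*} [TopologicalSpace M] [ChartedSpace H M] [IsManifold I ∞ M]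
  [CompleteSpace E] [T2Space M]
  {J : EndField I M} {D : AffConn I M} {B : Tensor12 I M} {a c : Tensor02 I M}
  {α γ : OneForm I M} (h : StructureEquations J D B a c α γ)

/-! ### Flatness of the connection on `TM ⊕ ℂ` -/

/-- The covariant derivative of the field extending `v` with constant coordinates. -/
def connCst (D : AffConn I M) (x : M) (u v : TangentSpace I x) : TangentSpace I x :=
  D (cst I x (tr I x x v)) x u

lemma connCst_eq (D : AffConn I M) (x : M) (u v : TangentSpace I x) :
    connCst D x u v = sy I x x (christoffel D x x u (tr I x x v)) := by
  have hx := mem_chart_source H x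
  rw [connCst, ← tr_conn_cst D hx, sy_tr hx]

lemma tr_connCst (D : AffConn I M) (x : M) (u v : TangentSpace I x) :
    tr I x x (connCst D x u v) = christoffel D x x u (tr I x x v) := by
  have hx := mem_chart_source H x
  rw [connCst_eq, tr_sy hx]

lemma connCst_comm (hD : D.torsion = 0) (x : M) (u v : TangentSpace I x) :
    connCst D x u v = connCst D x v u := conn_cst_comm hD v u

include h

lemma StructureEquations.conn_tractorFst {x : M} {X Y : VField I M}
    (hX : FieldSmoothAt X x) (hY : FieldSmoothAt Y x) (f : ℂ) (u : TangentSpace I x) :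
    D (fun q ↦ tractorFst J B α γ q (X q) (Y q) f) x u =
      (1 / 2 : ℝ) • covTensor12 D B x u (X x) (Y x) +
      (mvfderiv I (fun q ↦ α q (X q)) x u - α x (D X x u)) • Y x +
      (mvfderiv I (fun q ↦ γ q (X q)) x u - γ x (D X x u)) • J x (Y x) +
      tractorFst J B α γ x (D X x u) (Y x) f + tractorFst J B α γ x (X x) (D Y x u) 0 := by
  have h1 := h.smooth_B x hX hY
  have h2 := (h.smooth_α x).apply hX
  have h3 := (h.smooth_γ x).apply hX
  have h4 := h.smooth_J x hY
  have h5 := h.smooth_J x hX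
  have s1 : FieldSmoothAt (fun q ↦ (1 / 2 : ℝ) • B q (X q) (Y q)) x :=
    FieldSmoothAt.smul contMDiffAt_const h1
  have s2 := s1.add (FieldSmoothAt.smul h2 hY)
  have s3 := s2.add (FieldSmoothAt.smul h3 h4)
  have s4 := s3.add (FieldSmoothAt.smul (f := fun _ ↦ f.re) contMDiffAt_const hX)
  simp only [tractorFst]
  rw [conn_add D s4 (FieldSmoothAt.smul contMDiffAt_const h5),
    conn_add D s3 (FieldSmoothAt.smul contMDiffAt_const hX),
    conn_add D s2 (FieldSmoothAt.smul h3 h4), conn_add D s1 (FieldSmoothAt.smul h2 hY),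
    conn_const_smul D _ h1, conn_smul D h2 hY, conn_smul D h3 h4, conn_const_smul D _ hX,
    conn_const_smul D _ h5, covTensor12_apply D (h.smooth_B x) hX hY,
    covEnd_apply D (h.smooth_J x) hX.diffAt, covEnd_apply D (h.smooth_J x) hY.diffAt,
    h.complex, h.complex]
  simp only [Complex.zero_re, Complex.zero_im]
  module

/-- The derivative of `complexForm`. -/
lemma StructureEquations.mvfderiv_complexForm {x : M} {X Y : VField I M}
    (hX : FieldSmoothAt X x) (hY : FieldSmoothAt Y x) (u : TangentSpace I x) :
    mvfderiv I (fun q ↦ complexForm J a c q (X q) (Y q)) x u =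
      (covForm2 D a.form x u (X x) (Y x) + 1 / 2 * covForm2 D c.form x u (X x) (Y x)) • (1 : ℂ) +
      (- covForm2 D a.form x u (X x) (J x (Y x)) +
        1 / 2 * covForm2 D c.form x u (X x) (J x (Y x))) • Complex.I +
      complexForm J a c x (D X x u) (Y x) + complexForm J a c x (X x) (D Y x u) := by
  have h0 := h.smooth_J x hY
  have h1 := h.smooth_a.smooth hX hY
  have h2 := h.smooth_c.smooth hX hY
  have h3 := h.smooth_a.smooth hX h0
  have h4 := h.smooth_c.smooth hX h0
  have key : ∀ {f g k l : M → ℝ}, ContMDiffAt I 𝓘(ℝ, ℝ) ∞ f x → ContMDiffAt I 𝓘(ℝ, ℝ) ∞ g x →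
      ContMDiffAt I 𝓘(ℝ, ℝ) ∞ k x → ContMDiffAt I 𝓘(ℝ, ℝ) ∞ l x →
      mvfderiv I (fun q ↦ (f q + 1 / 2 * g q) • (1 : ℂ) + (- k q + 1 / 2 * l q) • Complex.I) x u =
      (mvfderiv I f x u + 1 / 2 * mvfderiv I g x u) • (1 : ℂ) +
        (- mvfderiv I k x u + 1 / 2 * mvfderiv I l x u) • Complex.I := by
    intro f g k l hf hg hk hl
    have hf := hf.mdifferentiableAt (by simp)
    have hg := hg.mdifferentiableAt (by simp)
    have hk := hk.mdifferentiableAt (by simp)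
    have hl := hl.mdifferentiableAt (by simp)
    let L : (ℝ × ℝ) × (ℝ × ℝ) →L[ℝ] ℂ := LinearMap.toContinuousLinearMap
      { toFun := fun p ↦ (p.1.1 + 1 / 2 * p.1.2) • (1 : ℂ) + (- p.2.1 + 1 / 2 * p.2.2) • Complex.I
        map_add' := fun p q ↦ by simp only [Prod.fst_add, Prod.snd_add]; module
        map_smul' := fun r p ↦ by
          simp only [Prod.smul_fst, Prod.smul_snd, smul_eq_mul, RingHom.id_apply]; module }
    have hp : MDifferentiableAt I 𝓘(ℝ, (ℝ × ℝ) × (ℝ × ℝ)) (fun q ↦ ((f q, g q), (k q, l q))) x :=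
      (hf.prodMk_space hg).prodMk_space (hk.prodMk_space hl)
    refine (mvfderiv_clm L hp u).trans ?_
    rw [mvfderiv_prodMk (hf.prodMk_space hg) (hk.prodMk_space hl), mvfderiv_prodMk hf hg,
      mvfderiv_prodMk hk hl]
    rfl
  have e1 := covForm2_apply D h.smooth_a hX hY u
  have e2 := covForm2_apply D h.smooth_c hX hY u
  have e3 := covForm2_apply D h.smooth_a hX h0 u
  have e4 := covForm2_apply D h.smooth_c hX h0 u
  rw [covEnd_apply D (h.smooth_J x) hY.diffAt, h.complex, zero_add] at e3 e4
  refine (key h1 h2 h3 h4).trans ?_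
  rw [e1, e2, e3, e4]
  simp only [complexForm, Tensor02.form]
  module

lemma StructureEquations.mvfderiv_tractorForm {x : M} (u v y : TangentSpace I x) (f : ℂ) :
    mvfderiv I (fun q ↦ tractorForm J D B a c α γ x q (cst I x (tr I x x v) q)) x u
      (tr I x x y, f) =
    (mvfderiv I (fun q ↦ christoffel D x q (cst I x (tr I x x v) q)) x u (tr I x x y) +
      tr I x x ((1 / 2 : ℝ) • covTensor12 D B x u v y +
        (mvfderiv I (fun q ↦ α q (cst I x (tr I x x v) q)) x u - α x (connCst D x u v)) • y +
        (mvfderiv I (fun q ↦ γ q (cst I x (tr I x x v) q)) x u - γ x (connCst D x u v)) • J x y +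
        tractorFst J B α γ x (connCst D x u v) y f +
        tractorFst J B α γ x v (connCst D x u y) 0 -
        connCst D x u (tractorFst J B α γ x v y f)),
      mvfderiv I (fun q ↦ α q (cst I x (tr I x x v) q)) x u • f +
      mvfderiv I (fun q ↦ γ q (cst I x (tr I x x v) q)) x u • (Complex.I * f) +
      (covForm2 D a.form x u v y + 1 / 2 * covForm2 D c.form x u v y) • (1 : ℂ) +
      (- covForm2 D a.form x u v (J x y) +
        1 / 2 * covForm2 D c.form x u v (J x y)) • Complex.I +
      complexForm J a c x (connCst D x u v) y + complexForm J a c x v (connCst D x u y)) := by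
  have hx := mem_chart_source H x
  have hv := fieldSmoothAt_cst (I := I) hx (tr I x x v)
  have hy := fieldSmoothAt_cst (I := I) hx (tr I x x y)
  have hA := (h.formSmoothAt_tractorForm hx).apply hv
  have hΓ := (formSmoothAt_christoffel h.smooth_D hx).apply hv
  have hS := h.fieldSmoothAt_tractorFst hv hy f
  have hS' := (fieldSmoothAt_iff hx).1 hS
  have hα := (h.smooth_α x).apply hv
  have hγ := (h.smooth_γ x).apply hv
  have hc := h.contMDiffAt_complexForm hv hy
  rw [← mvfderiv_apply_const (hA.mdifferentiableAt (by simp))]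
  have e : (fun q ↦ tractorForm J D B a c α γ x q (cst I x (tr I x x v) q) (tr I x x y, f)) =ᶠ[𝓝 x]
      fun q ↦ (christoffel D x q (cst I x (tr I x x v) q) (tr I x x y) +
        tr I x q (tractorFst J B α γ q (cst I x (tr I x x v) q) (cst I x (tr I x x y) q) f),
        (α q (cst I x (tr I x x v) q) • f + γ q (cst I x (tr I x x v) q) • (Complex.I * f)) +
          complexForm J a c q (cst I x (tr I x x v) q) (cst I x (tr I x x y) q)) := by
    filter_upwards [(chartAt H x).open_source.mem_nhds hx] with q hq
    rw [tractorForm_apply, sy_eq hq]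
    rfl
  have dΓ := hΓ.mdifferentiableAt (n := ∞) (by simp)
  have dΓ' : MDifferentiableAt I 𝓘(ℝ, E)
      (fun q ↦ christoffel D x q (cst I x (tr I x x v) q) (tr I x x y)) x :=
    mdifferentiableAt_clm (ContinuousLinearMap.apply ℝ E (tr I x x y)) dΓ
  have dS := hS'.mdifferentiableAt (n := ∞) (by simp)
  have dα := hα.mdifferentiableAt (n := ∞) (by simp)
  have dγ := hγ.mdifferentiableAt (n := ∞) (by simp)
  have dc := hc.mdifferentiableAt (n := ∞) (by simp)
  have d1 := mdifferentiableAt_fun_smul dα (mdifferentiableAt_const (c := f))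
  have d2 := mdifferentiableAt_fun_smul dγ (mdifferentiableAt_const (c := Complex.I * f))
  have hSx : tr I x x (D (fun q ↦ tractorFst J B α γ q (cst I x (tr I x x v) q)
      (cst I x (tr I x x y) q) f) x u) = _ := tr_conn D hx hS.diffAt u
  rw [mvfderiv_congr e, mvfderiv_prodMk (mdifferentiableAt_fun_add dΓ' dS)
      (mdifferentiableAt_fun_add (mdifferentiableAt_fun_add d1 d2) dc),
    mvfderiv_fun_add dΓ' dS, mvfderiv_fun_add (mdifferentiableAt_fun_add d1 d2) dc, mvfderiv_fun_add d1 d2,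
    mvfderiv_fun_smul dα mdifferentiableAt_const, mvfderiv_fun_smul dγ mdifferentiableAt_const]
  simp only [add_apply, mvfderiv_apply_const dΓ, h.mvfderiv_complexForm hv hy]
  rw [h.conn_tractorFst hv hy] at hSx
  simp only [cst_tr hx] at hSx ⊢
  rw [Prod.mk.injEq]
  constructor
  · rw [map_sub, tr_connCst, add_right_inj]
    exact (sub_eq_of_eq_add hSx).symm
  · simp only [mvfderiv_const, smul_zero, ContinuousLinearMap.smulRight_apply, zero_apply,
      connCst]
    module

omit h in
lemma connCst_add (D : AffConn I M) (x : M) (u v w : TangentSpace I x) :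
    connCst D x u (v + w) = connCst D x u v + connCst D x u w := by
  simp only [connCst_eq, map_add]

/-- The curvature of the connection on `TM ⊕ ℂ`: the tangential component. -/
lemma StructureEquations.flat_fst (x : M) (u v y : TangentSpace I x) (f : ℂ) :
    curv D x u v y + (1 / 2 : ℝ) • (covTensor12 D B x u v y - covTensor12 D B x v u y)
      + extD α x u v • y + extD γ x u v • J x y
      + tractorFst J B α γ x u (tractorFst J B α γ x v y f) (tractorSnd J a c α γ x v y f)
      - tractorFst J B α γ x v (tractorFst J B α γ x u y f) (tractorSnd J a c α γ x u y f) = 0 := by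
  rw [h.curvature, h.d_B]
  have h1 : ∀ w, B x v w = B x w v := h.symm_B x v
  have e1 : ((Complex.I * f).re = -f.im) ∧ (Complex.I * f).im = f.re := by simp
  simp only [tractorFst, tractorSnd, complexForm, map_add, map_smul, h.anti_B, h.sq, h.symm_B x v u,
    Complex.add_re, Complex.add_im, Complex.smul_re, Complex.smul_im, e1.1, e1.2, Complex.one_re,
    Complex.one_im, Complex.I_re, Complex.I_im, smul_eq_mul, mul_zero, mul_one, add_zero, zero_add]
  module

/-- The curvature of the connection on `TM ⊕ ℂ`: the complex-valued component. -/
lemma StructureEquations.flat_snd (x : M) (u v y : TangentSpace I x) (f : ℂ) :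
    extD α x u v • f + extD γ x u v • (Complex.I * f) +
      ((covForm2 D a.form x u v y - covForm2 D a.form x v u y) +
        1 / 2 * (covForm2 D c.form x u v y - covForm2 D c.form x v u y)) • (1 : ℂ) +
      (- (covForm2 D a.form x u v (J x y) - covForm2 D a.form x v u (J x y)) +
        1 / 2 * (covForm2 D c.form x u v (J x y) - covForm2 D c.form x v u (J x y))) • Complex.I
      + tractorSnd J a c α γ x u (tractorFst J B α γ x v y f) (tractorSnd J a c α γ x v y f)
      - tractorSnd J a c α γ x v (tractorFst J B α γ x u y f) (tractorSnd J a c α γ x u y f) = 0 := by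
  have hcJ : ∀ u v, c x (J x u) v = c x u (J x v) := fun u v ↦ by
    have := h.anti_c x u (J x v)
    rw [h.sq, map_neg] at this
    linarith
  have h1 : c x v u = c x u v := h.symm_c x v u
  have h2 : c x v (J x u) = c x u (J x v) := by rw [h.symm_c, hcJ]
  rw [h.d_a, h.d_a, h.d_c, h.d_c, h.d_α, h.d_γ]
  simp only [tractorFst, tractorSnd, complexForm, map_add, map_smul, map_neg, h.anti_B, h.sq, h1, h2,
    smul_eq_mul]
  apply Complex.ext
  · simp
    ring
  · simp
    ring

lemma StructureEquations.flat (x : M) (u v : TangentSpace I x) (σ : E × ℂ) :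
    extD (tractorForm J D B a c α γ x) x u v σ +
      tractorForm J D B a c α γ x x u (tractorForm J D B a c α γ x x v σ) -
      tractorForm J D B a c α γ x x v (tractorForm J D B a c α γ x x u σ) = 0 := by
  have hx := mem_chart_source H x
  obtain ⟨w, f⟩ := σ
  obtain ⟨y, rfl⟩ := ((isFrame_tr (I := I) x).bijective x hx).2 w
  have hA : ∀ u y f, tractorForm J D B a c α γ x x u (tr I x x y, f) =
      (tr I x x (connCst D x u y + tractorFst J B α γ x u y f), tractorSnd J a c α γ x u y f) :=
    fun u y f ↦ by rw [tractorForm_apply, map_add, tr_connCst, sy_tr hx]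
  have hR := tr_curv h.smooth_D hx u v y
  rw [curvRep, ← extD_eq_formRep hx (formSmoothAt_christoffel h.smooth_D hx), extD, sub_apply] at hR
  simp only [← tr_connCst] at hR
  rw [extD, sub_apply, h.mvfderiv_tractorForm, h.mvfderiv_tractorForm, hA, hA, hA, hA,
    connCst_comm h.torsion x v u]
  have h1 := congrArg (tr I x x) (h.flat_fst x u v y f)
  have h2 := h.flat_snd x u v y f
  refine Prod.ext ?_ ?_
  · have key : ∀ u v, tractorFst J B α γ x u (connCst D x v y + tractorFst J B α γ x v y f)
        (tractorSnd J a c α γ x v y f) = tractorFst J B α γ x u (connCst D x v y) 0 +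
        tractorFst J B α γ x u (tractorFst J B α γ x v y f) (tractorSnd J a c α γ x v y f) := by
      intro u v
      simp only [tractorFst.eq_1 J B α γ x u, map_add, Complex.zero_re, Complex.zero_im]
      module
    simp only [Prod.fst_add, Prod.fst_sub, Prod.fst_zero, key, connCst_add, map_add, map_sub] at h1 ⊢
    rw [hR, extD, extD, map_zero] at h1
    rw [← h1]
    simp only [map_smul, sub_smul, smul_sub, map_sub]
    abel
  · have key : ∀ u v, tractorSnd J a c α γ x u (connCst D x v y + tractorFst J B α γ x v y f)
        (tractorSnd J a c α γ x v y f) = complexForm J a c x u (connCst D x v y) +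
        tractorSnd J a c α γ x u (tractorFst J B α γ x v y f) (tractorSnd J a c α γ x v y f) := by
      intro u v
      simp only [tractorSnd.eq_1 J a c α γ x u, complexForm, map_add]
      module
    simp only [Prod.snd_add, Prod.snd_sub, Prod.snd_zero, key]
    rw [← h2, extD, extD]
    module

end Flatness

section Products

variable {E : Type*} [NormedAddCommGroup E] [NormedSpace ℝ E]
  {H : Type*} [TopologicalSpace H] {I : ModelWithCorners ℝ E H} [I.Boundaryless]
  {N : Type*} [TopologicalSpace N] [ChartedSpace H N] [IsManifold I ∞ N]
  {E' : Type*} [NormedAddCommGroup E'] [NormedSpace ℝ E']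
  {H' : Type*} [TopologicalSpace H'] {I' : ModelWithCorners ℝ E' H'} [I'.Boundaryless]
  {K : Type*} [TopologicalSpace K] [ChartedSpace H' K] [IsManifold I' ∞ K]
  {W : Type*} [NormedAddCommGroup W] [NormedSpace ℝ W]

/-! ### Tangent vectors of products -/

/-- The first component of a tangent vector of a product. -/
def tfst (q : N × K) : TangentSpace (I.prod I') q →L[ℝ] TangentSpace I q.1 :=
  ContinuousLinearMap.fst ℝ (TangentSpace I q.1) (TangentSpace I' q.2)

/-- The second component of a tangent vector of a product. -/
def tsnd (q : N × K) : TangentSpace (I.prod I') q →L[ℝ] TangentSpace I' q.2 :=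
  ContinuousLinearMap.snd ℝ (TangentSpace I q.1) (TangentSpace I' q.2)

lemma tangent_ext {q : N × K} {u v : TangentSpace (I.prod I') q} (h₁ : tfst q u = tfst q v)
    (h₂ : tsnd q u = tsnd q v) : u = v := Prod.ext h₁ h₂

lemma mfderiv_fst_eq (q : N × K) (u : TangentSpace (I.prod I') q) :
    mfderiv (I.prod I') I Prod.fst q u = tfst q u := by
  rw [mfderiv_fst]; rfl

lemma mvfderiv_comp_fst {F : N → W} {q : N × K} (hF : MDifferentiableAt I 𝓘(ℝ, W) F q.1)
    (u : TangentSpace (I.prod I') q) :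
    mvfderiv (I.prod I') (fun y ↦ F y.1) q u = mvfderiv I F q.1 (tfst q u) :=
  DFunLike.congr_fun (HasMFDerivAt.comp q hF.hasMFDerivAt (hasMFDerivAt_fst (I := I) (I' := I') q)).mfderiv u

lemma mvfderiv_comp_snd {F : K → W} {q : N × K} (hF : MDifferentiableAt I' 𝓘(ℝ, W) F q.2)
    (u : TangentSpace (I.prod I') q) :
    mvfderiv (I.prod I') (fun y ↦ F y.2) q u = mvfderiv I' F q.2 (tsnd q u) :=
  DFunLike.congr_fun (HasMFDerivAt.comp q hF.hasMFDerivAt (hasMFDerivAt_snd (I := I) (I' := I') q)).mfderiv u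

lemma ContMDiffAt.comp_fst' {F : N → W} {q : N × K} {n : ℕ∞ω} (hF : ContMDiffAt I 𝓘(ℝ, W) n F q.1) :
    ContMDiffAt (I.prod I') 𝓘(ℝ, W) n (fun y ↦ F y.1) q := hF.comp q contMDiffAt_fst

lemma prod_chart_source (p : N × K) :
    (chartAt (ModelProd H H') p).source = (chartAt H p.1).source ×ˢ (chartAt H' p.2).source := by
  rw [prodChartedSpace_chartAt]; rfl

lemma tr_prod_fst {p q : N × K} (hq : q ∈ (chartAt (ModelProd H H') p).source)
    (u : TangentSpace (I.prod I') q) : (tr (I.prod I') p q u).1 = tr I p.1 q.1 (tfst q u) := by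
  have hq1 : q.1 ∈ (chartAt H p.1).source := by rw [prod_chart_source] at hq; exact hq.1
  have h1 : MDifferentiableAt (I.prod I') 𝓘(ℝ, E × E') (extChartAt (I.prod I') p) q :=
    (contMDiffAt_extChartAt_of_mem hq).mdifferentiableAt (by simp)
  have h2 := mvfderiv_clm (ContinuousLinearMap.fst ℝ E E') h1 u
  rw [mfderiv_extChartAt_eq_tr hq] at h2
  have h3 : MDifferentiableAt I 𝓘(ℝ, E) (extChartAt I p.1) q.1 :=
    (contMDiffAt_extChartAt_of_mem hq1).mdifferentiableAt (by simp)
  rw [← mfderiv_extChartAt_eq_tr hq1, ← mvfderiv_comp_fst h3]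
  refine h2.symm.trans ?_
  congr 2

lemma tfst_cst {p q : N × K} (hq : q ∈ (chartAt (ModelProd H H') p).source) (v : E × E') :
    tfst q (cst (I.prod I') p v q) = cst I p.1 v.1 q.1 := by
  have hq1 : q.1 ∈ (chartAt H p.1).source := by rw [prod_chart_source] at hq; exact hq.1
  rw [← cst_tr hq1 (tfst q (cst (I.prod I') p v q)), ← tr_prod_fst hq, tr_cst hq]

variable [FiniteDimensional ℝ E] [FiniteDimensional ℝ E']

/-- The pull-back of a one-form to a product. -/
def pullForm (K : Type*) [TopologicalSpace K] [ChartedSpace H' K] (I' : ModelWithCorners ℝ E' H')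
    (Φ : ∀ x : N, TangentSpace I x →L[ℝ] W) (q : N × K) :
    TangentSpace (I.prod I') q →L[ℝ] W := Φ q.1 ∘L tfst q

lemma pullForm_apply (Φ : ∀ x : N, TangentSpace I x →L[ℝ] W) (q : N × K)
    (u : TangentSpace (I.prod I') q) : pullForm K I' Φ q u = Φ q.1 (tfst q u) := rfl

lemma FormSmoothAt.pullForm {Φ : ∀ x : N, TangentSpace I x →L[ℝ] W} {q : N × K}
    (h : FormSmoothAt Φ q.1) : FormSmoothAt (pullForm K I' Φ) q := by
  intro v
  refine (ContMDiffAt.comp_fst' (h v.1)).congr_of_eventuallyEq ?_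
  filter_upwards [(chartAt (ModelProd H H') q).open_source.mem_nhds (mem_chart_source _ q)] with y hy
  rw [pullForm_apply, tfst_cst hy]

lemma extD_pullForm {Φ : ∀ x : N, TangentSpace I x →L[ℝ] W} {q : N × K}
    (h : FormSmoothAt Φ q.1) (u v : TangentSpace (I.prod I') q) :
    extD (pullForm K I' Φ) q u v = extD Φ q.1 (tfst q u) (tfst q v) := by
  have hq := mem_chart_source (ModelProd H H') q
  have key : ∀ u v : TangentSpace (I.prod I') q,
      mvfderiv (I.prod I') (fun y ↦ CProj.pullForm K I' Φ y
        (cst (I.prod I') q (tr (I.prod I') q q v) y)) q u =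
      mvfderiv I (fun y ↦ Φ y (cst I q.1 (tr I q.1 q.1 (tfst q v)) y)) q.1 (tfst q u) := by
    intro u v
    have e : (fun y ↦ CProj.pullForm K I' Φ y (cst (I.prod I') q (tr (I.prod I') q q v) y)) =ᶠ[𝓝 q]
        fun y ↦ Φ y.1 (cst I q.1 (tr I q.1 q.1 (tfst q v)) y.1) := by
      filter_upwards [(chartAt (ModelProd H H') q).open_source.mem_nhds hq] with y hy
      rw [pullForm_apply, tfst_cst hy, tr_prod_fst hq]
    rw [mvfderiv_congr e, ← mvfderiv_comp_fst ((h _).mdifferentiableAt (by simp))]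
  rw [extD, extD, key, key]

end Products

section Coframe

variable {E : Type*} [NormedAddCommGroup E] [NormedSpace ℝ E] [FiniteDimensional ℝ E]
  {H : Type*} [TopologicalSpace H] {I : ModelWithCorners ℝ E H} [I.Boundaryless]
  {N : Type*} [TopologicalSpace N] [ChartedSpace H N] [IsManifold I ∞ N]
  {E' : Type*} [NormedAddCommGroup E'] [NormedSpace ℝ E'] [FiniteDimensional ℝ E']
  {H' : Type*} [TopologicalSpace H'] {I' : ModelWithCorners ℝ E' H'} [I'.Boundaryless]
  {K : Type*} [TopologicalSpace K] [ChartedSpace H' K] [IsManifold I' ∞ K]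

/-- A nowhere vanishing local diffeomorphism to `ℂ`. -/
structure IsLocalCoordinate (I' : ModelWithCorners ℝ E' H') (ζ : K → ℂ) : Prop where
  smooth : ContMDiff I' 𝓘(ℝ, ℂ) ∞ ζ
  ne_zero : ∀ k, ζ k ≠ 0
  bijective : ∀ k, Function.Bijective (mvfderiv I' ζ k)

/-- The multiplication of tangent vectors by complex numbers. -/
def cmul (J : EndField I N) (x : N) (z : ℂ) : TangentSpace I x →L[ℝ] TangentSpace I x :=
  z.re • ContinuousLinearMap.id ℝ (TangentSpace I x) + z.im • J x

lemma cmul_apply (J : EndField I N) (x : N) (z : ℂ) (u : TangentSpace I x) :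
    cmul J x z u = z.re • u + z.im • J x u := rfl

lemma cmul_cmul {J : EndField I N} (sq : ∀ x v, J x (J x v) = -v) (x : N) (z w : ℂ)
    (u : TangentSpace I x) : cmul J x z (cmul J x w u) = cmul J x (z * w) u := by
  simp only [cmul_apply, map_add, map_smul, sq, Complex.mul_re, Complex.mul_im]
  module

lemma cmul_one (J : EndField I N) (x : N) (u : TangentSpace I x) : cmul J x 1 u = u := by
  simp [cmul_apply]

lemma cmul_J (J : EndField I N) (x : N) (z : ℂ) (u : TangentSpace I x) :
    cmul J x z (J x u) = J x (cmul J x z u) := by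
  simp only [cmul_apply, map_add, map_smul]

lemma cmul_inv_cmul {J : EndField I N} (sq : ∀ x v, J x (J x v) = -v) (x : N) {z : ℂ} (hz : z ≠ 0)
    (u : TangentSpace I x) : cmul J x z⁻¹ (cmul J x z u) = u := by
  rw [cmul_cmul sq, inv_mul_cancel₀ hz, cmul_one]

variable (J : EndField I N) (D : AffConn I N) (B : Tensor12 I N) (a c : Tensor02 I N)
  (α γ : OneForm I N) (ζ : K → ℂ) (I')

/-- The section `(0, ζ)` of the bundle `TN ⊕ ℂ`. -/
def tautSection (E : Type*) [NormedAddCommGroup E] {N : Type*} (ζ : K → ℂ) (q : N × K) : E × ℂ :=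
  (0, ζ q.2)

/-- The connection form of `TN ⊕ ℂ`, pulled back to `N × K`. -/
abbrev totalForm (x₀ : N) : ∀ q : N × K, TangentSpace (I.prod I') q →L[ℝ] (E × ℂ) →L[ℝ] E × ℂ :=
  pullForm K I' (tractorForm J D B a c α γ x₀)

/-- The covariant derivative of the tautological section `(0, ζ)`, in coordinates. -/
def coframe (x₀ : N) (q : N × K) : TangentSpace (I.prod I') q →L[ℝ] E × ℂ :=
  mvfderiv (I.prod I') (tautSection E ζ) q +
    ContinuousLinearMap.apply ℝ (E × ℂ) (tautSection E ζ q) ∘L totalForm I' J D B a c α γ x₀ q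

variable {J D B a c α γ ζ I'}

lemma coframe_eq (x₀ : N) (q : N × K) (u : TangentSpace (I.prod I') q) :
    coframe I' J D B a c α γ ζ x₀ q u = mvfderiv (I.prod I') (tautSection E ζ) q u +
      totalForm I' J D B a c α γ x₀ q u (tautSection E ζ q) := rfl

variable [CompleteSpace E] [T2Space N] (h : StructureEquations J D B a c α γ)
  (hζ : IsLocalCoordinate I' ζ)

include hζ in
lemma contMDiff_tautSection (q : N × K) :
    ContMDiffAt (I.prod I') 𝓘(ℝ, E × ℂ) ∞ (tautSection E ζ) q :=
  contMDiffAt_const.prodMk_space (hζ.smooth.contMDiffAt.comp q contMDiffAt_snd)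

include h in
lemma formSmoothAt_totalForm {x₀ : N} {q : N × K} (hq : q.1 ∈ (chartAt H x₀).source) :
    FormSmoothAt (totalForm I' J D B a c α γ x₀) q :=
  (h.formSmoothAt_tractorForm hq).pullForm

include hζ in
lemma coframe_apply (x₀ : N) (q : N × K) (u : TangentSpace (I.prod I') q) :
    coframe I' J D B a c α γ ζ x₀ q u = (tr I x₀ q.1 (cmul J q.1 (ζ q.2) (tfst q u)),
      mvfderiv I' ζ q.2 (tsnd q u) + α q.1 (tfst q u) • ζ q.2 +
        γ q.1 (tfst q u) • (Complex.I * ζ q.2)) := by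
  have h1 : MDifferentiableAt I' 𝓘(ℝ, ℂ) ζ q.2 :=
    hζ.smooth.contMDiffAt.mdifferentiableAt (by simp)
  have h2 : MDifferentiableAt (I.prod I') 𝓘(ℝ, ℂ) (fun y : N × K ↦ ζ y.2) q :=
    (hζ.smooth.contMDiffAt.comp q contMDiffAt_snd).mdifferentiableAt (by simp)
  have h3 : mvfderiv (I.prod I') (tautSection E ζ) q u = (0, mvfderiv I' ζ q.2 (tsnd q u)) := by
    refine (mvfderiv_prodMk mdifferentiableAt_const h2 u).trans ?_
    rw [mvfderiv_comp_snd h1, mvfderiv_const]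
    rfl
  rw [coframe_eq, h3, pullForm_apply, tractorForm_apply]
  simp only [tautSection, map_zero, tractorFst, tractorSnd, complexForm, cmul_apply]
  refine Prod.ext ?_ ?_
  · simp
  · simp [add_assoc]

include h hζ in
lemma coframe_injective {x₀ : N} {q : N × K} (hq : q.1 ∈ (chartAt H x₀).source) :
    Function.Injective (coframe I' J D B a c α γ ζ x₀ q) := by
  refine (injective_iff_map_eq_zero _).2 fun u hu ↦ ?_
  rw [coframe_apply hζ, Prod.mk_eq_zero] at hu
  obtain ⟨h1, h2⟩ := hu
  have h3 : tfst q u = 0 := by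
    have h4 : cmul J q.1 (ζ q.2) (tfst q u) = 0 := tr_injective hq (by rw [h1, map_zero])
    rw [← cmul_inv_cmul h.sq q.1 (hζ.ne_zero q.2) (tfst q u), h4, map_zero]
  rw [h3, map_zero, map_zero, zero_smul, zero_smul, add_zero, add_zero] at h2
  have h5 : tsnd q u = 0 := (hζ.bijective q.2).1 (by rw [h2, map_zero])
  exact tangent_ext (by rw [h3, map_zero]) (by rw [h5, map_zero])

include h hζ in
lemma coframe_bijective {x₀ : N} {q : N × K} (hq : q.1 ∈ (chartAt H x₀).source) :
    Function.Bijective (coframe I' J D B a c α γ ζ x₀ q) := by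
  have h1 : Module.finrank ℝ E' = Module.finrank ℝ ℂ :=
    (LinearEquiv.ofBijective (mvfderiv I' ζ q.2 : TangentSpace I' q.2 →ₗ[ℝ] ℂ)
      (hζ.bijective q.2)).finrank_eq
  have h2 : Module.finrank ℝ (TangentSpace (I.prod I') q) = Module.finrank ℝ (E × ℂ) := by
    change Module.finrank ℝ (E × E') = _
    rw [Module.finrank_prod, Module.finrank_prod, h1]
  have h3 := coframe_injective h hζ hq
  exact ⟨h3, (LinearMap.injective_iff_surjective_of_finrank_eq_finrank
    (f := (coframe I' J D B a c α γ ζ x₀ q : TangentSpace (I.prod I') q →ₗ[ℝ] E × ℂ)) h2).1 h3⟩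

include h hζ in
lemma isFrame_coframe (x₀ : N) : IsFrame (coframe I' J D B a c α γ ζ x₀)
    (Prod.fst ⁻¹' (chartAt H x₀).source) where
  smooth _ hq := fun v ↦ (formSmoothAt_mvfderiv (contMDiff_tautSection hζ _) v).add
    ((formSmoothAt_totalForm h hq v).clm_apply (contMDiff_tautSection hζ _))
  bijective _ hq := coframe_bijective h hζ hq

/-- The inverse of the coframe. -/
def coframeInv (I' : ModelWithCorners ℝ E' H') (J : EndField I N) (D : AffConn I N)
    (B : Tensor12 I N) (a c : Tensor02 I N) (α γ : OneForm I N) (ζ : K → ℂ) (q : N × K) :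
    E × ℂ →L[ℝ] TangentSpace (I.prod I') q :=
  (coframe I' J D B a c α γ ζ q.1 q).inverse

include h hζ in
lemma coframe_coframeInv (q : N × K) (w : E × ℂ) :
    coframe I' J D B a c α γ ζ q.1 q (coframeInv I' J D B a c α γ ζ q w) = w := by
  have hb := coframe_bijective h hζ (mem_chart_source H q.1)
  let e : TangentSpace (I.prod I') q ≃L[ℝ] E × ℂ := (LinearEquiv.ofBijective
    (coframe I' J D B a c α γ ζ q.1 q : TangentSpace (I.prod I') q →ₗ[ℝ] E × ℂ)
      hb).toContinuousLinearEquiv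
  have he : coframe I' J D B a c α γ ζ q.1 q = (e : TangentSpace (I.prod I') q →L[ℝ] E × ℂ) := rfl
  rw [coframeInv, he, ContinuousLinearMap.inverse_equiv]
  exact e.apply_symm_apply w

/-- The change of frames of `TN ⊕ ℂ` induced by a change of charts of `N`. -/
def frameChange (I : ModelWithCorners ℝ E H) {N : Type*} [TopologicalSpace N] [ChartedSpace H N]
    [IsManifold I ∞ N] (x₁ x₀ x : N) : E × ℂ →L[ℝ] E × ℂ :=
  (chartChange I x₁ x₀ x).prodMap (ContinuousLinearMap.id ℝ ℂ)

lemma frameChange_apply (x₁ x₀ x : N) (σ : E × ℂ) :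
    frameChange I x₁ x₀ x σ = (chartChange I x₁ x₀ x σ.1, σ.2) := rfl

lemma chartChange_tr {x₀ x₁ q : N} (h₀ : q ∈ (chartAt H x₀).source) (u : TangentSpace I q) :
    chartChange I x₁ x₀ q (tr I x₀ q u) = tr I x₁ q u := by
  rw [formRep_apply h₀, cst_tr h₀]

lemma sy_chartChange {x₀ x₁ q : N} (h₀ : q ∈ (chartAt H x₀).source)
    (h₁ : q ∈ (chartAt H x₁).source) (w : E) :
    sy I x₁ q (chartChange I x₁ x₀ q w) = sy I x₀ q w := by
  rw [formRep_apply h₀, sy_eq h₁, cst_tr h₁, sy_eq h₀]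

include hζ in
lemma coframe_frameChange {x₀ x₁ : N} {q : N × K} (h₀ : q.1 ∈ (chartAt H x₀).source)
    (u : TangentSpace (I.prod I') q) :
    coframe I' J D B a c α γ ζ x₁ q u =
      frameChange I x₁ x₀ q.1 (coframe I' J D B a c α γ ζ x₀ q u) := by
  rw [coframe_apply hζ, coframe_apply hζ, frameChange_apply, chartChange_tr h₀]

lemma tractorForm_frameChange {x₀ x₁ x : N} (h₀ : x ∈ (chartAt H x₀).source)
    (h₁ : x ∈ (chartAt H x₁).source) (u : TangentSpace I x) (σ : E × ℂ) :
    tractorForm J D B a c α γ x₁ x u (frameChange I x₁ x₀ x σ) +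
      (mvfderiv I (chartChange I x₁ x₀) x u σ.1, 0) =
      frameChange I x₁ x₀ x (tractorForm J D B a c α γ x₀ x u σ) := by
  have h2 := DFunLike.congr_fun (chartChange_comp_christoffel D h₀ h₁ u) σ.1
  simp only [ContinuousLinearMap.comp_apply, add_apply] at h2
  rw [tractorForm_apply, tractorForm_apply, frameChange_apply, frameChange_apply,
    sy_chartChange h₀ h₁, map_add, h2, chartChange_tr h₀, Prod.mk_add_mk, add_zero]
  congr 1
  abel

/-! ### The connection on `N × K` -/

/-- The operator of the connection on `N × K` which is carried to the connection on `TN ⊕ ℂ` by the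
coframe. -/
def totalConnFun (I' : ModelWithCorners ℝ E' H') (J : EndField I N) (D : AffConn I N)
    (B : Tensor12 I N) (a c : Tensor02 I N) (α γ : OneForm I N) (ζ : K → ℂ)
    (Y : VField (I.prod I') (N × K)) (p : N × K) :
    TangentSpace (I.prod I') p →L[ℝ] TangentSpace (I.prod I') p :=
  coframeInv I' J D B a c α γ ζ p ∘L
    (mvfderiv (I.prod I') (fun q ↦ coframe I' J D B a c α γ ζ p.1 q (Y q)) p +
      ContinuousLinearMap.apply ℝ (E × ℂ) (coframe I' J D B a c α γ ζ p.1 p (Y p)) ∘L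
        totalForm I' J D B a c α γ p.1 p)

include h hζ in
lemma coframe_totalConnFun_self (Y : VField (I.prod I') (N × K)) (p : N × K)
    (u : TangentSpace (I.prod I') p) :
    coframe I' J D B a c α γ ζ p.1 p (totalConnFun I' J D B a c α γ ζ Y p u) =
      mvfderiv (I.prod I') (fun q ↦ coframe I' J D B a c α γ ζ p.1 q (Y q)) p u +
        totalForm I' J D B a c α γ p.1 p u (coframe I' J D B a c α γ ζ p.1 p (Y p)) :=
  coframe_coframeInv h hζ p _

include h hζ in
lemma coframe_totalConnFun {x₀ : N} {p : N × K} (hp : p.1 ∈ (chartAt H x₀).source)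
    {Y : VField (I.prod I') (N × K)} (hY : FieldDiffAt Y p)
    (u : TangentSpace (I.prod I') p) :
    coframe I' J D B a c α γ ζ x₀ p (totalConnFun I' J D B a c α γ ζ Y p u) =
      mvfderiv (I.prod I') (fun q ↦ coframe I' J D B a c α γ ζ x₀ q (Y q)) p u +
        totalForm I' J D B a c α γ x₀ p u (coframe I' J D B a c α γ ζ x₀ p (Y p)) := by
  have hc := mem_chart_source H p.1
  have hg : MDifferentiableAt (I.prod I') 𝓘(ℝ, E × ℂ)
      (fun q ↦ coframe I' J D B a c α γ ζ p.1 q (Y q)) p :=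
    ((isFrame_coframe h hζ p.1).smooth p hc).apply_diff hY
  have hτ : MDifferentiableAt I 𝓘(ℝ, E →L[ℝ] E) (chartChange I x₀ p.1) p.1 :=
    (contMDiffAt_chartChange hc hp).mdifferentiableAt (by simp)
  have hτ' : MDifferentiableAt (I.prod I') 𝓘(ℝ, E →L[ℝ] E) (fun q : N × K ↦
      chartChange I x₀ p.1 q.1) p :=
    ((contMDiffAt_chartChange hc hp).comp p contMDiffAt_fst).mdifferentiableAt (by simp)
  have e : (fun q ↦ coframe I' J D B a c α γ ζ x₀ q (Y q)) =ᶠ[𝓝 p] fun q ↦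
      (chartChange I x₀ p.1 q.1 (coframe I' J D B a c α γ ζ p.1 q (Y q)).1,
        (coframe I' J D B a c α γ ζ p.1 q (Y q)).2) := by
    filter_upwards [((chartAt H p.1).open_source.preimage continuous_fst).mem_nhds hc] with q hq
    rw [coframe_frameChange hζ hq, frameChange_apply]
  have h1 := mdifferentiableAt_clm (ContinuousLinearMap.fst ℝ E ℂ) hg
  have h2 := mdifferentiableAt_clm (ContinuousLinearMap.snd ℝ E ℂ) hg
  have h1' := mvfderiv_clm (ContinuousLinearMap.fst ℝ E ℂ) hg u
  have h2' := mvfderiv_clm (ContinuousLinearMap.snd ℝ E ℂ) hg u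
  simp only [ContinuousLinearMap.coe_fst', ContinuousLinearMap.coe_snd'] at h1 h2 h1' h2'
  have h5 := tractorForm_frameChange (J := J) (D := D) (B := B) (a := a) (c := c) (α := α) (γ := γ)
    hc hp (tfst p u) (coframe I' J D B a c α γ ζ p.1 p (Y p))
  rw [← coframe_frameChange hζ hc (x₁ := x₀)] at h5
  rw [coframe_frameChange hζ hc (totalConnFun I' J D B a c α γ ζ Y p u) (x₁ := x₀),
    coframe_totalConnFun_self h hζ, mvfderiv_congr e,
    mvfderiv_prodMk (hτ'.clm_apply h1) h2, mvfderiv_clm_apply hτ' h1, mvfderiv_comp_fst hτ, h1', h2',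
    map_add, pullForm_apply, ← h5, pullForm_apply, frameChange_apply]
  refine Prod.ext ?_ ?_
  · simp only [Prod.fst_add]
    abel
  · simp

/-- The connection on `N × K`. -/
def totalConn (h : StructureEquations J D B a c α γ) (hζ : IsLocalCoordinate I' ζ) :
    AffConn (I.prod I') (N × K) where
  toFun := totalConnFun I' J D B a c α γ ζ
  isCovariantDerivativeOnUniv :=
    { add := fun {X Y} p hX hY _ ↦ by
        have hc := mem_chart_source H p.1
        have hf := (isFrame_coframe h hζ p.1).smooth p hc
        ext1 u
        apply coframe_injective h hζ hc
        rw [add_apply, map_add]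
        simp only [coframe_totalConnFun_self h hζ, Pi.add_apply, map_add]
        rw [mvfderiv_fun_add (hf.apply_diff hX) (hf.apply_diff hY), add_apply]
        abel
      leibniz := fun {X g} p hX hg _ ↦ by
        have hc := mem_chart_source H p.1
        have hf := (isFrame_coframe h hζ p.1).smooth p hc
        ext1 u
        apply coframe_injective h hζ hc
        rw [add_apply, map_add, smul_apply, map_smul, ContinuousLinearMap.smulRight_apply, map_smul]
        simp only [coframe_totalConnFun_self h hζ, Pi.smul_apply', map_smul]
        rw [mvfderiv_fun_smul hg (hf.apply_diff hX), add_apply, smul_apply,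
          ContinuousLinearMap.smulRight_apply, smul_add]
        abel }

lemma isRep_totalConn (x₀ : N) : IsRep (totalConn h hζ) (coframe I' J D B a c α γ ζ x₀)
    (totalForm I' J D B a c α γ x₀) (Prod.fst ⁻¹' (chartAt H x₀).source) :=
  fun _ hp _ hY u ↦ coframe_totalConnFun h hζ hp hY u

end Coframe

section SymmetricDerivative

variable {E : Type*} [NormedAddCommGroup E] [NormedSpace ℝ E] [FiniteDimensional ℝ E]
  [CompleteSpace E]
  {H : Type*} [TopologicalSpace H] {I : ModelWithCorners ℝ E H} [I.Boundaryless]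
  {M : Type*} [TopologicalSpace M] [ChartedSpace H M] [IsManifold I ∞ M]

/-! ### Almost complex structures with symmetric covariant derivative -/

lemma fieldSmoothAt_ext {x : M} (v : TangentSpace I x) : FieldSmoothAt (ext v) x := by
  rw [ext_eq]
  exact fieldSmoothAt_cst (mem_chart_source H x) _

lemma ext_self {x : M} (v : TangentSpace I x) : ext v x = v := by
  rw [ext_eq, cst_tr (mem_chart_source H x)]

lemma covEnd_anticomm (D : AffConn I M) {J : EndField I M} (hJ : ∀ x, EndSmoothAt J x)
    (sq : ∀ x v, J x (J x v) = -v) (x : M) (u v : TangentSpace I x) :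
    covEnd D J x u (J x v) = - J x (covEnd D J x u v) := by
  have hX := fieldSmoothAt_ext (I := I) v
  have h1 := covEnd_apply D (hJ x) (hJ x hX).diffAt u
  have h2 := covEnd_apply D (hJ x) hX.diffAt u
  have h3 : (fun q ↦ J q (J q (ext v q))) = fun q ↦ (-1 : ℝ) • ext v q := by
    funext q
    rw [sq, neg_one_smul]
  rw [h3, conn_const_smul D _ hX, h2, map_add, sq, ext_self, neg_one_smul] at h1
  rw [eq_neg_iff_add_eq_zero]
  have h4 := sub_eq_zero.2 h1
  rw [← neg_eq_zero, ← h4]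
  abel

lemma nijenhuis_eq_zero {D : AffConn I M} (hD : D.torsion = 0) {J : EndField I M}
    (hJ : ∀ x, EndSmoothAt J x) (sq : ∀ x v, J x (J x v) = -v)
    (hs : ∀ x u v, covEnd D J x u v = covEnd D J x v u) (x : M) (u v : TangentSpace I x) :
    nijenhuis J x u v = 0 := by
  have hu := fieldSmoothAt_ext (I := I) u
  have hv := fieldSmoothAt_ext (I := I) v
  rw [nijenhuis, mlieBracket_eq_of_torsion hD (hJ x hu).diffAt (hJ x hv).diffAt,
    mlieBracket_eq_of_torsion hD (hJ x hu).diffAt hv.diffAt,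
    mlieBracket_eq_of_torsion hD hu.diffAt (hJ x hv).diffAt,
    mlieBracket_eq_of_torsion hD hu.diffAt hv.diffAt]
  simp only [covEnd_apply D (hJ x) hu.diffAt, covEnd_apply D (hJ x) hv.diffAt, ext_self, map_sub,
    map_add, sq]
  rw [hs x (J x u) v, hs x (J x v) u, covEnd_anticomm D hJ sq, covEnd_anticomm D hJ sq, hs x v u]
  abel

lemma lieDerivEnd_eq {D : AffConn I M} (hD : D.torsion = 0) {J : EndField I M}
    (hJ : ∀ x, EndSmoothAt J x) {ξ : VField I M} {x : M} (hξ : FieldSmoothAt ξ x)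
    (h : ∀ u, D ξ x u = u) (v : TangentSpace I x) :
    lieDerivEnd ξ J x v = covEnd D J x (ξ x) v := by
  have hv := fieldSmoothAt_ext (I := I) v
  rw [lieDerivEnd, mlieBracket_eq_of_torsion hD hξ.diffAt (hJ x hv).diffAt,
    mlieBracket_eq_of_torsion hD hξ.diffAt hv.diffAt, covEnd_apply D (hJ x) hv.diffAt, h, h,
    ext_self, map_sub]
  abel

lemma complexConn_eq {D : AffConn I M} {J : EndField I M} (hJ : ∀ x, EndSmoothAt J x)
    {Y : VField I M} {x : M} (hY : FieldDiffAt Y x) (u : TangentSpace I x) :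
    complexConn J D Y x u = D Y x u - (1 / 2 : ℝ) • J x (covEnd D J x u (Y x)) := by
  rw [complexConn, covEnd_apply D (hJ x) hY, add_sub_cancel_right]

variable {W : Type*} [NormedAddCommGroup W] [NormedSpace ℝ W] [FiniteDimensional ℝ W]

/-- A flat connection whose coframe is the covariant derivative of a section `σ` has no torsion. -/
lemma IsRep.torsion_eq_zero {D : AffConn I M}
    (h : ∀ x : M, ∃ (U : Set M) (Φ : ∀ q : M, TangentSpace I q →L[ℝ] W)
      (A : ∀ q : M, TangentSpace I q →L[ℝ] W →L[ℝ] W) (σ : M → W), x ∈ U ∧ IsFrame Φ U ∧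
      FormSmoothAt A x ∧ IsRep D Φ A U ∧ ContMDiffAt I 𝓘(ℝ, W) ∞ σ x ∧
      (∀ q u, Φ q u = mvfderiv I σ q u + A q u (σ q)) ∧
      ∀ u v, extD A x u v (σ x) + A x u (A x v (σ x)) - A x v (A x u (σ x)) = 0) :
    D.torsion = 0 := by
  refine torsion_eq_zero_of_cst fun x u v ↦ ?_
  obtain ⟨U, Φ, A, σ, hx, hΦ, hA, hD, hσ, hΦσ, hflat⟩ := h x
  have hx' := mem_chart_source H x
  have key : ∀ u v : TangentSpace I x, Φ x (D (cst I x (tr I x x u)) x v) =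
      mvfderiv I (fun q ↦ mvfderiv I σ q (cst I x (tr I x x u) q)) x v +
      (mvfderiv I (fun q ↦ A q (cst I x (tr I x x u) q)) x v (σ x) +
        A x u (mvfderiv I σ x v)) + A x v (mvfderiv I σ x u + A x u (σ x)) := by
    intro u v
    have hc := fieldSmoothAt_cst (I := I) hx' (tr I x x u)
    have h1 : ContMDiffAt I 𝓘(ℝ, W) ∞ (fun q ↦ mvfderiv I σ q (cst I x (tr I x x u) q)) x :=
      (formSmoothAt_mvfderiv hσ).apply hc
    have h2 := hA.apply hc
    have d1 := h1.mdifferentiableAt (by simp)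
    have d2 := h2.mdifferentiableAt (by simp)
    have d3 := hσ.mdifferentiableAt (by simp)
    rw [hD x hx _ hc.diffAt, cst_tr hx', hΦσ, ← hΦσ]
    simp only [hΦσ]
    rw [mvfderiv_fun_add d1 (d2.clm_apply d3), add_apply, mvfderiv_clm_apply d2 d3, cst_tr hx']
  apply (hΦ.bijective x hx).1
  rw [key, key, mvfderiv_mvfderiv_symm hσ u v, ← sub_eq_zero, ← hflat v u, extD, sub_apply]
  simp only [map_add]
  abel

end SymmetricDerivative

section ComplexValued

variable {E : Type*} [NormedAddCommGroup E] [NormedSpace ℝ E]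
  {H : Type*} [TopologicalSpace H] {I : ModelWithCorners ℝ E H}
  {M : Type*} [TopologicalSpace M] [ChartedSpace H M]

lemma contMDiffAt_complex_mul {f g : M → ℂ} {x : M} {n : ℕ∞ω} (hf : ContMDiffAt I 𝓘(ℝ, ℂ) n f x)
    (hg : ContMDiffAt I 𝓘(ℝ, ℂ) n g x) : ContMDiffAt I 𝓘(ℝ, ℂ) n (fun q ↦ f q * g q) x :=
  (contMDiffAt_clm (ContinuousLinearMap.mul ℝ ℂ) hf).clm_apply hg

lemma contMDiffAt_complex_inv {f : M → ℂ} {x : M} {n : ℕ∞ω} (hf : ContMDiffAt I 𝓘(ℝ, ℂ) n f x)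
    (h : f x ≠ 0) : ContMDiffAt I 𝓘(ℝ, ℂ) n (fun q ↦ (f q)⁻¹) x :=
  ((contDiffAt_inv ℝ h).contMDiffAt (n := n)).comp x hf

end ComplexValued

section TotalSpace

variable {E : Type*} [NormedAddCommGroup E] [NormedSpace ℝ E] [FiniteDimensional ℝ E]
  {H : Type*} [TopologicalSpace H] {I : ModelWithCorners ℝ E H} [I.Boundaryless]
  {N : Type*} [TopologicalSpace N] [ChartedSpace H N] [IsManifold I ∞ N]
  {E' : Type*} [NormedAddCommGroup E'] [NormedSpace ℝ E'] [FiniteDimensional ℝ E']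
  {H' : Type*} [TopologicalSpace H'] {I' : ModelWithCorners ℝ E' H'} [I'.Boundaryless]
  {K : Type*} [TopologicalSpace K] [ChartedSpace H' K] [IsManifold I' ∞ K]
  {J : EndField I N} {D : AffConn I N} {B : Tensor12 I N} {a c : Tensor02 I N}
  {α γ : OneForm I N} {ζ : K → ℂ} [CompleteSpace E] [CompleteSpace E'] [T2Space N]
  (h : StructureEquations J D B a c α γ) (hζ : IsLocalCoordinate I' ζ)

/-! ### The conical special complex structure on `N × K` -/

/-- The principal connection form on `N × K`. -/
def principalForm (_ : StructureEquations J D B a c α γ) (_ : IsLocalCoordinate I' ζ) :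
    COneForm (I.prod I') (N × K) := fun p ↦
  ContinuousLinearMap.mul ℝ ℂ (ζ p.2)⁻¹ ∘L ContinuousLinearMap.snd ℝ E ℂ ∘L
    coframe I' J D B a c α γ ζ p.1 p

lemma coframe_eq_principalForm (x₀ : N) (p : N × K) (u : TangentSpace (I.prod I') p) :
    coframe I' J D B a c α γ ζ x₀ p u =
      (tr I x₀ p.1 (cmul J p.1 (ζ p.2) (tfst p u)), ζ p.2 * principalForm h hζ p u) := by
  have h1 : principalForm h hζ p u = (ζ p.2)⁻¹ * (coframe I' J D B a c α γ ζ p.1 p u).2 := rfl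
  rw [h1, mul_inv_cancel_left₀ (hζ.ne_zero _), coframe_apply hζ, coframe_apply hζ]

lemma mul_principalForm (p : N × K) (u : TangentSpace (I.prod I') p) :
    ζ p.2 * principalForm h hζ p u = mvfderiv I' ζ p.2 (tsnd p u) + α p.1 (tfst p u) • ζ p.2 +
      γ p.1 (tfst p u) • (Complex.I * ζ p.2) := by
  have h1 := coframe_eq_principalForm h hζ p.1 p u
  rw [coframe_apply hζ] at h1
  exact (congrArg Prod.snd h1).symm

lemma principal_ext {p : N × K} {u v : TangentSpace (I.prod I') p} (h₁ : tfst p u = tfst p v)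
    (h₂ : principalForm h hζ p u = principalForm h hζ p v) : u = v := by
  apply coframe_injective h hζ (mem_chart_source H p.1)
  rw [coframe_eq_principalForm h hζ, coframe_eq_principalForm h hζ, h₁, h₂]

/-- The tangent vector of `N × K` with prescribed projection and value of the principal connection
form. -/
def liftVec (_ : StructureEquations J D B a c α γ) (_ : IsLocalCoordinate I' ζ) (p : N × K) :
    TangentSpace I p.1 × ℂ →L[ℝ] TangentSpace (I.prod I') p :=
  coframeInv I' J D B a c α γ ζ p ∘L
    (tr I p.1 p.1 ∘L cmul J p.1 (ζ p.2)).prodMap (ContinuousLinearMap.mul ℝ ℂ (ζ p.2))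

lemma coframe_liftVec (x₀ : N) (p : N × K)
    (w : TangentSpace I p.1 × ℂ) : coframe I' J D B a c α γ ζ x₀ p (liftVec h hζ p w) =
      (tr I x₀ p.1 (cmul J p.1 (ζ p.2) w.1), ζ p.2 * w.2) := by
  have hc := mem_chart_source H p.1
  rw [coframe_frameChange hζ hc]
  refine (congrArg _ (coframe_coframeInv h hζ p _)).trans ?_
  rw [frameChange_apply]
  refine Prod.ext ?_ rfl
  exact chartChange_tr hc _

lemma tfst_liftVec (p : N × K) (w : TangentSpace I p.1 × ℂ) :
    tfst p (liftVec h hζ p w) = w.1 := by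
  have hc := mem_chart_source H p.1
  have h1 := coframe_liftVec h hζ p.1 p w
  rw [coframe_eq_principalForm h hζ, Prod.mk.injEq] at h1
  have h2 := tr_injective hc h1.1
  rw [← cmul_inv_cmul h.sq p.1 (hζ.ne_zero p.2) (tfst p _), h2,
    cmul_inv_cmul h.sq p.1 (hζ.ne_zero p.2)]

lemma principalForm_liftVec (p : N × K) (w : TangentSpace I p.1 × ℂ) :
    principalForm h hζ p (liftVec h hζ p w) = w.2 := by
  have hc := mem_chart_source H p.1
  have h1 := coframe_liftVec h hζ p.1 p w
  rw [coframe_eq_principalForm h hζ, Prod.mk.injEq] at h1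
  exact mul_left_cancel₀ (hζ.ne_zero _) h1.2

lemma fieldSmoothAt_of_principal {Y : VField (I.prod I') (N × K)} {X : VField I N} {p : N × K}
    (hX : FieldSmoothAt X p.1) (hY : ∀ᶠ q in 𝓝 p, tfst q (Y q) = X q.1)
    (hη : ContMDiffAt (I.prod I') 𝓘(ℝ, ℂ) ∞ (fun q ↦ principalForm h hζ q (Y q)) p) :
    FieldSmoothAt Y p := by
  have hc := mem_chart_source H p.1
  have hz : ContMDiffAt (I.prod I') 𝓘(ℝ, ℂ) ∞ (fun q : N × K ↦ ζ q.2) p :=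
    hζ.smooth.contMDiffAt.comp p contMDiffAt_snd
  refine (isFrame_coframe h hζ p.1).fieldSmoothAt hc ?_
  have h1 : ContMDiffAt (I.prod I') 𝓘(ℝ, E) ∞ (fun q : N × K ↦ tr I p.1 q.1 (X q.1)) p :=
    ContMDiffAt.comp_fst' (F := fun x ↦ tr I p.1 x (X x)) ((fieldSmoothAt_iff hc).1 hX)
  have h2 : ContMDiffAt (I.prod I') 𝓘(ℝ, E) ∞ (fun q : N × K ↦ tr I p.1 q.1 (J q.1 (X q.1))) p :=
    ContMDiffAt.comp_fst' (F := fun x ↦ tr I p.1 x (J x (X x)))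
      ((fieldSmoothAt_iff hc).1 (h.smooth_J _ hX))
  refine ((((contMDiffAt_clm Complex.reCLM hz).smul h1).add
    ((contMDiffAt_clm Complex.imCLM hz).smul h2)).prodMk_space (contMDiffAt_complex_mul hz hη)).congr_of_eventuallyEq ?_
  filter_upwards [hY] with q hq
  rw [coframe_eq_principalForm h hζ, hq, cmul_apply, map_add, map_smul, map_smul]
  rfl

lemma fieldSmoothAt_of_tfst_eq_zero {Y : VField (I.prod I') (N × K)} {p : N × K}
    (hY : ∀ q, tfst q (Y q) = 0)
    (hη : ContMDiffAt (I.prod I') 𝓘(ℝ, ℂ) ∞ (fun q ↦ principalForm h hζ q (Y q)) p) :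
    FieldSmoothAt Y p := by
  have h0 : FieldSmoothAt (fun x : N ↦ (0 : TangentSpace I x)) p.1 := by
    refine (fieldSmoothAt_iff (mem_chart_source H p.1)).2 ?_
    simp only [map_zero]
    exact contMDiffAt_const
  exact fieldSmoothAt_of_principal h hζ h0 (Filter.Eventually.of_forall hY) hη

lemma formSmoothAt_principalForm (p : N × K) : FormSmoothAt (principalForm h hζ) p := by
  have hc := mem_chart_source H p.1
  have hz : ContMDiffAt (I.prod I') 𝓘(ℝ, ℂ) ∞ (fun q : N × K ↦ ζ q.2) p :=
    hζ.smooth.contMDiffAt.comp p contMDiffAt_snd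
  intro v
  have h1 := (isFrame_coframe h hζ p.1).smooth p hc v
  refine (contMDiffAt_complex_mul (contMDiffAt_complex_inv hz (hζ.ne_zero _))
    (contMDiffAt_clm (ContinuousLinearMap.snd ℝ E ℂ) h1)).congr_of_eventuallyEq (Filter.Eventually.of_forall fun q ↦ ?_)
  change _ = (ζ q.2)⁻¹ * (coframe I' J D B a c α γ ζ p.1 q _).2
  rw [coframe_eq_principalForm h hζ, inv_mul_cancel_left₀ (hζ.ne_zero _)]

/-- The complex structure of `N × K`. -/
def totalEnd : EndField (I.prod I') (N × K) := fun p ↦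
  liftVec h hζ p ∘L (J p.1 ∘L tfst p).prod
    (ContinuousLinearMap.mul ℝ ℂ Complex.I ∘L principalForm h hζ p)

lemma tfst_totalEnd (p : N × K) (u : TangentSpace (I.prod I') p) :
    tfst p (totalEnd h hζ p u) = J p.1 (tfst p u) := tfst_liftVec h hζ p _

lemma principalForm_totalEnd (p : N × K) (u : TangentSpace (I.prod I') p) :
    principalForm h hζ p (totalEnd h hζ p u) = Complex.I * principalForm h hζ p u :=
  principalForm_liftVec h hζ p _

lemma totalEnd_sq (p : N × K) (u : TangentSpace (I.prod I') p) :
    totalEnd h hζ p (totalEnd h hζ p u) = -u := by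
  apply principal_ext h hζ
  · rw [tfst_totalEnd, tfst_totalEnd, h.sq, map_neg]
  · rw [principalForm_totalEnd, principalForm_totalEnd, map_neg, ← mul_assoc, Complex.I_mul_I,
      neg_one_mul]

/-- The complex structure of `TN` in coordinates. -/
abbrev endRep (J : EndField I N) (x₀ x : N) : E →L[ℝ] E :=
  formRep (W := E) x₀ (fun q ↦ tr I x₀ q ∘L J q) x

lemma endRep_tr {x₀ x : N} (hx : x ∈ (chartAt H x₀).source) (u : TangentSpace I x) :
    endRep J x₀ x (tr I x₀ x u) = tr I x₀ x (J x u) := by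
  rw [formRep_apply hx, ContinuousLinearMap.comp_apply, cst_tr hx]

lemma coframe_totalEnd {x₀ : N} {p : N × K} (hp : p.1 ∈ (chartAt H x₀).source)
    (u : TangentSpace (I.prod I') p) :
    coframe I' J D B a c α γ ζ x₀ p (totalEnd h hζ p u) =
      (endRep J x₀ p.1 (coframe I' J D B a c α γ ζ x₀ p u).1,
        Complex.I * (coframe I' J D B a c α γ ζ x₀ p u).2) := by
  rw [coframe_eq_principalForm h hζ, coframe_eq_principalForm h hζ, tfst_totalEnd,
    principalForm_totalEnd, cmul_J, endRep_tr hp, mul_left_comm]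

include h in
lemma contMDiffAt_endRep {x₀ x : N} (hx : x ∈ (chartAt H x₀).source) :
    ContMDiffAt I 𝓘(ℝ, E →L[ℝ] E) ∞ (endRep J x₀) x :=
  ((h.smooth_J x).formSmoothAt hx).contMDiffAt_formRep hx

lemma endSmoothAt_totalEnd (p : N × K) : EndSmoothAt (totalEnd h hζ) p := by
  intro X hX
  have hc := mem_chart_source H p.1
  have hf := isFrame_coframe h hζ p.1
  refine hf.fieldSmoothAt hc ?_
  have h1 := (hf.smooth p hc).apply hX
  refine (((ContMDiffAt.comp_fst' (contMDiffAt_endRep h hc)).clm_apply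
    (contMDiffAt_clm (ContinuousLinearMap.fst ℝ E ℂ) h1)).prodMk_space
    (contMDiffAt_complex_mul (contMDiffAt_const (c := Complex.I))
      (contMDiffAt_clm (ContinuousLinearMap.snd ℝ E ℂ) h1))).congr_of_eventuallyEq ?_
  filter_upwards [((chartAt H p.1).open_source.preimage continuous_fst).mem_nhds hc] with q hq
  rw [coframe_totalEnd h hζ hq]
  rfl

/-- The Euler field. -/
def eulerField : VField (I.prod I') (N × K) := fun p ↦ liftVec h hζ p (0, 1)

lemma tfst_eulerField (p : N × K) : tfst p (eulerField h hζ p) = 0 := tfst_liftVec h hζ p _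

lemma principalForm_eulerField (p : N × K) : principalForm h hζ p (eulerField h hζ p) = 1 :=
  principalForm_liftVec h hζ p _

lemma coframe_eulerField (x₀ : N) (p : N × K) :
    coframe I' J D B a c α γ ζ x₀ p (eulerField h hζ p) = tautSection E ζ p := by
  rw [coframe_eq_principalForm h hζ, tfst_eulerField, principalForm_eulerField, map_zero, map_zero,
    mul_one]
  rfl

lemma fieldSmoothAt_eulerField (p : N × K) : FieldSmoothAt (eulerField h hζ) p := by
  refine fieldSmoothAt_of_tfst_eq_zero h hζ (tfst_eulerField h hζ) ?_
  simp only [principalForm_eulerField]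
  exact contMDiffAt_const

lemma eulerField_ne_zero (p : N × K) : eulerField h hζ p ≠ 0 := fun h0 ↦ by
  have h1 := principalForm_eulerField h hζ p
  rw [h0, map_zero] at h1
  exact zero_ne_one h1

lemma isOpen_preimage_chart_source (x₀ : N) :
    IsOpen (Prod.fst ⁻¹' (chartAt H x₀).source : Set (N × K)) :=
  (chartAt H x₀).open_source.preimage continuous_fst

include h in
lemma totalForm_flat (p : N × K) (u v : TangentSpace (I.prod I') p) (σ : E × ℂ) :
    extD (totalForm I' J D B a c α γ p.1) p u v σ +
      totalForm I' J D B a c α γ p.1 p u (totalForm I' J D B a c α γ p.1 p v σ) -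
      totalForm I' J D B a c α γ p.1 p v (totalForm I' J D B a c α γ p.1 p u σ) = 0 := by
  rw [extD_pullForm (h.formSmoothAt_tractorForm (mem_chart_source H p.1))]
  exact h.flat p.1 _ _ σ

lemma smooth_totalConn : CovariantDerivative.ContMDiffCovariantDerivative (totalConn h hζ) ∞ :=
  IsRep.contMDiffCovariantDerivative fun p ↦ ⟨_, _, _, isOpen_preimage_chart_source p.1,
    mem_chart_source H p.1, isFrame_coframe h hζ p.1, fun _ hq ↦ formSmoothAt_totalForm h hq,
    isRep_totalConn h hζ p.1⟩

lemma torsion_totalConn : (totalConn h hζ).torsion = 0 :=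
  IsRep.torsion_eq_zero fun p ↦ ⟨_, _, _, tautSection E ζ, mem_chart_source H p.1,
    isFrame_coframe h hζ p.1, formSmoothAt_totalForm h (mem_chart_source H p.1),
    isRep_totalConn h hζ p.1, contMDiff_tautSection hζ p, fun q u ↦ coframe_eq p.1 q u,
    fun u v ↦ totalForm_flat h p u v _⟩

lemma curv_totalConn (p : N × K) (u v w : TangentSpace (I.prod I') p) :
    curv (totalConn h hζ) p u v w = 0 := by
  apply coframe_injective h hζ (mem_chart_source H p.1)
  rw [(isRep_totalConn h hζ p.1).curv_eq (isFrame_coframe h hζ p.1)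
    (fun _ hq ↦ formSmoothAt_totalForm h hq) (isOpen_preimage_chart_source p.1)
    (mem_chart_source H p.1), map_zero]
  exact totalForm_flat h p u v _

lemma totalConn_eulerField (p : N × K) (u : TangentSpace (I.prod I') p) :
    totalConn h hζ (eulerField h hζ) p u = u := by
  have hc := mem_chart_source H p.1
  apply coframe_injective h hζ hc
  rw [isRep_totalConn h hζ p.1 p hc _ (fieldSmoothAt_eulerField h hζ p).diffAt]
  simp only [coframe_eulerField]
  exact (coframe_eq p.1 p u).symm

/-! ### The derivative of the complex structure -/

include h in
lemma mvfderiv_endRep {x : N} (u y : TangentSpace I x) :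
    mvfderiv I (endRep J x) x u (tr I x x y) + christoffel D x x u (tr I x x (J x y)) =
      tr I x x (J x (sy I x x (christoffel D x x u (tr I x x y)))) := by
  have hx := mem_chart_source H x
  have hy := fieldSmoothAt_cst (I := I) hx (tr I x x y)
  have h1 := covEnd_apply D (h.smooth_J x) hy.diffAt u
  rw [h.complex, zero_add] at h1
  have h2 := congrArg (tr I x x) h1
  rw [tr_conn D hx (h.smooth_J x hy).diffAt, cst_tr hx] at h2
  rw [← tr_conn_cst D hx (tr I x x y) u, sy_tr hx, ← h2, ← mvfderiv_apply_const
    ((contMDiffAt_endRep h hx).mdifferentiableAt (by simp))]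
  congr 2
  refine mvfderiv_congr ?_
  filter_upwards [(chartAt H x).open_source.mem_nhds hx] with q hq
  rw [formRep_apply hq]
  rfl

include h in
lemma tractorFst_J (x : N) (u y : TangentSpace I x) (f : ℂ) :
    tractorFst J B α γ x u (J x y) (Complex.I * f) - J x (tractorFst J B α γ x u y f) =
      - J x (B x u y) := by
  have e : (Complex.I * f).re = -f.im ∧ (Complex.I * f).im = f.re := by simp
  simp only [tractorFst, map_add, map_smul, h.anti_B, h.sq, e]
  module

include h in
lemma tractorSnd_J (x : N) (u y : TangentSpace I x) (f : ℂ) :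
    tractorSnd J a c α γ x u (J x y) (Complex.I * f) - Complex.I * tractorSnd J a c α γ x u y f =
      c x u (J x y) • (1 : ℂ) - c x u y • Complex.I := by
  simp only [tractorSnd, complexForm, h.sq, map_neg]
  apply Complex.ext <;> simp <;> ring

lemma coframe_covEnd (p : N × K) (u v : TangentSpace (I.prod I') p) :
    coframe I' J D B a c α γ ζ p.1 p (covEnd (totalConn h hζ) (totalEnd h hζ) p u v) =
      (tr I p.1 p.1 (- J p.1 (B p.1 (tfst p u) (cmul J p.1 (ζ p.2) (tfst p v)))),
        c p.1 (tfst p u) (J p.1 (cmul J p.1 (ζ p.2) (tfst p v))) • (1 : ℂ) -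
          c p.1 (tfst p u) (cmul J p.1 (ζ p.2) (tfst p v)) • Complex.I) := by
  have hc := mem_chart_source H p.1
  set y := cmul J p.1 (ζ p.2) (tfst p v) with hy
  have hX := fieldSmoothAt_ext (I := I.prod I') v
  have hg : MDifferentiableAt (I.prod I') 𝓘(ℝ, E × ℂ)
      (fun q ↦ coframe I' J D B a c α γ ζ p.1 q (ext v q)) p :=
    ((isFrame_coframe h hζ p.1).smooth p hc).apply_diff hX.diffAt
  have hj : MDifferentiableAt I 𝓘(ℝ, E →L[ℝ] E) (endRep J p.1) p.1 :=
    (contMDiffAt_endRep h hc).mdifferentiableAt (by simp)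
  have hj' : MDifferentiableAt (I.prod I') 𝓘(ℝ, E →L[ℝ] E) (fun q : N × K ↦ endRep J p.1 q.1) p :=
    (ContMDiffAt.comp_fst' (contMDiffAt_endRep h hc)).mdifferentiableAt (by simp)
  have h1 := mdifferentiableAt_clm (ContinuousLinearMap.fst ℝ E ℂ) hg
  have h2 := mdifferentiableAt_clm (ContinuousLinearMap.mul ℝ ℂ Complex.I ∘L
    ContinuousLinearMap.snd ℝ E ℂ) hg
  have h1' := mvfderiv_clm (ContinuousLinearMap.fst ℝ E ℂ) hg u
  have h2' := mvfderiv_clm (ContinuousLinearMap.mul ℝ ℂ Complex.I ∘L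
    ContinuousLinearMap.snd ℝ E ℂ) hg u
  simp only [ContinuousLinearMap.coe_fst', ContinuousLinearMap.comp_apply,
    ContinuousLinearMap.coe_snd', ContinuousLinearMap.mul_apply'] at h1 h2 h1' h2'
  have e : (fun q ↦ coframe I' J D B a c α γ ζ p.1 q (totalEnd h hζ q (ext v q))) =ᶠ[𝓝 p] fun q ↦
      (endRep J p.1 q.1 (coframe I' J D B a c α γ ζ p.1 q (ext v q)).1,
        Complex.I * (coframe I' J D B a c α γ ζ p.1 q (ext v q)).2) := by
    filter_upwards [(isOpen_preimage_chart_source p.1).mem_nhds hc] with q hq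
    rw [coframe_totalEnd h hζ hq]
  obtain ⟨w, hw⟩ : ∃ w : TangentSpace I p.1,
      tr I p.1 p.1 w = (mvfderiv (I.prod I')
        (fun q ↦ coframe I' J D B a c α γ ζ p.1 q (ext v q)) p u).1 :=
    ((isFrame_tr (I := I) p.1).bijective p.1 hc).2 _
  have h3 := coframe_eq_principalForm h hζ p.1 p v
  rw [← hy] at h3
  rw [covEnd, map_sub, coframe_totalEnd h hζ hc,
    isRep_totalConn h hζ p.1 p hc _ (endSmoothAt_totalEnd h hζ p hX).diffAt,
    isRep_totalConn h hζ p.1 p hc _ hX.diffAt, mvfderiv_congr e,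
    mvfderiv_prodMk (hj'.clm_apply h1) h2, mvfderiv_clm_apply hj' h1, mvfderiv_comp_fst hj, h1', h2',
    ext_self, coframe_totalEnd h hζ hc, h3, pullForm_apply, tractorForm_apply, tractorForm_apply,
    ← hw, endRep_tr hc, endRep_tr hc]
  dsimp only
  rw [sy_tr hc, sy_tr hc]
  refine Prod.ext ?_ ?_
  · have h4 := mvfderiv_endRep h (tfst p u) y
    have h5 := tractorFst_J h p.1 (tfst p u) y (ζ p.2 * principalForm h hζ p v)
    obtain ⟨z, hz⟩ : ∃ z : TangentSpace I p.1,
        tr I p.1 p.1 z = christoffel D p.1 p.1 (tfst p u) (tr I p.1 p.1 y) :=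
      ((isFrame_tr (I := I) p.1).bijective p.1 hc).2 _
    rw [← hz, sy_tr hc] at h4
    simp only [Prod.fst_sub, Prod.fst_add]
    rw [← h5, ← hw, ← hz, ← map_add, ← map_add, endRep_tr hc, map_sub, map_add, map_add, map_add,
      map_add, ← h4]
    abel
  · have h5 := tractorSnd_J h p.1 (tfst p u) y (ζ p.2 * principalForm h hζ p v)
    simp only [Prod.snd_sub, Prod.snd_add]
    rw [← h5]
    ring

end TotalSpace

section Conical

variable {E : Type*} [NormedAddCommGroup E] [NormedSpace ℝ E] [FiniteDimensional ℝ E]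
  {H : Type*} [TopologicalSpace H] {I : ModelWithCorners ℝ E H} [I.Boundaryless]
  {N : Type*} [TopologicalSpace N] [ChartedSpace H N] [IsManifold I ∞ N]
  {E' : Type*} [NormedAddCommGroup E'] [NormedSpace ℝ E'] [FiniteDimensional ℝ E']
  {H' : Type*} [TopologicalSpace H'] {I' : ModelWithCorners ℝ E' H'} [I'.Boundaryless]
  {K : Type*} [TopologicalSpace K] [ChartedSpace H' K] [IsManifold I' ∞ K]
  {J : EndField I N} {D : AffConn I N} {B : Tensor12 I N} {a c : Tensor02 I N}
  {α γ : OneForm I N} {ζ : K → ℂ} [CompleteSpace E] [CompleteSpace E'] [T2Space N]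
  (h : StructureEquations J D B a c α γ) (hζ : IsLocalCoordinate I' ζ)

include h in
lemma StructureEquations.c_J_comm (x : N) (u v : TangentSpace I x) :
    c x u (J x v) = c x v (J x u) := by
  have h1 := h.anti_c x u (J x v)
  rw [h.sq, map_neg, neg_inj, h.symm_c] at h1
  exact h1.symm

lemma covEnd_totalEnd_symm (p : N × K) (u v : TangentSpace (I.prod I') p) :
    covEnd (totalConn h hζ) (totalEnd h hζ) p u v =
      covEnd (totalConn h hζ) (totalEnd h hζ) p v u := by
  apply coframe_injective h hζ (mem_chart_source H p.1)
  rw [coframe_covEnd, coframe_covEnd]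
  simp only [cmul_apply, map_add, map_smul, h.anti_B, h.sq, map_neg,
    h.symm_B p.1 (tfst p u) (tfst p v), h.symm_c p.1 (tfst p u) (tfst p v),
    h.c_J_comm p.1 (tfst p u) (tfst p v)]

lemma isConicalSpecialComplex :
    IsConicalSpecialComplex (totalEnd h hζ) (totalConn h hζ) (eulerField h hζ) where
  special :=
    { complexStructure :=
        { smooth := smoothEnd_of_endSmoothAt (endSmoothAt_totalEnd h hζ)
          sq := totalEnd_sq h hζ
          integrable := nijenhuis_eq_zero (torsion_totalConn h hζ) (endSmoothAt_totalEnd h hζ)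
            (totalEnd_sq h hζ) (covEnd_totalEnd_symm h hζ) }
      smooth := smooth_totalConn h hζ
      torsion := torsion_totalConn h hζ
      flat := curv_totalConn h hζ
      symmetric := covEnd_totalEnd_symm h hζ }
  smooth_field := fieldSmoothAt_eulerField h hζ
  ne_zero := eulerField_ne_zero h hζ
  nabla_field := totalConn_eulerField h hζ
  lie_field p v := by
    rw [lieDerivEnd_eq (torsion_totalConn h hζ) (endSmoothAt_totalEnd h hζ)
      (fieldSmoothAt_eulerField h hζ p) (totalConn_eulerField h hζ p)]
    apply coframe_injective h hζ (mem_chart_source H p.1)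
    rw [coframe_covEnd, tfst_eulerField]
    simp

/-! ### The complex connection -/

lemma tfst_complexConn {p : N × K} {Y : VField I N} (hY : FieldSmoothAt Y p.1)
    {Y' : VField (I.prod I') (N × K)} (hY' : FieldDiffAt Y' p)
    (hYY : ∀ q, tfst q (Y' q) = Y q.1) (u : TangentSpace (I.prod I') p) :
    tfst p (complexConn (totalEnd h hζ) (totalConn h hζ) Y' p u) =
      D Y p.1 (tfst p u) + cmul J p.1 (principalForm h hζ p u) (Y p.1) +
        cmul J p.1 (principalForm h hζ p (Y' p)) (tfst p u) := by
  have hc := mem_chart_source H p.1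
  have hJY := h.smooth_J _ hY
  have hz : MDifferentiableAt I' 𝓘(ℝ, ℂ) ζ p.2 :=
    hζ.smooth.contMDiffAt.mdifferentiableAt (by simp)
  have hz' : MDifferentiableAt (I.prod I') 𝓘(ℝ, ℂ) (fun y : N × K ↦ ζ y.2) p :=
    (hζ.smooth.contMDiffAt.comp p contMDiffAt_snd).mdifferentiableAt (by simp)
  have hre := mdifferentiableAt_clm Complex.reCLM hz'
  have him := mdifferentiableAt_clm Complex.imCLM hz'
  have hre' := mvfderiv_clm Complex.reCLM hz' u
  have him' := mvfderiv_clm Complex.imCLM hz' u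
  rw [mvfderiv_comp_snd hz] at hre' him'
  have h1 : MDifferentiableAt I 𝓘(ℝ, E) (fun x ↦ tr I p.1 x (Y x)) p.1 :=
    ((fieldSmoothAt_iff hc).1 hY).mdifferentiableAt (by simp)
  have h2 : MDifferentiableAt I 𝓘(ℝ, E) (fun x ↦ tr I p.1 x (J x (Y x))) p.1 :=
    ((fieldSmoothAt_iff hc).1 hJY).mdifferentiableAt (by simp)
  have h1' : MDifferentiableAt (I.prod I') 𝓘(ℝ, E) (fun q : N × K ↦ tr I p.1 q.1 (Y q.1)) p :=
    (ContMDiffAt.comp_fst' (F := fun x ↦ tr I p.1 x (Y x))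
      ((fieldSmoothAt_iff hc).1 hY)).mdifferentiableAt (by simp)
  have h2' : MDifferentiableAt (I.prod I') 𝓘(ℝ, E)
      (fun q : N × K ↦ tr I p.1 q.1 (J q.1 (Y q.1))) p :=
    (ContMDiffAt.comp_fst' (F := fun x ↦ tr I p.1 x (J x (Y x)))
      ((fieldSmoothAt_iff hc).1 hJY)).mdifferentiableAt (by simp)
  have e1 := mvfderiv_comp_fst (I' := I') (q := p) h1 u
  have e2 := mvfderiv_comp_fst (I' := I') (q := p) h2 u
  have hDJ := covEnd_apply D (h.smooth_J p.1) hY.diffAt (tfst p u)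
  rw [h.complex, zero_add] at hDJ
  have e3 := tr_conn D hc hY.diffAt (tfst p u)
  have e4 := tr_conn D hc hJY.diffAt (tfst p u)
  rw [hDJ] at e4
  have hg : MDifferentiableAt (I.prod I') 𝓘(ℝ, E × ℂ)
      (fun q ↦ coframe I' J D B a c α γ ζ p.1 q (Y' q)) p :=
    ((isFrame_coframe h hζ p.1).smooth p hc).apply_diff hY'
  have hfst := mvfderiv_clm (ContinuousLinearMap.fst ℝ E ℂ) hg u
  have hfun : (fun q ↦ ContinuousLinearMap.fst ℝ E ℂ (coframe I' J D B a c α γ ζ p.1 q (Y' q))) =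
      fun q ↦ Complex.reCLM (ζ q.2) • tr I p.1 q.1 (Y q.1) +
        Complex.imCLM (ζ q.2) • tr I p.1 q.1 (J q.1 (Y q.1)) := by
    funext q
    rw [coframe_eq_principalForm h hζ, hYY, cmul_apply, map_add, map_smul, map_smul]
    rfl
  rw [hfun, mvfderiv_fun_add (mdifferentiableAt_fun_smul hre h1') (mdifferentiableAt_fun_smul him h2'),
    add_apply, mvfderiv_fun_smul hre h1', mvfderiv_fun_smul him h2', add_apply, add_apply, smul_apply,
    smul_apply, ContinuousLinearMap.smulRight_apply, ContinuousLinearMap.smulRight_apply,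
    e1, e2, hre', him', ← sub_eq_iff_eq_add.2 e3, ← sub_eq_iff_eq_add.2 e4] at hfst
  have key : tr I p.1 p.1 (cmul J p.1 (ζ p.2)
      (tfst p (complexConn (totalEnd h hζ) (totalConn h hζ) Y' p u))) =
      tr I p.1 p.1 (cmul J p.1 (ζ p.2) (D Y p.1 (tfst p u) +
        cmul J p.1 (principalForm h hζ p u) (Y p.1) +
        cmul J p.1 (principalForm h hζ p (Y' p)) (tfst p u))) := by
    have h3 := congrArg Prod.fst (coframe_eq_principalForm h hζ p.1 p
      (complexConn (totalEnd h hζ) (totalConn h hζ) Y' p u))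
    refine h3.symm.trans ?_
    rw [complexConn_eq (endSmoothAt_totalEnd h hζ) hY', map_sub, map_smul, coframe_totalEnd h hζ hc,
      coframe_covEnd, isRep_totalConn h hζ p.1 p hc _ hY', Prod.fst_sub, Prod.smul_fst,
      endRep_tr hc, Prod.fst_add]
    refine (congrArg (fun z ↦ z + _ - _) hfst.symm).trans ?_
    rw [pullForm_apply, tractorForm_apply, coframe_eq_principalForm h hζ, hYY]
    dsimp only
    rw [sy_tr hc, map_add (cmul J p.1 (ζ p.2)), map_add (cmul J p.1 (ζ p.2)), cmul_cmul h.sq,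
      cmul_cmul h.sq, mul_principalForm h hζ p u]
    simp only [tractorFst, cmul_apply, map_add, map_smul, map_neg, h.sq, Complex.reCLM_apply,
      Complex.imCLM_apply, Complex.add_re, Complex.add_im, Complex.real_smul, Complex.mul_re,
      Complex.mul_im, Complex.I_re, Complex.I_im, Complex.ofReal_re, Complex.ofReal_im]
    module
  have h4 := tr_injective hc key
  have h5 := congrArg (cmul J p.1 (ζ p.2)⁻¹) h4
  rwa [cmul_inv_cmul h.sq p.1 (hζ.ne_zero _), cmul_inv_cmul h.sq p.1 (hζ.ne_zero _)] at h5

end Conical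

section Velocity

variable {E : Type*} [NormedAddCommGroup E] [NormedSpace ℝ E]
  {H : Type*} [TopologicalSpace H] {I : ModelWithCorners ℝ E H}
  {M : Type*} [TopologicalSpace M] [ChartedSpace H M]
  {W : Type*} [NormedAddCommGroup W] [NormedSpace ℝ W]

/-- The velocity of a curve. -/
lemma mvfderiv_velocity {g : ℝ → M} {p : M} (hp : g 0 = p)
    (hg : MDifferentiableAt 𝓘(ℝ, ℝ) I g 0) {F : M → W} (hF : MDifferentiableAt I 𝓘(ℝ, W) F p) :
    mvfderiv I F p ((mfderiv 𝓘(ℝ, ℝ) I g 0 : ℝ →L[ℝ] E) 1 : E) = deriv (fun t ↦ F (g t)) 0 := by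
  subst hp
  have h1 := (HasMFDerivAt.comp (0 : ℝ) hF.hasMFDerivAt hg.hasMFDerivAt).mfderiv
  rw [mfderiv_eq_fderiv] at h1
  exact (DFunLike.congr_fun h1 1).symm

end Velocity

section ComplexGroup

variable {E' : Type*} [NormedAddCommGroup E'] [NormedSpace ℝ E'] [FiniteDimensional ℝ E']
  {H' : Type*} [TopologicalSpace H'] {I' : ModelWithCorners ℝ E' H'} [I'.Boundaryless]
  {K : Type*} [TopologicalSpace K] [ChartedSpace H' K] [IsManifold I' ∞ K]

lemma mvfderiv_units_val (z : ℂˣ) (u : TangentSpace 𝓘(ℝ, ℂ) z) :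
    mvfderiv 𝓘(ℝ, ℂ) (Units.val : ℂˣ → ℂ) z u = u := by
  have h1 := mfderiv_extChartAt_eq_tr (I := 𝓘(ℝ, ℂ)) (mem_chart_source ℂ z) u
  rw [tr_self] at h1
  exact h1

lemma isLocalCoordinate_diffeomorph (e : K ≃ₘ^∞⟮I', 𝓘(ℝ, ℂ)⟯ ℂˣ) :
    IsLocalCoordinate I' (fun k ↦ (e k : ℂ)) where
  smooth := Units.contMDiff_val.comp e.contMDiff
  ne_zero k := (e k).ne_zero
  bijective k := by
    have h0 : MDifferentiableAt I' 𝓘(ℝ, ℂ) e k := e.contMDiff.mdifferentiable (by simp) k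
    have h1 : ∀ u, mvfderiv I' (fun k ↦ (e k : ℂ)) k u = mfderiv I' 𝓘(ℝ, ℂ) e k u := fun u ↦ by
      have h2 : MDifferentiableAt 𝓘(ℝ, ℂ) 𝓘(ℝ, ℂ) (Units.val : ℂˣ → ℂ) (e k) :=
        (Units.contMDiff_val (n := ∞)).mdifferentiable (by simp) _
      exact (DFunLike.congr_fun (HasMFDerivAt.comp k h2.hasMFDerivAt h0.hasMFDerivAt).mfderiv
        u).trans (mvfderiv_units_val _ _)
    have h3 := (e.mfderivToContinuousLinearEquiv (by simp) k).bijective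
    exact (funext h1 : ⇑(mvfderiv I' (fun k ↦ (e k : ℂ)) k) = _) ▸ h3

/-- The action of `ℂˣ` on `N × K` for `K ≅ ℂˣ`. -/
def fiberAct (N : Type*) (e : K ≃ₘ^∞⟮I', 𝓘(ℝ, ℂ)⟯ ℂˣ) (z : ℂˣ) (p : N × K) : N × K :=
  (p.1, e.symm (z * e p.2))

variable {E : Type*} [NormedAddCommGroup E] [NormedSpace ℝ E]
  {H : Type*} [TopologicalSpace H] {I : ModelWithCorners ℝ E H}
  {N : Type*} [TopologicalSpace N] [ChartedSpace H N] [IsManifold I ∞ N]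
  (e : K ≃ₘ^∞⟮I', 𝓘(ℝ, ℂ)⟯ ℂˣ)

lemma fiberAct_snd (z : ℂˣ) (p : N × K) : e (fiberAct N e z p).2 = z * e p.2 :=
  e.apply_symm_apply _

lemma fiberAct_one (p : N × K) : fiberAct N e 1 p = p := by
  rw [fiberAct, one_mul, e.symm_apply_apply]

variable (I)

lemma contMDiff_fiberAct : ContMDiff (𝓘(ℝ, ℂ).prod (I.prod I')) (I.prod I') ∞
    (fun q : ℂˣ × N × K ↦ fiberAct N e q.1 q.2) :=
  (contMDiff_fst.comp contMDiff_snd).prodMk (e.symm.contMDiff.comp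
    ((contMDiff_fst).mul (e.contMDiff.comp (contMDiff_snd.comp contMDiff_snd))))

lemma contMDiff_fiberAct_left (z : ℂˣ) :
    ContMDiff (I.prod I') (I.prod I') ∞ (fiberAct N e z) :=
  (contMDiff_fiberAct I e).comp (contMDiff_const.prodMk contMDiff_id)

lemma isPrincipalBundle_fiberAct :
    IsPrincipalBundle (I.prod I') I (fiberAct N e) (Prod.fst : N × K → N) where
  act_one := fiberAct_one e
  act_mul z w p := by
    rw [fiberAct, fiberAct, fiberAct, e.apply_symm_apply, mul_assoc]
  smooth_act := contMDiff_fiberAct I e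
  smooth_proj := contMDiff_fst
  proj_act _ _ := rfl
  locallyTrivial b := by
    refine ⟨Set.univ, ((Homeomorph.refl N).prodCongr e.toHomeomorph).toOpenPartialHomeomorph,
      isOpen_univ, trivial, rfl, Set.univ_prod_univ.symm, ?_, ?_, fun p _ ↦ rfl,
      fun z p _ ↦ fiberAct_snd e z p⟩
    · exact (contMDiff_fst.prodMk (e.contMDiff.comp contMDiff_snd)).contMDiffOn
    · exact (contMDiff_fst.prodMk (e.symm.contMDiff.comp contMDiff_snd)).contMDiffOn

lemma contMDiff_expUnit (w : ℂ) :
    ContMDiff 𝓘(ℝ, ℝ) 𝓘(ℝ, ℂ) ∞ (fun t : ℝ ↦ expUnit (t * w)) := by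
  refine ContMDiff.of_comp_isOpenEmbedding Units.isOpenEmbedding_val ?_
  refine ContDiff.contMDiff ?_
  change ContDiff ℝ ∞ fun t : ℝ ↦ Complex.exp (t * w)
  exact (Complex.ofRealCLM.contDiff.mul contDiff_const).cexp

lemma expUnit_zero (w : ℂ) : expUnit (((0 : ℝ) : ℂ) * w) = 1 := by
  ext
  simp [expUnit]

lemma mdifferentiableAt_orbit (w : ℂ) (p : N × K) : MDifferentiableAt 𝓘(ℝ, ℝ) (I.prod I')
    (fun t : ℝ ↦ fiberAct N e (expUnit (t * w)) p) 0 :=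
  ((contMDiff_fiberAct I e).comp ((contMDiff_expUnit w).prodMk contMDiff_const)).mdifferentiable
    (by simp) _

end ComplexGroup

section Quotient

variable {E : Type*} [NormedAddCommGroup E] [NormedSpace ℝ E] [FiniteDimensional ℝ E]
  {H : Type*} [TopologicalSpace H] {I : ModelWithCorners ℝ E H} [I.Boundaryless]
  {N : Type*} [TopologicalSpace N] [ChartedSpace H N] [IsManifold I ∞ N]
  {E' : Type*} [NormedAddCommGroup E'] [NormedSpace ℝ E'] [FiniteDimensional ℝ E']
  {H' : Type*} [TopologicalSpace H'] {I' : ModelWithCorners ℝ E' H'} [I'.Boundaryless]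
  {K : Type*} [TopologicalSpace K] [ChartedSpace H' K] [IsManifold I' ∞ K]
  {J : EndField I N} {D : AffConn I N} {B : Tensor12 I N} {a c : Tensor02 I N}
  {α γ : OneForm I N} [CompleteSpace E] [CompleteSpace E'] [T2Space N]
  (h : StructureEquations J D B a c α γ) (e : K ≃ₘ^∞⟮I', 𝓘(ℝ, ℂ)⟯ ℂˣ)

/-! ### The action of `ℂˣ` -/

lemma fundField_fiberAct (w : ℂ) (p : N × K) :
    fundField (I := I.prod I') (fiberAct N e) w p =
      liftVec h (isLocalCoordinate_diffeomorph e) p (0, w) := by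
  set hζ := isLocalCoordinate_diffeomorph e
  have hc := mem_chart_source H p.1
  have hp : fiberAct N e (expUnit (((0 : ℝ) : ℂ) * w)) p = p := by
    rw [expUnit_zero, fiberAct_one]
  have hg := mdifferentiableAt_orbit I e w p
  have h1 : MDifferentiableAt I 𝓘(ℝ, E) (extChartAt I p.1) p.1 :=
    (contMDiffAt_extChartAt_of_mem hc).mdifferentiableAt (by simp)
  have h1' : MDifferentiableAt (I.prod I') 𝓘(ℝ, E) (fun q : N × K ↦ extChartAt I p.1 q.1) p :=
    (ContMDiffAt.comp_fst' (contMDiffAt_extChartAt_of_mem hc)).mdifferentiableAt (by simp)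
  have h2 : MDifferentiableAt I' 𝓘(ℝ, ℂ) (fun k ↦ (e k : ℂ)) p.2 :=
    hζ.smooth.contMDiffAt.mdifferentiableAt (by simp)
  have h2' : MDifferentiableAt (I.prod I') 𝓘(ℝ, ℂ) (fun q : N × K ↦ (e q.2 : ℂ)) p :=
    (hζ.smooth.contMDiffAt.comp p contMDiffAt_snd).mdifferentiableAt (by simp)
  have v1 : mvfderiv (I.prod I') (fun q : N × K ↦ extChartAt I p.1 q.1) p
      (fundField (I := I.prod I') (fiberAct N e) w p) = 0 :=
    (mvfderiv_velocity hp hg h1').trans (deriv_const 0 (extChartAt I p.1 p.1))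
  have v2 : mvfderiv (I.prod I') (fun q : N × K ↦ (e q.2 : ℂ)) p
      (fundField (I := I.prod I') (fiberAct N e) w p) = e p.2 * w := by
    refine (mvfderiv_velocity hp hg h2').trans ?_
    have e1 : (fun t : ℝ ↦ ((e (fiberAct N e (expUnit (t * w)) p).2 : ℂˣ) : ℂ)) =
        fun t : ℝ ↦ Complex.exp (t * w) * e p.2 := by
      funext t
      rw [fiberAct_snd]
      rfl
    rw [e1]
    have d : HasDerivAt (fun t : ℝ ↦ Complex.exp (t * w) * e p.2) _ 0 :=
      (((Complex.ofRealCLM.hasDerivAt (x := (0 : ℝ))).mul_const w).cexp).mul_const _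
    rw [d.deriv]
    simp [mul_comm]
  rw [mvfderiv_comp_fst h1, mfderiv_extChartAt_eq_tr hc] at v1
  rw [mvfderiv_comp_snd h2] at v2
  have t0 : tfst p (fundField (I := I.prod I') (fiberAct N e) w p) = 0 :=
    tr_injective hc (by rw [v1, map_zero])
  apply principal_ext h hζ
  · rw [tfst_liftVec, t0]
  · rw [principalForm_liftVec]
    have h3 := mul_principalForm h hζ p (fundField (I := I.prod I') (fiberAct N e) w p)
    rw [v2, t0, map_zero, map_zero, zero_smul, zero_smul, add_zero, add_zero] at h3
    exact mul_left_cancel₀ (hζ.ne_zero _) h3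

lemma tfst_mfderiv_fiberAct (z : ℂˣ) (p : N × K) (u : TangentSpace (I.prod I') p) :
    tfst (fiberAct N e z p) (mfderiv (I.prod I') (I.prod I') (fiberAct N e z) p u) =
      (tfst p u : TangentSpace I p.1) := by
  have h1 : MDifferentiableAt (I.prod I') (I.prod I') (fiberAct N e z) p :=
    (contMDiff_fiberAct_left I e z).mdifferentiable (by simp) p
  have h2 : HasMFDerivAt (I.prod I') I (Prod.fst : N × K → N) (fiberAct N e z p) _ :=
    hasMFDerivAt_fst _
  have h3 := (HasMFDerivAt.comp p h2 h1.hasMFDerivAt).mfderiv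
  exact (DFunLike.congr_fun h3 u).symm.trans (mfderiv_fst_eq p u)

lemma principalForm_mfderiv_fiberAct (z : ℂˣ) (p : N × K) (u : TangentSpace (I.prod I') p) :
    principalForm h (isLocalCoordinate_diffeomorph e) (fiberAct N e z p)
      (mfderiv (I.prod I') (I.prod I') (fiberAct N e z) p u) =
      principalForm h (isLocalCoordinate_diffeomorph e) p u := by
  set hζ := isLocalCoordinate_diffeomorph e
  have h0 : MDifferentiableAt (I.prod I') (I.prod I') (fiberAct N e z) p :=
    (contMDiff_fiberAct_left I e z).mdifferentiable (by simp) p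
  have h2 : ∀ k, MDifferentiableAt I' 𝓘(ℝ, ℂ) (fun k ↦ (e k : ℂ)) k := fun k ↦
    hζ.smooth.contMDiffAt.mdifferentiableAt (by simp)
  have h2' : ∀ p, MDifferentiableAt (I.prod I') 𝓘(ℝ, ℂ) (fun q : N × K ↦ (e q.2 : ℂ)) p := fun p ↦
    (hζ.smooth.contMDiffAt.comp p contMDiffAt_snd).mdifferentiableAt (by simp)
  have h3 : mvfderiv (I.prod I') (fun q : N × K ↦ (e q.2 : ℂ)) (fiberAct N e z p)
      (mfderiv (I.prod I') (I.prod I') (fiberAct N e z) p u) =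
      z * mvfderiv (I.prod I') (fun q : N × K ↦ (e q.2 : ℂ)) p u := by
    have h4 := DFunLike.congr_fun (HasMFDerivAt.comp p (h2' _).hasMFDerivAt h0.hasMFDerivAt).mfderiv u
    refine Eq.trans h4.symm ?_
    have e1 : (fun q : N × K ↦ (e q.2 : ℂ)) ∘ fiberAct N e z =
        fun q ↦ ContinuousLinearMap.mul ℝ ℂ z (e q.2) := by
      funext q
      exact congrArg Units.val (fiberAct_snd e z q)
    rw [e1]
    exact mvfderiv_clm (ContinuousLinearMap.mul ℝ ℂ z) (h2' p) u
  rw [mvfderiv_comp_snd (h2 _), mvfderiv_comp_snd (h2 _)] at h3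
  have h5 := mul_principalForm h hζ (fiberAct N e z p)
    (mfderiv (I.prod I') (I.prod I') (fiberAct N e z) p u)
  have h6 := mul_principalForm h hζ p u
  rw [h3, tfst_mfderiv_fiberAct, fiberAct_snd, Units.val_mul] at h5
  change (z : ℂ) * e p.2 * _ = z * _ + α p.1 (tfst p u) • _ + γ p.1 (tfst p u) • _ at h5
  have h7 : (z : ℂ) * (e p.2 * principalForm h hζ (fiberAct N e z p)
      (mfderiv (I.prod I') (I.prod I') (fiberAct N e z) p u)) =
      z * (e p.2 * principalForm h hζ p u) := by
    rw [← mul_assoc, h5, h6]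
    simp only [Complex.real_smul]
    ring
  exact mul_left_cancel₀ (hζ.ne_zero _) (mul_left_cancel₀ z.ne_zero h7)

lemma isProjectiveSpecialQuotient (hJ : IsComplexStructure J) :
    IsProjectiveSpecialQuotient (totalEnd h (isLocalCoordinate_diffeomorph e))
      (totalConn h (isLocalCoordinate_diffeomorph e))
      (eulerField h (isLocalCoordinate_diffeomorph e)) (fiberAct N e) Prod.fst J where
  conical := isConicalSpecialComplex h _
  complexBase := hJ
  principal := isPrincipalBundle_fiberAct I e
  fund_one p := fundField_fiberAct h e 1 p
  fund_I p := by
    rw [fundField_fiberAct h]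
    apply principal_ext h (isLocalCoordinate_diffeomorph e)
    · rw [tfst_liftVec, tfst_totalEnd, tfst_eulerField, map_zero]
    · rw [principalForm_liftVec, principalForm_totalEnd, principalForm_eulerField, mul_one]
  holomorphic_act z p v := by
    apply principal_ext h (isLocalCoordinate_diffeomorph e)
    · rw [tfst_mfderiv_fiberAct, tfst_totalEnd, tfst_totalEnd, tfst_mfderiv_fiberAct]
      rfl
    · rw [principalForm_mfderiv_fiberAct, principalForm_totalEnd, principalForm_totalEnd,
        principalForm_mfderiv_fiberAct]
  holomorphic_proj p v := by
    rw [mfderiv_fst_eq, mfderiv_fst_eq, tfst_totalEnd]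

end Quotient

section Canonical

variable {E : Type*} [NormedAddCommGroup E] [NormedSpace ℝ E] [FiniteDimensional ℝ E]
  {H : Type*} [TopologicalSpace H] {I : ModelWithCorners ℝ E H} [I.Boundaryless]
  {N : Type*} [TopologicalSpace N] [ChartedSpace H N] [IsManifold I ∞ N]
  {E' : Type*} [NormedAddCommGroup E'] [NormedSpace ℝ E'] [FiniteDimensional ℝ E']
  {H' : Type*} [TopologicalSpace H'] {I' : ModelWithCorners ℝ E' H'} [I'.Boundaryless]
  {K : Type*} [TopologicalSpace K] [ChartedSpace H' K] [IsManifold I' ∞ K]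
  {J : EndField I N} {D : AffConn I N} {B : Tensor12 I N} {a c : Tensor02 I N}
  {α γ : OneForm I N} [CompleteSpace E] [CompleteSpace E'] [T2Space N]

/-! ### The canonical c-projective structure -/

lemma CProjRelated.trans {D₁ D₂ D₃ : AffConn I N} (h₁ : CProjRelated J D₁ D₂)
    (h₂ : CProjRelated J D₂ D₃) : CProjRelated J D₁ D₃ := by
  obtain ⟨θ, hθ, h⟩ := h₁
  obtain ⟨τ, hτ, k⟩ := h₂
  refine ⟨fun x ↦ θ x + τ x, smoothOneForm_iff.2 fun x v ↦
    (hθ.formSmoothAt x v).add (hτ.formSmoothAt x v), fun Y hY x u ↦ ?_⟩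
  rw [h Y hY, k Y hY]
  simp only [add_apply]
  module

variable (h : StructureEquations J D B a c α γ) (e : K ≃ₘ^∞⟮I', 𝓘(ℝ, ℂ)⟯ ℂˣ)

lemma isPrincipalConnection_principalForm : IsPrincipalConnection (I := I.prod I') (fiberAct N e)
    (principalForm h (isLocalCoordinate_diffeomorph e)) where
  smooth := smoothCOneForm_iff.2 (formSmoothAt_principalForm h _)
  fundamental w p := by rw [fundField_fiberAct h, principalForm_liftVec]
  invariant z p v := principalForm_mfderiv_fiberAct h e z p v

lemma isProjectedConn_principalForm : IsProjectedConn (I := I.prod I') (I' := I)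
    (Prod.fst : N × K → N) (principalForm h (isLocalCoordinate_diffeomorph e))
    (complexConn (totalEnd h (isLocalCoordinate_diffeomorph e))
      (totalConn h (isLocalCoordinate_diffeomorph e))) D := by
  intro Y Y' hY hY' p u hu
  have h1 : ∀ q, tfst q (Y' q) = Y q.1 := fun q ↦ (mfderiv_fst_eq q _).symm.trans (hY' q).2
  have h2 : FieldSmoothAt Y' p := by
    refine fieldSmoothAt_of_principal h (isLocalCoordinate_diffeomorph e) (hY p.1)
      (Filter.Eventually.of_forall h1) ?_
    simp only [fun q ↦ (hY' q).1]
    exact contMDiffAt_const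
  rw [mfderiv_fst_eq, mfderiv_fst_eq, tfst_complexConn h _ (hY p.1) h2.diffAt h1, hu, (hY' p).1]
  simp [cmul_apply]

variable {η : COneForm (I.prod I') (N × K)}

lemma contMDiffAt_principalConnection_liftVec (hη : IsPrincipalConnection (fiberAct N e) η)
    {Y : VField I N} {p : N × K} (hY : FieldSmoothAt Y p.1) :
    ContMDiffAt (I.prod I') 𝓘(ℝ, ℂ) ∞
      (fun q ↦ η q (liftVec h (isLocalCoordinate_diffeomorph e) q (Y q.1, 0))) p := by
  refine (smoothCOneForm_iff.1 hη.smooth p).apply (fieldSmoothAt_of_principal h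
    (isLocalCoordinate_diffeomorph e) hY (Filter.Eventually.of_forall fun q ↦
      tfst_liftVec h _ q _) ?_)
  simp only [principalForm_liftVec]
  exact contMDiffAt_const

lemma principalConnection_liftVec (hη : IsPrincipalConnection (fiberAct N e) η) (p : N × K)
    (u : TangentSpace I p.1) (w : ℂ) :
    η p (liftVec h (isLocalCoordinate_diffeomorph e) p (u, w)) =
      η p (liftVec h (isLocalCoordinate_diffeomorph e) p (u, 0)) + w := by
  have h1 : ((u, w) : TangentSpace I p.1 × ℂ) = (u, 0) + (0, w) := by simp
  rw [h1, map_add, map_add, ← fundField_fiberAct h, hη.fundamental]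

/-- The connection projected along an arbitrary principal connection. -/
lemma projectedConn_eq (hη : IsPrincipalConnection (fiberAct N e) η) {D₀ : AffConn I N}
    (hD : IsProjectedConn (I' := I) (Prod.fst : N × K → N) η
      (complexConn (totalEnd h (isLocalCoordinate_diffeomorph e))
        (totalConn h (isLocalCoordinate_diffeomorph e))) D₀)
    {Y : VField I N} (hY : SmoothVField Y) (p : N × K) (u : TangentSpace I p.1) :
    D₀ Y p.1 u = D Y p.1 u +
      cmul J p.1 (-η p (liftVec h (isLocalCoordinate_diffeomorph e) p (u, 0))) (Y p.1) +
      cmul J p.1 (-η p (liftVec h (isLocalCoordinate_diffeomorph e) p (Y p.1, 0))) u := by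
  set hζ := isLocalCoordinate_diffeomorph e
  set Y' : VField (I.prod I') (N × K) := fun q ↦
    liftVec h hζ q (Y q.1, -η q (liftVec h hζ q (Y q.1, 0)))
  have h1 : ∀ q, tfst q (Y' q) = Y q.1 := fun q ↦ tfst_liftVec h hζ q _
  have h2 : FieldSmoothAt Y' p := by
    refine fieldSmoothAt_of_principal h hζ (hY p.1) (Filter.Eventually.of_forall h1) ?_
    simp only [Y', principalForm_liftVec]
    exact (contMDiffAt_principalConnection_liftVec h e hη (hY p.1)).neg
  have h3 : IsHorizontalLift (I' := I) Prod.fst η Y Y' := fun q ↦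
    ⟨by rw [principalConnection_liftVec h e hη, add_neg_cancel], by rw [mfderiv_fst_eq, h1]⟩
  have h4 := hD Y Y' hY h3 p (liftVec h hζ p (u, -η p (liftVec h hζ p (u, 0))))
    (by rw [principalConnection_liftVec h e hη, add_neg_cancel])
  rw [mfderiv_fst_eq, mfderiv_fst_eq, tfst_complexConn h hζ (hY p.1) h2.diffAt h1, tfst_liftVec,
    principalForm_liftVec, principalForm_liftVec] at h4
  exact h4.symm

lemma principalConnection_liftVec_J (hη : IsPrincipalConnection (fiberAct N e) η)
    (hker : ∀ (p : N × K) (u : TangentSpace (I.prod I') p), η p u = 0 →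
      η p (totalEnd h (isLocalCoordinate_diffeomorph e) p u) = 0) (p : N × K)
    (u : TangentSpace I p.1) :
    η p (liftVec h (isLocalCoordinate_diffeomorph e) p (J p.1 u, 0)) =
      Complex.I * η p (liftVec h (isLocalCoordinate_diffeomorph e) p (u, 0)) := by
  set hζ := isLocalCoordinate_diffeomorph e
  set w := η p (liftVec h hζ p (u, 0)) with hw
  have h1 := hker p (liftVec h hζ p (u, -w))
    (by rw [principalConnection_liftVec h e hη, ← hw, add_neg_cancel])
  have h2 : totalEnd h hζ p (liftVec h hζ p (u, -w)) =
      liftVec h hζ p (J p.1 u, -(Complex.I * w)) := by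
    apply principal_ext h hζ
    · rw [tfst_totalEnd, tfst_liftVec, tfst_liftVec]
    · rw [principalForm_totalEnd, principalForm_liftVec, principalForm_liftVec, mul_neg]
  rw [h2, principalConnection_liftVec h e hη] at h1
  exact add_neg_eq_zero.1 h1

lemma cprojRelated_of_isProjectedConn (hη : IsPrincipalConnection (fiberAct N e) η)
    (hker : ∀ (p : N × K) (u : TangentSpace (I.prod I') p), η p u = 0 →
      η p (totalEnd h (isLocalCoordinate_diffeomorph e) p u) = 0) {D₀ : AffConn I N}
    (hD : IsProjectedConn (I' := I) (Prod.fst : N × K → N) η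
      (complexConn (totalEnd h (isLocalCoordinate_diffeomorph e))
        (totalConn h (isLocalCoordinate_diffeomorph e))) D₀) : CProjRelated J D₀ D := by
  set hζ := isLocalCoordinate_diffeomorph e
  let k₀ : K := e.symm 1
  refine ⟨fun x ↦ -(Complex.reCLM ∘L η (x, k₀) ∘L liftVec h hζ (x, k₀) ∘L
    ContinuousLinearMap.inl ℝ (TangentSpace I x) ℂ), smoothOneForm_iff.2 fun x v ↦ ?_,
    fun Y hY x u ↦ ?_⟩
  · have h1 := contMDiffAt_principalConnection_liftVec h e hη (p := (x, k₀))
      (fieldSmoothAt_cst (mem_chart_source H x) v)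
    have h2 : ContMDiffAt I (I.prod I') ∞ (fun y : N ↦ (y, k₀)) x :=
      contMDiffAt_id.prodMk contMDiffAt_const
    exact (contMDiffAt_clm Complex.reCLM (ContMDiffAt.comp x h1 h2)).neg
  · have h1 := projectedConn_eq h e hη hD hY (x, k₀) u
    have h2 := principalConnection_liftVec_J h e hη hker (x, k₀) u
    have h3 := principalConnection_liftVec_J h e hη hker (x, k₀) (Y x)
    refine h1.trans ?_
    simp only [neg_apply, ContinuousLinearMap.comp_apply, ContinuousLinearMap.inl_apply]
    change _ = _ + (-Complex.reCLM (η (x, k₀) (liftVec h hζ (x, k₀) (u, 0)))) • Y x +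
      (-Complex.reCLM (η (x, k₀) (liftVec h hζ (x, k₀) (Y x, 0)))) • u -
      (-Complex.reCLM (η (x, k₀) (liftVec h hζ (x, k₀) (J x u, 0)))) • J x (Y x) -
      (-Complex.reCLM (η (x, k₀) (liftVec h hζ (x, k₀) (J x (Y x), 0)))) • J x u
    rw [h2, h3]
    simp only [cmul_apply, Complex.neg_re, Complex.neg_im, Complex.reCLM_apply, Complex.mul_re,
      Complex.I_re, Complex.I_im, zero_mul, one_mul, zero_sub]
    module

lemma canonicalCProj_eq (hD : IsTorsionFreeComplex J D) :
    canonicalCProj (totalEnd h (isLocalCoordinate_diffeomorph e))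
      (totalConn h (isLocalCoordinate_diffeomorph e)) (fiberAct N e) Prod.fst J =
      cprojClass J D := by
  ext D'
  constructor
  · rintro ⟨η, D₀, hη, hker, -, hproj, hD', hrel⟩
    exact ⟨hD', hrel.trans (cprojRelated_of_isProjectedConn h e hη hker hproj)⟩
  · intro hD'
    refine ⟨_, D, isPrincipalConnection_principalForm h e, fun p u hu ↦ ?_, hD,
      isProjectedConn_principalForm h e, hD'⟩
    rw [principalForm_totalEnd, hu, mul_zero]

end Canonical

section Polar

/-! ### Polar coordinates of `ℂˣ` -/

attribute [local instance] finrank_real_complex_fact'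

lemma contMDiff_posReal_val : ContMDiff 𝓘(ℝ, ℝ) 𝓘(ℝ, ℝ) ∞ (Subtype.val : posReal → ℝ) :=
  contMDiff_subtype_val

lemma contMDiff_units_norm :
    ContMDiff 𝓘(ℝ, ℂ) 𝓘(ℝ, ℝ) ∞ (fun z : ℂˣ ↦ ‖(z : ℂ)‖) := fun z ↦
  ((contDiffAt_norm ℝ z.ne_zero).contMDiffAt (n := ∞)).comp z Units.contMDiff_val.contMDiffAt

lemma contMDiff_phase : ContMDiff 𝓘(ℝ, ℂ) (𝓡 1) ∞ phase := by
  have h : ContMDiff 𝓘(ℝ, ℂ) 𝓘(ℝ, ℂ) ∞ (fun z : ℂˣ ↦ (z : ℂ) / (‖(z : ℂ)‖ : ℂ)) := by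
    intro z
    have h1 : ContMDiffAt 𝓘(ℝ, ℂ) 𝓘(ℝ, ℂ) ∞ (fun z : ℂˣ ↦ (z : ℂ)) z :=
      Units.contMDiff_val.contMDiffAt
    have h2 := contMDiffAt_clm Complex.ofRealCLM (contMDiff_units_norm z)
    exact contMDiffAt_complex_mul h1 (contMDiffAt_complex_inv h2 (by simp))
  exact ContMDiff.codRestrict_sphere h _

/-- The diffeomorphism `S¹ × ℝ^{>0} ≅ ℂˣ`. -/
def polar : (Circle × posReal) ≃ₘ^∞⟮(𝓡 1).prod 𝓘(ℝ, ℝ), 𝓘(ℝ, ℂ)⟯ ℂˣ where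
  toFun k := Units.mk0 ((k.2 : ℝ) * (k.1 : ℂ))
    (mul_ne_zero (Complex.ofReal_ne_zero.2 (ne_of_gt k.2.2)) k.1.coe_ne_zero)
  invFun z := (phase z, ⟨‖(z : ℂ)‖, norm_pos_iff.mpr z.ne_zero⟩)
  left_inv k := by
    have h0 : (0 : ℝ) < k.2 := k.2.2
    have h1 : ‖((k.2 : ℝ) : ℂ) * (k.1 : ℂ)‖ = k.2 := by
      rw [norm_mul, Circle.norm_coe, mul_one, Complex.norm_real, Real.norm_of_nonneg h0.le]
    refine Prod.ext (Circle.ext ?_) (Subtype.ext h1)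
    change ((k.2 : ℝ) : ℂ) * (k.1 : ℂ) / (‖((k.2 : ℝ) : ℂ) * (k.1 : ℂ)‖ : ℂ) = k.1
    rw [h1, mul_div_cancel_left₀ _ (Complex.ofReal_ne_zero.2 h0.ne')]
  right_inv z := by
    ext
    exact mul_div_cancel₀ _ (by simp)
  contMDiff_toFun := by
    refine ContMDiff.of_comp_isOpenEmbedding Units.isOpenEmbedding_val fun k ↦ ?_
    have h1 : ContMDiffAt ((𝓡 1).prod 𝓘(ℝ, ℝ)) 𝓘(ℝ, ℂ) ∞
        (fun k : Circle × posReal ↦ (k.1 : ℂ)) k :=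
      (contMDiff_coe_sphere.comp contMDiff_fst).contMDiffAt
    have h2 : ContMDiffAt ((𝓡 1).prod 𝓘(ℝ, ℝ)) 𝓘(ℝ, ℂ) ∞
        (fun k : Circle × posReal ↦ Complex.ofRealCLM (k.2 : ℝ)) k :=
      contMDiffAt_clm Complex.ofRealCLM (contMDiff_posReal_val.comp contMDiff_snd).contMDiffAt
    exact contMDiffAt_complex_mul h2 h1
  contMDiff_invFun := by
    exact contMDiff_phase.prodMk ((ContMDiff.subtypeVal_comp_iff posReal _).1 contMDiff_units_norm)

lemma stdAct_eq (N : Type*) : stdAct N = fiberAct N polar := by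
  funext z p
  have h0 : (0 : ℝ) < p.2.2 := p.2.2.2
  have h1 : polar (stdAct N z p).2 = z * polar p.2 := by
    ext
    change ((‖(z : ℂ)‖ * (p.2.2 : ℝ) : ℝ) : ℂ) * ((z : ℂ) / (‖(z : ℂ)‖ : ℂ) * (p.2.1 : ℂ)) =
      z * (((p.2.2 : ℝ) : ℂ) * (p.2.1 : ℂ))
    have : (‖(z : ℂ)‖ : ℂ) ≠ 0 := by simp
    push_cast
    field_simp
  refine Prod.ext rfl ?_
  rw [fiberAct, ← h1, polar.symm_apply_apply]

end Polar

end CProj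

end

theorem corollary3p16
    {E : Type*} [NormedAddCommGroup E] [NormedSpace ℝ E] [FiniteDimensional ℝ E] [CompleteSpace E]
    {N : Type*} [TopologicalSpace N] [ChartedSpace E N] [IsManifold 𝓘(ℝ, E) ∞ N]
    [T2Space N] [SigmaCompactSpace N]
    -- the real dimension of `N` is `2n ≥ 4`
    (n : ℕ) (hn : 2 ≤ n) (hdim : Module.finrank ℝ E = 2 * n)
    -- the complex structure `J` and the torsion-free complex connection `D`
    (J : CProj.EndField 𝓘(ℝ, E) N) (hJ : CProj.IsComplexStructure J)
    (D : CProj.AffConn 𝓘(ℝ, E) N) (hD : CProj.IsTorsionFreeComplex J D)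
    -- the symmetric tensor `B` anti-commuting with `J`
    (B : CProj.Tensor12 𝓘(ℝ, E) N) (hB : CProj.SmoothTensor12 B)
    (hBsymm : ∀ x u v, B x u v = B x v u)
    (hBJ : ∀ x u v, B x u (J x v) = - J x (B x u v))
    -- the symmetric tensor `c` with `J^* c = - c`
    (c : CProj.Tensor02 𝓘(ℝ, E) N) (hc : CProj.SmoothTensor02 c)
    (hcsymm : ∀ x u v, c x u v = c x v u)
    (hcJ : ∀ x u v, c x (J x u) (J x v) = - c x u v)
    -- the prescribed form of the c-projective Weyl curvature
    (hW : ∀ x u v w, CProj.weyl n J D x u v w =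
      - (1 / 4 : ℝ) • (B x u (B x v w) - B x v (B x u w))
      - (1 / (4 * ((n : ℝ) + 1)) * CProj.twist J (CProj.traceForm B) x u v) • J x w
      + (1 / (8 * ((n : ℝ) + 1))) • CProj.wedge (CProj.traceForm B) CProj.idEnd x u v w
      - (1 / (8 * ((n : ℝ) + 1))) • CProj.wedge (CProj.twist J (CProj.traceForm B)) J x u v w)
    -- the equation for `d^D a`
    (hda : ∀ x u v w, CProj.dForm2 D (CProj.fundForm n J D B) x u v w =
      - (1 / 4 : ℝ) * (c x u (B x v w) - c x v (B x u w)))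
    -- the one-form `γ` and the equations in which it occurs
    (γ : CProj.OneForm 𝓘(ℝ, E) N) (hγ : CProj.SmoothOneForm γ)
    (hdγ : ∀ x u v, CProj.extDerivOneForm γ x u v =
      2 * CProj.asymm (CProj.twist J (CProj.fundForm n J D B)) x u v)
    (hdB : ∀ x u v w, CProj.dTensor12 D B x u v w =
      - (2 : ℝ) • (γ x u • J x (B x v w) - γ x v • J x (B x u w))
      + CProj.wedge c.form CProj.idEnd x u v w
      + CProj.wedge (CProj.twist J c.form) J x u v w)
    (hdc : ∀ x u v w,
      CProj.fundForm n J D B x u (B x v w) - CProj.fundForm n J D B x v (B x u w)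
        + CProj.dForm2 D c.form x u v w =
      2 * (γ x u * c x v (J x w) - γ x v * c x u (J x w))) :
    ∃ (JM : CProj.EndField (CProj.totalModel E) (CProj.Total N))
      (nabla : CProj.AffConn (CProj.totalModel E) (CProj.Total N))
      (ξ : CProj.VField (CProj.totalModel E) (CProj.Total N)),
      CProj.IsProjectiveSpecialQuotient JM nabla ξ (CProj.stdAct N) Prod.fst J ∧
      CProj.canonicalCProj JM nabla (CProj.stdAct N) Prod.fst J = CProj.cprojClass J D := by
  obtain ⟨a, α, h⟩ := CProj.exists_structureEquations n J hJ D hD B hB hBsymm hBJ c hc hcsymm hcJ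
    hW hda γ hγ hdγ hdB hdc
  rw [CProj.stdAct_eq]
  exact ⟨_, _, _, CProj.isProjectiveSpecialQuotient h CProj.polar hJ,
    CProj.canonicalCProj_eq h CProj.polar hD⟩
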